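/- There is a deterministic algorithm on the real RAM that solves the following problem in $\widetilde{O}(n^{3/2})$ time, i.e. in $O(n^{3/2}\log^{c} n)$ operations in the worst case for some constant $c$. Given $n$ points $p_1,\dots,p_n\in\mathbb{R}^2$ and $n$ closed axis-aligned unit squares $r_1,\dots,r_n\subset\mathbb{R}^2$, where $r_i=[a_i,a_i+1]\times[b_i,b_i+1]$ is given by its lower left corner $(a_i,b_i)$, find indices $i,j,k\in\{1,\dots,n\}$ (not necessarily distinct) such that $\{p_1,\dots,p_n\}\subseteq r_i\cup r_j\cup r_k$, or report that there are none. Here the real RAM stores exact real numbers and words of $w\ge\kappa(\lfloor\log_2 n\rfloor+1)$ bits for a constant $\kappa$ that depends only on the algorithm (with $\lfloor\log_2 0\rfloor$ read as $0$). Unit-cost operations are $+,-,\times,\div$ and comparisons on reals, $+,-,\times,\lfloor\div\rfloor$ and comparisons on words (modulo $2^w$, with subtraction cut off at $0$), conversion of a word to a real number, and memory access at an address given by a word; reals cannot be rounded or converted to words, and division by $0$ gives $0$. The algorithm is one finite program, which works for all $n$ and all such $w$. -/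

import Mathlib

open Filter Asymptotics

/-! ## The real RAM

A unit-cost random access machine that holds words of `w` bits and exact real numbers, each kind
in registers and in memory.  Programs are written in structured form (assignment, sequence,
branch, loop); a program is a finite text that depends neither on the input nor on `w`.
There is no rounding and no conversion from reals to words. -/

namespace RealRAM

/-- Memory contents.  Registers and memory banks are named by literal numbers in the program text,
so a program uses finitely many of them; positions inside a bank are addressed by words. -/
structure State where
  wreg : ℕ → ℕ
  wmem : ℕ → ℕ → ℕ
  rreg : ℕ → ℝ
  rmem : ℕ → ℕ → ℝ

/-- Word-valued expressions. -/
inductive WExpr where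
  | const (c : ℕ)
  | reg (i : ℕ)
  | load (bank : ℕ) (addr : WExpr)
  | add (x y : WExpr)
  | sub (x y : WExpr)
  | mul (x y : WExpr)
  | div (x y : WExpr)

/-- Word arithmetic modulo `2 ^ w`; subtraction is cut off at `0`, division is rounded down and
division by `0` gives `0`. -/
def WExpr.eval (w : ℕ) (s : State) : WExpr → ℕ
  | .const c => c % 2 ^ w
  | .reg i => s.wreg i
  | .load b a => s.wmem b (a.eval w s)
  | .add x y => (x.eval w s + y.eval w s) % 2 ^ w
  | .sub x y => x.eval w s - y.eval w s
  | .mul x y => (x.eval w s * y.eval w s) % 2 ^ w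
  | .div x y => x.eval w s / y.eval w s

/-- The number of operations in a word-valued expression. -/
def WExpr.cost : WExpr → ℕ
  | .const _ => 1
  | .reg _ => 1
  | .load _ a => a.cost + 1
  | .add x y => x.cost + y.cost + 1
  | .sub x y => x.cost + y.cost + 1
  | .mul x y => x.cost + y.cost + 1
  | .div x y => x.cost + y.cost + 1

/-- Real-valued expressions. -/
inductive RExpr where
  | const (c : ℤ)
  | reg (i : ℕ)
  | load (bank : ℕ) (addr : WExpr)
  | ofWord (x : WExpr)
  | add (x y : RExpr)
  | sub (x y : RExpr)
  | mul (x y : RExpr)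
  | div (x y : RExpr)

/-- Exact real arithmetic; division by `0` gives `0`. -/
noncomputable def RExpr.eval (w : ℕ) (s : State) : RExpr → ℝ
  | .const c => (c : ℝ)
  | .reg i => s.rreg i
  | .load b a => s.rmem b (a.eval w s)
  | .ofWord x => (x.eval w s : ℝ)
  | .add x y => x.eval w s + y.eval w s
  | .sub x y => x.eval w s - y.eval w s
  | .mul x y => x.eval w s * y.eval w s
  | .div x y => x.eval w s / y.eval w s

/-- The number of operations in a real-valued expression. -/
def RExpr.cost : RExpr → ℕ
  | .const _ => 1
  | .reg _ => 1
  | .load _ a => a.cost + 1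
  | .ofWord x => x.cost + 1
  | .add x y => x.cost + y.cost + 1
  | .sub x y => x.cost + y.cost + 1
  | .mul x y => x.cost + y.cost + 1
  | .div x y => x.cost + y.cost + 1

/-- Tests: comparisons of words (`wlt`, `wle`) and of reals (`rlt`, `rle`), and their Boolean
combinations. -/
inductive Test where
  | wlt (x y : WExpr)
  | wle (x y : WExpr)
  | rlt (x y : RExpr)
  | rle (x y : RExpr)
  | neg (a : Test)
  | conj (a b : Test)

/-- The truth value of a test. -/
def Test.Holds (w : ℕ) (s : State) : Test → Prop
  | .wlt x y => x.eval w s < y.eval w s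
  | .wle x y => x.eval w s ≤ y.eval w s
  | .rlt x y => x.eval w s < y.eval w s
  | .rle x y => x.eval w s ≤ y.eval w s
  | .neg a => ¬ a.Holds w s
  | .conj a b => a.Holds w s ∧ b.Holds w s

/-- The number of operations in a test. -/
def Test.cost : Test → ℕ
  | .wlt x y => x.cost + y.cost + 1
  | .wle x y => x.cost + y.cost + 1
  | .rlt x y => x.cost + y.cost + 1
  | .rle x y => x.cost + y.cost + 1
  | .neg a => a.cost + 1
  | .conj a b => a.cost + b.cost + 1

/-- Programs. -/
inductive Prog where
  | skip
  | wset (i : ℕ) (x : WExpr)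
  | wstore (bank : ℕ) (addr : WExpr) (x : WExpr)
  | rset (i : ℕ) (x : RExpr)
  | rstore (bank : ℕ) (addr : WExpr) (x : RExpr)
  | seq (p q : Prog)
  | branch (b : Test) (p q : Prog)
  | loop (b : Test) (p : Prog)

/-- `Exec w p s t s'`: with words of `w` bits, the program `p` started in the state `s` terminates
after exactly `t` operations, in the state `s'`.  (`loop b p` repeats `p` as long as `b` holds.) -/
inductive Exec (w : ℕ) : Prog → State → ℕ → State → Prop where
  | skip (s : State) : Exec w .skip s 1 s
  | wset (s : State) (i : ℕ) (x : WExpr) :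
      Exec w (.wset i x) s (x.cost + 1)
        { s with wreg := Function.update s.wreg i (x.eval w s) }
  | wstore (s : State) (b : ℕ) (a x : WExpr) :
      Exec w (.wstore b a x) s (a.cost + x.cost + 1)
        { s with
          wmem := Function.update s.wmem b
            (Function.update (s.wmem b) (a.eval w s) (x.eval w s)) }
  | rset (s : State) (i : ℕ) (x : RExpr) :
      Exec w (.rset i x) s (x.cost + 1)
        { s with rreg := Function.update s.rreg i (x.eval w s) }
  | rstore (s : State) (b : ℕ) (a : WExpr) (x : RExpr) :
      Exec w (.rstore b a x) s (a.cost + x.cost + 1)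
        { s with
          rmem := Function.update s.rmem b
            (Function.update (s.rmem b) (a.eval w s) (x.eval w s)) }
  | seq {p q : Prog} {s s₁ s₂ : State} {t₁ t₂ : ℕ} :
      Exec w p s t₁ s₁ → Exec w q s₁ t₂ s₂ → Exec w (.seq p q) s (t₁ + t₂) s₂
  | branch_true {b : Test} {p q : Prog} {s s₁ : State} {t : ℕ} :
      b.Holds w s → Exec w p s t s₁ → Exec w (.branch b p q) s (b.cost + 1 + t) s₁
  | branch_false {b : Test} {p q : Prog} {s s₁ : State} {t : ℕ} :
      ¬ b.Holds w s → Exec w q s t s₁ → Exec w (.branch b p q) s (b.cost + 1 + t) s₁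
  | loop_done {b : Test} {p : Prog} {s : State} :
      ¬ b.Holds w s → Exec w (.loop b p) s (b.cost + 1) s
  | loop_step {b : Test} {p : Prog} {s s₁ s₂ : State} {t₁ t₂ : ℕ} :
      b.Holds w s → Exec w p s t₁ s₁ → Exec w (.loop b p) s₁ t₂ s₂ →
        Exec w (.loop b p) s (b.cost + 1 + t₁ + t₂) s₂

end RealRAM

/-! ## Covering points by three unit squares -/

/-- The closed axis-aligned unit square with lower left corner `c`. -/
def unitSquare (c : ℝ × ℝ) : Set (ℝ × ℝ) :=
  Set.Icc c.1 (c.1 + 1) ×ˢ Set.Icc c.2 (c.2 + 1)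

/-- The squares number `i`, `j`, `k` cover all the points; `R` lists the lower left corners of the
squares. -/
def CoverBy {n : ℕ} (P R : Fin n → ℝ × ℝ) (i j k : Fin n) : Prop :=
  Set.range P ⊆ unitSquare (R i) ∪ unitSquare (R j) ∪ unitSquare (R k)

/-- Entry `i` of a finite list of reals, and `0` beyond its end. -/
noncomputable def entry {n : ℕ} (f : Fin n → ℝ) (i : ℕ) : ℝ :=
  if h : i < n then f ⟨i, h⟩ else 0

/-- The initial state: `n` in word register `0`; in the real memory, the first and second
coordinates of the points in banks `0` and `1`, and those of the lower left corners of the squares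
in banks `2` and `3`; `0` everywhere else. -/
noncomputable def inputState {n : ℕ} (P R : Fin n → ℝ × ℝ) : RealRAM.State where
  wreg := fun i => if i = 0 then n else 0
  wmem := fun _ _ => 0
  rreg := fun _ => 0
  rmem := fun b =>
    if b = 0 then entry (fun i => (P i).1)
    else if b = 1 then entry (fun i => (P i).2)
    else if b = 2 then entry (fun i => (R i).1)
    else if b = 3 then entry (fun i => (R i).2)
    else fun _ => 0

/-- The final state holds a correct answer: either word register `0` is `1` and word registers
`1`, `2`, `3` hold the numbers of three squares that cover all the points, or word register `0`
is `0` and there are no such three squares. -/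
def CorrectAnswer {n : ℕ} (P R : Fin n → ℝ × ℝ) (s : RealRAM.State) : Prop :=
  (s.wreg 0 = 1 ∧
      ∃ i j k : Fin n, s.wreg 1 = i ∧ s.wreg 2 = j ∧ s.wreg 3 = k ∧ CoverBy P R i j k) ∨
    (s.wreg 0 = 0 ∧ ¬ ∃ i j k : Fin n, CoverBy P R i j k)

/-- `T n = Õ(f n)`: big-O up to a fixed power of `log n`. -/
def IsSoftO (T : ℕ → ℕ) (f : ℕ → ℝ) : Prop :=
  ∃ c : ℕ, (fun n => (T n : ℝ)) =O[atTop] fun n => f n * Real.log n ^ c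

/-! Only comparisons between numbers on the same axis matter. So the 3n numbers of each axis (the
coordinates of the points and both sides of each square) are replaced by their ranks, with equal
ranks for equal numbers. This is the only work done on reals and the only part that needs time
n^{3/2}: a selection sort that keeps the minima of about √n blocks. The common size of the squares
survives as the fact that left sides and right sides, and likewise lower and upper sides, are
ordered alike (`Instance.A_iff`, `Instance.B_iff`).

Geometry: sort three covering squares by abscissa and look at the order of their ordinates. Up to
reflections in the axes there are two cases (`not_covers_of_noHit`). If the squares increase in both
coordinates, then the middle one determines separately what the lower and the upper one must contain
(`MonoCond`), so these two can be chosen independently. Otherwise one square r is the lower left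
one, and of the other two i is the upper and j the right one. Then r must contain the points that
neither i nor j can contain; they are of three kinds (`Forced`). A finite set of points lies in one
lower left square as soon as any two of its points are `Feasible`, because only the largest abscissa
and the largest ordinate matter (`exists_lowerLeft`). Hence the existence of r becomes a condition
on pairs of kinds, and each such condition concerns i alone, or j alone, or compares a number
depending on i with a number depending on j (`PairCond`).

Finding a suitable j for every i is therefore a dominance query with fifteen constraints, and a
further dominance query finds r for i and the j just found. One j per i is enough: the only
condition missing from `PairCond` concerns i alone, and it holds whenever i is the upper square of
some solution.

Maxima under dominance constraints are computed with dyadic boxes. The interval [0, U) splits into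
dyadic intervals according to the binary digits of U, so an item belongs to polylogarithmically many
boxes and a query is a union of polylogarithmically many (`exists_cell_of_forall₂`,
`forall₂_of_cell`). A box is addressed directly by a word with two digits in base K = 3n + 3 for
each of at most fifteen constraints; this is where K^30 ≤ 2^w comes from, and it uses that memory is
zero at the start. Every array thus takes n times a power of log n operations. The whole search is a
fixed list of array commands, run on the instance and its three reflections; its correctness is
`coreSpec` and `commands_spec`. -/

namespace RealRAM

/-! ### Rules for total correctness with time bounds. -/

/-- Total correctness with a time bound: started in `s`, the program `p` terminates within `T`
operations in a state that satisfies `Q`. -/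
def Runs (w : ℕ) (p : Prog) (s : State) (T : ℕ) (Q : State → Prop) : Prop :=
  ∃ t s', t ≤ T ∧ Exec w p s t s' ∧ Q s'

/-- The state after writing a word register. -/
def State.setW (s : State) (i v : ℕ) : State :=
  { s with wreg := Function.update s.wreg i v }

/-- The state after writing a word of memory. -/
def State.setM (s : State) (b a v : ℕ) : State :=
  { s with wmem := Function.update s.wmem b (Function.update (s.wmem b) a v) }

/-- The state after writing a real of memory. -/
noncomputable def State.setRM (s : State) (b a : ℕ) (v : ℝ) : State :=
  { s with rmem := Function.update s.rmem b (Function.update (s.rmem b) a v) }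

section SetLemmas
variable (s : State) (i v j b a c : ℕ) (r : ℝ)

@[simp] theorem setW_wreg : (s.setW i v).wreg j = if j = i then v else s.wreg j := by
  simp [State.setW, Function.update_apply]
@[simp] theorem setW_wmem : (s.setW i v).wmem = s.wmem := rfl
@[simp] theorem setW_rreg : (s.setW i v).rreg = s.rreg := rfl
@[simp] theorem setW_rmem : (s.setW i v).rmem = s.rmem := rfl
@[simp] theorem setM_wreg : (s.setM b a v).wreg = s.wreg := rfl
@[simp] theorem setM_rreg : (s.setM b a v).rreg = s.rreg := rfl
@[simp] theorem setM_rmem : (s.setM b a v).rmem = s.rmem := rfl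
theorem setM_wmem_same : (s.setM b a v).wmem b c = if c = a then v else s.wmem b c := by
  simp [State.setM, Function.update_apply]
theorem setM_wmem_ne (h : c ≠ b) : (s.setM b a v).wmem c = s.wmem c := by
  simp [State.setM, h]
@[simp] theorem setRM_wreg : (s.setRM b a r).wreg = s.wreg := rfl
@[simp] theorem setRM_wmem : (s.setRM b a r).wmem = s.wmem := rfl
@[simp] theorem setRM_rreg : (s.setRM b a r).rreg = s.rreg := rfl
theorem setRM_rmem_same : (s.setRM b a r).rmem b c = if c = a then r else s.rmem b c := by
  simp [State.setRM, Function.update_apply]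
theorem setRM_rmem_ne (h : c ≠ b) : (s.setRM b a r).rmem c = s.rmem c := by
  simp [State.setRM, h]

end SetLemmas

namespace Runs
variable {w : ℕ} {p q : Prog} {s : State} {T T₁ T₂ : ℕ} {Q R : State → Prop}

theorem mono (h : Runs w p s T₁ R) (hT : T₁ ≤ T) (hQ : ∀ s', R s' → Q s') : Runs w p s T Q := by
  obtain ⟨t, s', ht, he, hr⟩ := h
  exact ⟨t, s', ht.trans hT, he, hQ _ hr⟩

theorem skip (hT : 1 ≤ T) (h : Q s) : Runs w .skip s T Q := ⟨1, s, hT, .skip s, h⟩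

theorem wset {i : ℕ} {x : WExpr} (hT : x.cost + 1 ≤ T) (h : Q (s.setW i (x.eval w s))) :
    Runs w (.wset i x) s T Q := ⟨_, _, hT, .wset s i x, h⟩

theorem wstore {b : ℕ} {a x : WExpr} (hT : a.cost + x.cost + 1 ≤ T)
    (h : Q (s.setM b (a.eval w s) (x.eval w s))) : Runs w (.wstore b a x) s T Q :=
  ⟨_, _, hT, .wstore s b a x, h⟩

theorem rstore {b : ℕ} {a : WExpr} {x : RExpr} (hT : a.cost + x.cost + 1 ≤ T)
    (h : Q (s.setRM b (a.eval w s) (x.eval w s))) : Runs w (.rstore b a x) s T Q :=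
  ⟨_, _, hT, .rstore s b a x, h⟩

theorem seq (T₁ T₂ : ℕ) (hT : T₁ + T₂ ≤ T) (h : Runs w p s T₁ fun s₁ => Runs w q s₁ T₂ Q) :
    Runs w (.seq p q) s T Q := by
  obtain ⟨t, s', ht, he, t', s'', ht', he', hq⟩ := h
  exact ⟨t + t', s'', by omega, .seq he he', hq⟩

theorem branch {b : Test} (hT : b.cost + 1 + T₁ ≤ T) (h₁ : b.Holds w s → Runs w p s T₁ Q)
    (h₂ : ¬ b.Holds w s → Runs w q s T₁ Q) : Runs w (.branch b p q) s T Q := by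
  by_cases hb : b.Holds w s
  · obtain ⟨t, s', ht, he, hq⟩ := h₁ hb
    exact ⟨_, s', by omega, .branch_true hb he, hq⟩
  · obtain ⟨t, s', ht, he, hq⟩ := h₂ hb
    exact ⟨_, s', by omega, .branch_false hb he, hq⟩

/-- A loop with a known number `N` of iterations. -/
theorem loop {b : Test} {B : ℕ} (N : ℕ) (Inv : ℕ → State → Prop)
    (hT : N * (B + b.cost + 1) + b.cost + 1 ≤ T) (h0 : Inv 0 s)
    (hstep : ∀ k < N, ∀ s, Inv k s → b.Holds w s ∧ Runs w p s B (Inv (k + 1)))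
    (hdone : ∀ s, Inv N s → ¬ b.Holds w s) (hQ : ∀ s, Inv N s → Q s) :
    Runs w (.loop b p) s T Q := by
  suffices H : ∀ d k s, k + d = N → Inv k s →
      Runs w (.loop b p) s (d * (B + b.cost + 1) + b.cost + 1) (Inv N) from
    (H N 0 s (by omega) h0).mono hT hQ
  intro d
  induction d with
  | zero =>
    intro k s hk hs
    obtain rfl : k = N := by omega
    exact ⟨_, s, by omega, .loop_done (hdone s hs), hs⟩
  | succ d ih =>
    intro k s hk hs
    obtain ⟨hb, t, s', ht, he, hi⟩ := hstep k (by omega) s hs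
    obtain ⟨t', s'', ht', he', hi'⟩ := ih (k + 1) s' (by omega) hi
    refine ⟨_, s'', ?_, .loop_step hb he he', hi'⟩
    rw [Nat.add_mul]; omega

end Runs

/-- `for i := 0 to hi - 1 do p`. -/
def forUp (i : ℕ) (hi : WExpr) (p : Prog) : Prog :=
  .seq (.wset i (.const 0))
    (.loop (.wlt (.reg i) hi) (.seq p (.wset i (.add (.reg i) (.const 1)))))

theorem Runs.forUp {w i : ℕ} {hi : WExpr} {p : Prog} {s : State} {T B : ℕ} {Q : State → Prop}
    (N : ℕ) (Inv : ℕ → State → Prop) (hN : N < 2 ^ w)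
    (hT : N * (B + hi.cost + 10) + hi.cost + 10 ≤ T)
    (h0 : Inv 0 (s.setW i 0))
    (hinv : ∀ k s, Inv k s → s.wreg i = k ∧ hi.eval w s = N)
    (hstep : ∀ k < N, ∀ s, Inv k s →
      Runs w p s B fun s' => s'.wreg i = k ∧ Inv (k + 1) (s'.setW i (k + 1)))
    (hQ : ∀ s, Inv N s → Q s) : Runs w (RealRAM.forUp i hi p) s T Q := by
  refine Runs.seq 2 (N * (B + hi.cost + 10) + hi.cost + 8) (by omega) ?_
  refine Runs.wset (by simp [WExpr.cost]) ?_
  refine Runs.loop (B := B + 4) N Inv (by simp [Test.cost, WExpr.cost]; nlinarith)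
    (by simpa [WExpr.eval] using h0) ?_ ?_ hQ
  · intro k hk s hs
    obtain ⟨h1, h2⟩ := hinv k s hs
    refine ⟨by simpa [Test.Holds, WExpr.eval, h1, h2] using hk, ?_⟩
    refine Runs.seq B 4 le_rfl ((hstep k hk s hs).mono le_rfl ?_)
    rintro s' ⟨hk', hi'⟩
    refine Runs.wset (by simp [WExpr.cost]) ?_
    have h3 : (1 : ℕ) % 2 ^ w = 1 := Nat.mod_eq_of_lt (by omega)
    have h4 : (k + 1) % 2 ^ w = k + 1 := Nat.mod_eq_of_lt (by omega)
    simpa [WExpr.eval, hk', h3, h4] using hi'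
  · intro s hs
    obtain ⟨h1, h2⟩ := hinv N s hs
    simp [Test.Holds, WExpr.eval, h1, h2]

/-- `for p := 1, 2, 4, … below the value of register 5 do q`. -/
def forPow (p : ℕ) (q : Prog) : Prog :=
  .seq (.wset p (.const 1))
    (.loop (.wlt (.reg p) (.reg 5)) (.seq q (.wset p (.add (.reg p) (.reg p)))))

/-- The loop variable overshoots K once, and its last value is below 2K; `hw` keeps this doubling
from wrapping around. -/
theorem Runs.forPow {w p K : ℕ} {q : Prog} {s : State} {T B : ℕ} {Q : State → Prop}
    (Inv : ℕ → State → Prop) (hK : 1 < K) (hw : 2 * K ≤ 2 ^ w)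
    (hT : Nat.clog 2 K * (B + 10) + 10 ≤ T)
    (h0 : Inv 0 (s.setW p 1))
    (hinv : ∀ k s, Inv k s → s.wreg p = 2 ^ k ∧ s.wreg 5 = K)
    (hstep : ∀ k, 2 ^ k < K → ∀ s, Inv k s →
      Runs w q s B fun s' => s'.wreg p = 2 ^ k ∧ Inv (k + 1) (s'.setW p (2 ^ (k + 1))))
    (hQ : ∀ s k, K ≤ 2 ^ k → Inv k s → Q s) : Runs w (RealRAM.forPow p q) s T Q := by
  have hlt : ∀ k, k < Nat.clog 2 K → 2 ^ k < K := fun k hk => by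
    exact (Nat.lt_clog_iff_pow_lt (by norm_num)).1 hk
  have hge : K ≤ 2 ^ Nat.clog 2 K := Nat.le_pow_clog (by norm_num) K
  refine Runs.seq 2 (Nat.clog 2 K * (B + 10) + 8) (by omega) ?_
  have h3 : (1 : ℕ) % 2 ^ w = 1 := Nat.mod_eq_of_lt (by omega)
  refine Runs.wset (by simp [WExpr.cost]) ?_
  refine Runs.loop (B := B + 4) (Nat.clog 2 K) Inv (by simp [Test.cost, WExpr.cost]; nlinarith)
    (by simpa [WExpr.eval, h3] using h0) ?_ ?_ (fun s hs => hQ s _ hge hs)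
  · intro k hk s hs
    obtain ⟨h1, h2⟩ := hinv k s hs
    refine ⟨by simpa [Test.Holds, WExpr.eval, h1, h2] using hlt k hk, ?_⟩
    refine Runs.seq B 4 le_rfl ((hstep k (hlt k hk) s hs).mono le_rfl ?_)
    rintro s' ⟨hk', hi'⟩
    refine Runs.wset (by simp [WExpr.cost]) ?_
    have h4 : (2 ^ k + 2 ^ k) % 2 ^ w = 2 ^ (k + 1) := by
      rw [Nat.mod_eq_of_lt (by have := hlt k hk; omega)]; ring
    simpa [WExpr.eval, hk', h4] using hi'
  · intro s hs
    obtain ⟨h1, h2⟩ := hinv _ s hs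
    simpa [Test.Holds, WExpr.eval, h1, h2] using hge

end RealRAM

namespace RealRAM

/-! ### Dominance queries by dyadic cells -/

/-- The interval [0, U) is a union of dyadic intervals, one for every binary digit 1 of U: the digit
number l contributes the interval of length 2^l with index U / 2^l - 1. Halving both numbers reduces
U, except when U is odd and u = U - 1, where l = 0 works. -/
theorem exists_dyadic_of_lt {u U : ℕ} (h : u < U) :
    ∃ l, U / 2 ^ l % 2 = 1 ∧ u / 2 ^ l = U / 2 ^ l - 1 := by
  induction U using Nat.strong_induction_on generalizing u with
  | _ U ih =>
    by_cases h0 : U % 2 = 1 ∧ u = U - 1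
    · exact ⟨0, by simpa using h0.1, by simpa using h0.2⟩
    · obtain ⟨l, h1, h2⟩ := ih (U / 2) (by omega) (u := u / 2) (by omega)
      refine ⟨l + 1, ?_, ?_⟩
      · rwa [pow_succ', ← Nat.div_div_eq_div_mul]
      · rwa [pow_succ', ← Nat.div_div_eq_div_mul, ← Nat.div_div_eq_div_mul]

theorem lt_of_dyadic {u U l : ℕ} (h1 : U / 2 ^ l % 2 = 1) (h2 : u / 2 ^ l = U / 2 ^ l - 1) :
    u < U := by
  by_contra h
  have := Nat.div_le_div_right (c := 2 ^ l) (not_lt.1 h)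
  generalize U / 2 ^ l = x at *
  omega

/-- `Cell K acc us a`: the address `a` belongs to one of the dyadic boxes that contain the point
with coordinates `us`; `acc` is the part of the address that has been fixed already. -/
def Cell (K : ℕ) : ℕ → List ℕ → ℕ → Prop
  | acc, [], a => a = acc
  | acc, u :: us, a => ∃ l, 2 ^ l < K ∧ Cell K ((acc * K + 2 ^ l) * K + u / 2 ^ l) us a

/-- `QueryCell K acc Us a`: the address `a` belongs to one of the dyadic boxes into which the
box of all points below `Us` is decomposed. -/
def QueryCell (K : ℕ) : ℕ → List ℕ → ℕ → Prop
  | acc, [], a => a = acc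
  | acc, U :: Us, a => ∃ l, 2 ^ l < K ∧ U / 2 ^ l % 2 = 1 ∧
      QueryCell K ((acc * K + 2 ^ l) * K + (U / 2 ^ l - 1)) Us a

theorem digits_inj {K acc acc' p p' q q' : ℕ} (hp : p < K) (hp' : p' < K) (hq : q < K)
    (hq' : q' < K) (h : (acc * K + p) * K + q = (acc' * K + p') * K + q') :
    acc = acc' ∧ p = p' ∧ q = q' := by
  have key : ∀ {x x' y y' : ℕ}, y < K → y' < K → x * K + y = x' * K + y' → x = x' ∧ y = y' := by
    intro x x' y y' hy hy' h
    have hK : 0 < K := by omega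
    have h1 : (x * K + y) / K = x := by
      rw [Nat.mul_comm, Nat.mul_add_div hK, Nat.div_eq_of_lt hy, add_zero]
    have h2 : (x' * K + y') / K = x' := by
      rw [Nat.mul_comm, Nat.mul_add_div hK, Nat.div_eq_of_lt hy', add_zero]
    have hx : x = x' := by rw [← h1, h, h2]
    subst hx
    exact ⟨rfl, by omega⟩
  obtain ⟨h1, h2⟩ := key hq hq' h
  obtain ⟨h3, h4⟩ := key hp hp' h1
  exact ⟨h3, h4, h2⟩

/-- An address determines its digits in base K, hence the level and the index of the dyadic interval
in every coordinate. A cell shared by an item and a query thus certifies dominance coordinate by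
coordinate. -/
theorem forall₂_of_cell {K : ℕ} : ∀ {us Us : List ℕ} {acc acc' a : ℕ}, us.length = Us.length →
    (∀ u ∈ us, u < K) → (∀ U ∈ Us, U < K) → Cell K acc us a → QueryCell K acc' Us a →
    acc = acc' ∧ List.Forall₂ (· < ·) us Us
  | [], [], acc, acc', a, _, _, _, h, h' => by
    simp only [Cell, QueryCell] at h h'
    exact ⟨h.symm.trans h', .nil⟩
  | [], _ :: _, _, _, _, h, _, _, _, _ => by simp at h
  | _ :: _, [], _, _, _, h, _, _, _, _ => by simp at h
  | u :: us, U :: Us, acc, acc', a, hl, hu, hU, h, h' => by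
    obtain ⟨l, hl1, h1⟩ := h
    obtain ⟨l', hl1', hl2', h1'⟩ := h'
    have hu' : u < K := hu u (by simp)
    have hU' : U < K := hU U (by simp)
    obtain ⟨e, hf⟩ := forall₂_of_cell (by simpa using hl) (fun v hv => hu v (by simp [hv]))
      (fun v hv => hU v (by simp [hv])) h1 h1'
    have b1 : u / 2 ^ l < K := (Nat.div_le_self _ _).trans_lt hu'
    have b2 : U / 2 ^ l' - 1 < K :=
      ((Nat.sub_le _ _).trans (Nat.div_le_self _ _)).trans_lt hU'
    obtain ⟨e1, e2, e3⟩ := digits_inj hl1 hl1' b1 b2 e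
    have : l = l' := Nat.pow_right_injective le_rfl e2
    subst this
    exact ⟨e1, .cons (lt_of_dyadic hl2' e3) hf⟩

/-- Existence of a common cell is enough, because only maxima are taken and counting an item twice
would do no harm. -/
theorem exists_cell_of_forall₂ {K : ℕ} {us Us : List ℕ} (h : List.Forall₂ (· < ·) us Us) :
    (∀ U ∈ Us, U < K) → ∀ acc, ∃ a, Cell K acc us a ∧ QueryCell K acc Us a := by
  induction h with
  | nil => exact fun _ acc => ⟨acc, rfl, rfl⟩
  | @cons u U us Us huU _ ih =>
    intro hU acc
    obtain ⟨l, h1, h2⟩ := exists_dyadic_of_lt huU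
    have h3 : 2 ^ l < K := by
      refine lt_of_le_of_lt ?_ (hU U (by simp))
      by_contra h4
      rw [Nat.div_eq_of_lt (not_le.1 h4)] at h1
      simp at h1
    obtain ⟨a, h4, h5⟩ := ih (fun v hv => hU v (by simp [hv]))
      ((acc * K + 2 ^ l) * K + (U / 2 ^ l - 1))
    exact ⟨a, ⟨l, h3, h2 ▸ h4⟩, ⟨l, h3, h1, h5⟩⟩

/-! ### Tables of dyadic cells: insertion and query programs. -/

/-- `Same R B s s'`: the states agree on the word registers in `R`, on the word memory banks in
`B`, and on everything real. -/
structure Same (R B : ℕ → Prop) (s s' : State) : Prop where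
  wreg : ∀ r, R r → s'.wreg r = s.wreg r
  wmem : ∀ b, B b → s'.wmem b = s.wmem b
  rreg : s'.rreg = s.rreg
  rmem : s'.rmem = s.rmem

theorem Same.refl (R B : ℕ → Prop) (s : State) : Same R B s s :=
  ⟨fun _ _ => rfl, fun _ _ => rfl, rfl, rfl⟩

theorem Same.trans {R B : ℕ → Prop} {s s' s'' : State} (h : Same R B s s')
    (h' : Same R B s' s'') : Same R B s s'' :=
  ⟨fun r hr => (h'.wreg r hr).trans (h.wreg r hr), fun b hb => (h'.wmem b hb).trans (h.wmem b hb),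
    h'.rreg.trans h.rreg, h'.rmem.trans h.rmem⟩

theorem Same.weaken {R B R' B' : ℕ → Prop} {s s' : State} (h : Same R B s s')
    (hR : ∀ r, R' r → R r) (hB : ∀ b, B' b → B b) : Same R' B' s s' :=
  ⟨fun r hr => h.wreg r (hR r hr), fun b hb => h.wmem b (hB b hb), h.rreg, h.rmem⟩

theorem Same.setW {R B : ℕ → Prop} {s s' : State} (h : Same R B s s') {i v : ℕ} (hi : ¬ R i) :
    Same R B s (s'.setW i v) :=
  ⟨fun r hr => by
    have : r ≠ i := fun e => hi (e ▸ hr)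
    simp [this, h.wreg r hr], h.wmem, h.rreg, h.rmem⟩

theorem Same.setM {R B : ℕ → Prop} {s s' : State} (h : Same R B s s') {b a v : ℕ} (hb : ¬ B b) :
    Same R B s (s'.setM b a v) :=
  ⟨h.wreg, fun c hc => by
    have : c ≠ b := fun e => hb (e ▸ hc)
    rw [setM_wmem_ne _ _ _ _ _ this, h.wmem c hc], h.rreg, h.rmem⟩

/-- The address that continues the one of nesting depth `d`, which is in register `20 + 2 * d`;
register `21 + 2 * d` is the loop variable of this depth, a power of two. -/
def nextAddr (d : ℕ) (x : WExpr) : WExpr :=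
  .add (.mul (.add (.mul (.reg (20 + 2 * d)) (.reg 5)) (.reg (21 + 2 * d))) (.reg 5)) x

/-- Each nesting depth appends two digits in base K, so addresses of depth d stay below K^(2d) and
word arithmetic on them is exact. -/
theorem nextAddr_bound {K d acc p e : ℕ} (hacc : acc < K ^ (2 * d)) (hp : p < K) (he : e < K) :
    (acc * K + p) * K + e < K ^ (2 * (d + 1)) := by
  have h1 : acc * K + p < K ^ (2 * d) * K := by nlinarith
  have h2 : (acc * K + p) * K + e < K ^ (2 * d) * K * K := by nlinarith
  calc _ < K ^ (2 * d) * K * K := h2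
    _ = K ^ (2 * (d + 1)) := by ring

theorem nextAddr_eval {w K d e : ℕ} {x : WExpr} {s : State} (h5 : s.wreg 5 = K)
    (hacc : s.wreg (20 + 2 * d) < K ^ (2 * d)) (hp : s.wreg (21 + 2 * d) < K) (hx : x.eval w s = e)
    (he : e < K) (hw : K ^ (2 * (d + 1)) ≤ 2 ^ w) :
    (nextAddr d x).eval w s = (s.wreg (20 + 2 * d) * K + s.wreg (21 + 2 * d)) * K + e := by
  have h2 := nextAddr_bound hacc hp he
  have h3 : s.wreg (20 + 2 * d) * K + s.wreg (21 + 2 * d) ≤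
      (s.wreg (20 + 2 * d) * K + s.wreg (21 + 2 * d)) * K := Nat.le_mul_of_pos_right _ (by omega)
  simp only [nextAddr, WExpr.eval, hx, h5]
  rw [Nat.mod_eq_of_lt (a := s.wreg (20 + 2 * d) * K) (by omega),
    Nat.mod_eq_of_lt (a := s.wreg (20 + 2 * d) * K + s.wreg (21 + 2 * d)) (by omega),
    Nat.mod_eq_of_lt (a := (s.wreg (20 + 2 * d) * K + s.wreg (21 + 2 * d)) * K) (by omega),
    Nat.mod_eq_of_lt (by omega)]

/-- Enter the value of register `8` into the cells of the item number `reg 7`, whose coordinates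
are in the given banks. -/
def insProg (tb : ℕ) : List ℕ → ℕ → Prog
  | [], d => .branch (.wlt (.load tb (.reg (20 + 2 * d))) (.reg 8))
      (.wstore tb (.reg (20 + 2 * d)) (.reg 8)) .skip
  | k :: ks, d => forPow (21 + 2 * d)
      (.seq (.wset (20 + 2 * (d + 1)) (nextAddr d (.div (.load k (.reg 7)) (.reg (21 + 2 * d)))))
        (insProg tb ks (d + 1)))

/-- A bound for the running time of `insProg` and `qryProg`. -/
def nestCost (L : ℕ) : ℕ → ℕ
  | 0 => 20
  | k + 1 => L * (nestCost L k + 60) + 10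

/-- A cell holds a maximum, and it is described by its upper bounds B. In this form the nested loops
merely accumulate conjunctions. -/
theorem runs_insProg {w K tb i : ℕ} (hK : 1 < K) (hw2 : 2 * K ≤ 2 ^ w) :
    ∀ (ks : List ℕ) (d : ℕ) (s : State), s.wreg 5 = K → s.wreg 7 = i → (∀ k ∈ ks, k ≠ tb) →
    (∀ k ∈ ks, s.wmem k i < K) → s.wreg (20 + 2 * d) < K ^ (2 * d) →
    K ^ (2 * (d + ks.length)) ≤ 2 ^ w →
    Runs w (insProg tb ks d) s (nestCost (Nat.clog 2 K) ks.length) fun s' =>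
      Same (· < 21 + 2 * d) (· ≠ tb) s s' ∧
      ∀ a B, s'.wmem tb a ≤ B ↔ s.wmem tb a ≤ B ∧
        (Cell K (s.wreg (20 + 2 * d)) (ks.map fun k => s.wmem k i) a → s.wreg 8 ≤ B)
  | [], d, s, h5, h7, hk, hb, hacc, hw => by
    refine Runs.branch (T₁ := 5) (by simp [Test.cost, WExpr.cost, nestCost]) (fun h => ?_)
      (fun h => ?_)
    · refine Runs.wstore (by simp [WExpr.cost]) ⟨(Same.refl _ _ s).setM (by simp), fun a B => ?_⟩
      simp only [Test.Holds, WExpr.eval] at h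
      rw [setM_wmem_same]
      simp only [List.map_nil, Cell, WExpr.eval]
      split_ifs with ha
      · subst ha
        simp only [if_true, forall_const]
        omega
      · simp [ha]
    · refine Runs.skip (by simp) ⟨Same.refl _ _ s, fun a B => ?_⟩
      simp only [Test.Holds, WExpr.eval] at h
      simp only [List.map_nil, Cell]
      refine ⟨fun h1 => ⟨h1, ?_⟩, fun h1 => h1.1⟩
      rintro rfl
      omega
  | k :: ks, d, s, h5, h7, hk, hb, hacc, hw => by
    have hw1 : K ^ (2 * (d + 1)) ≤ 2 ^ w :=
      (Nat.pow_le_pow_right (by omega) (by simp only [List.length_cons]; omega)).trans hw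
    refine Runs.forPow (K := K) (B := nestCost (Nat.clog 2 K) ks.length + 20)
      (Inv := fun l s' => Same (· < 21 + 2 * d) (· ≠ tb) s s' ∧ s'.wreg (21 + 2 * d) = 2 ^ l ∧
        ∀ a B, s'.wmem tb a ≤ B ↔ s.wmem tb a ≤ B ∧ ∀ l' < l, 2 ^ l' < K →
          Cell K ((s.wreg (20 + 2 * d) * K + 2 ^ l') * K + s.wmem k i / 2 ^ l')
            (ks.map fun k => s.wmem k i) a → s.wreg 8 ≤ B)
      hK hw2 ?_ ?_ ?_ ?_ ?_
    · simp only [nestCost, List.length_cons]; nlinarith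
    · exact ⟨(Same.refl _ _ s).setW (by simp), by simp, by simp⟩
    · rintro l s' ⟨hs, hp, -⟩
      exact ⟨hp, (hs.wreg 5 (by omega)).trans h5⟩
    · rintro l hl s' ⟨hs, hp, ht⟩
      refine Runs.seq 20 (nestCost (Nat.clog 2 K) ks.length) (by omega) ?_
      have e5 : s'.wreg 5 = K := (hs.wreg 5 (by omega)).trans h5
      have e7 : s'.wreg 7 = i := (hs.wreg 7 (by omega)).trans h7
      have ea : s'.wreg (20 + 2 * d) = s.wreg (20 + 2 * d) := hs.wreg _ (by simp)
      have ek : ∀ k' ∈ k :: ks, s'.wmem k' = s.wmem k' := fun k' hk' => hs.wmem k' (hk k' hk')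
      have hlt : s.wmem k i / 2 ^ l < K := (Nat.div_le_self _ _).trans_lt (hb k (by simp))
      have ev := nextAddr_eval (w := w) (s := s') (d := d)
        (x := .div (.load k (.reg 7)) (.reg (21 + 2 * d))) (e := s.wmem k i / 2 ^ l) e5
        (by rwa [ea]) (by rwa [hp])
        (by simp only [WExpr.eval, e7, hp, ek k (by simp)]) hlt hw1
      rw [ea, hp] at ev
      refine Runs.wset (by simp [nextAddr, WExpr.cost]) ?_
      rw [ev]
      set s1 := s'.setW (20 + 2 * (d + 1)) ((s.wreg (20 + 2 * d) * K + 2 ^ l) * K + s.wmem k i / 2 ^ l)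
        with hs1
      have hs1s : Same (· < 22 + 2 * d) (fun _ => True) s' s1 :=
        (Same.refl _ _ s').setW (by simp; omega)
      have eacc : s1.wreg (20 + 2 * (d + 1)) =
        (s.wreg (20 + 2 * d) * K + 2 ^ l) * K + s.wmem k i / 2 ^ l := by simp [hs1]
      have e8 : s1.wreg 8 = s.wreg 8 := (hs1s.wreg 8 (by omega)).trans (hs.wreg 8 (by omega))
      have em : ∀ k' ∈ k :: ks, s1.wmem k' i = s.wmem k' i := fun k' hk' => by
        rw [hs1s.wmem k' trivial, ek k' hk']
      refine (runs_insProg hK hw2 ks (d + 1) s1 ((hs1s.wreg 5 (by omega)).trans e5)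
        ((hs1s.wreg 7 (by omega)).trans e7) (fun k' hk' => hk k' (by simp [hk']))
        (fun k' hk' => by rw [em k' (by simp [hk'])]; exact hb k' (by simp [hk']))
        (by rw [eacc]; exact nextAddr_bound hacc hl hlt)
        (by simp only [List.length_cons] at hw; convert hw using 3; ring)).mono le_rfl ?_
      rintro s2 ⟨hs2, ht2⟩
      have hp2 : s2.wreg (21 + 2 * d) = 2 ^ l := by
        rw [hs2.wreg _ (by omega), hs1s.wreg _ (by omega), hp]
      refine ⟨hp2, ⟨?_, by simp, fun a B => ?_⟩⟩
      · refine (hs.trans ((hs1s.weaken ?_ ?_).trans (hs2.weaken ?_ ?_))).setW (by simp) <;>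
          intros <;> first | omega | trivial
      · have emap : (ks.map fun k => s1.wmem k i) = ks.map fun k => s.wmem k i :=
          List.map_congr_left fun k' hk' => em k' (by simp [hk'])
        rw [setW_wmem, ht2, hs1s.wmem tb trivial, ht, eacc, e8, emap, and_assoc]
        refine and_congr_right fun _ => ⟨?_, fun h => ⟨fun l' hl' => h l' (by omega),
          fun hc => h l (by omega) hl hc⟩⟩
        rintro ⟨h1, h2⟩ l' hl' hl2 hc
        rcases Nat.lt_succ_iff_lt_or_eq.1 hl' with h | rfl
        · exact h1 l' h hl2 hc
        · exact h2 hc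
    · rintro s' l hl ⟨hs, hp, ht⟩
      refine ⟨hs, fun a B => ?_⟩
      rw [ht]
      simp only [List.map_cons, Cell]
      refine and_congr_right fun _ => ⟨?_, fun h l' _ hl' hc => h ⟨l', hl', hc⟩⟩
      rintro h ⟨l', hl', hc⟩
      refine h l' ?_ hl' hc
      by_contra hcon
      have := Nat.pow_le_pow_right (n := 2) (by norm_num) (not_lt.1 hcon)
      omega

/-- The bound number `(b, f)` of the query `reg 7`, in units of `reg (21 + 2 * d)`. -/
def qryBound (b f d : ℕ) : WExpr := .div (.add (.load b (.reg 7)) (.const f)) (.reg (21 + 2 * d))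

/-- Raise register `9` to the maximum of the cells into which the box of the query number `reg 7`
is decomposed; the bounds are in the given banks, to be increased by the given constants. -/
def qryProg (tb : ℕ) : List (ℕ × ℕ) → ℕ → Prog
  | [], d => .branch (.wlt (.reg 9) (.load tb (.reg (20 + 2 * d))))
      (.wset 9 (.load tb (.reg (20 + 2 * d)))) .skip
  | b :: bs, d => forPow (21 + 2 * d)
      (.branch (.wlt (.mul (.const 2) (.div (qryBound b.1 b.2 d) (.const 2)))
          (qryBound b.1 b.2 d))
        (.seq (.wset (20 + 2 * (d + 1)) (nextAddr d (.sub (qryBound b.1 b.2 d) (.const 1))))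
          (qryProg tb bs (d + 1)))
        .skip)

theorem runs_qryProg {w K tb i : ℕ} (hK : 2 < K) (hw2 : 2 * K ≤ 2 ^ w) :
    ∀ (bs : List (ℕ × ℕ)) (d : ℕ) (s : State), s.wreg 5 = K → s.wreg 7 = i →
    (∀ b ∈ bs, s.wmem b.1 i + b.2 < K) → s.wreg (20 + 2 * d) < K ^ (2 * d) →
    K ^ (2 * (d + bs.length)) ≤ 2 ^ w →
    Runs w (qryProg tb bs d) s (nestCost (Nat.clog 2 K) bs.length) fun s' =>
      Same (fun r => r < 21 + 2 * d ∧ r ≠ 9) (fun _ => True) s s' ∧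
      ∀ B, s'.wreg 9 ≤ B ↔ s.wreg 9 ≤ B ∧
        ∀ a, QueryCell K (s.wreg (20 + 2 * d)) (bs.map fun b => s.wmem b.1 i + b.2) a →
          s.wmem tb a ≤ B
  | [], d, s, h5, h7, hb, hacc, hw => by
    refine Runs.branch (T₁ := 5) (by simp [Test.cost, WExpr.cost, nestCost]) (fun h => ?_)
      (fun h => ?_)
    · refine Runs.wset (by simp [WExpr.cost]) ⟨(Same.refl _ _ s).setW (by simp), fun B => ?_⟩
      simp only [Test.Holds, WExpr.eval] at h
      simp only [List.map_nil, QueryCell, WExpr.eval, setW_wreg, if_true, forall_eq]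
      omega
    · refine Runs.skip (by simp) ⟨Same.refl _ _ s, fun B => ?_⟩
      simp only [Test.Holds, WExpr.eval] at h
      simp only [List.map_nil, QueryCell, forall_eq]
      omega
  | b :: bs, d, s, h5, h7, hb, hacc, hw => by
    have hw1 : K ^ (2 * (d + 1)) ≤ 2 ^ w :=
      (Nat.pow_le_pow_right (by omega) (by simp only [List.length_cons]; omega)).trans hw
    refine Runs.forPow (K := K) (B := nestCost (Nat.clog 2 K) bs.length + 50)
      (Inv := fun l s' => Same (fun r => r < 21 + 2 * d ∧ r ≠ 9) (fun _ => True) s s' ∧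
        s'.wreg (21 + 2 * d) = 2 ^ l ∧
        ∀ B, s'.wreg 9 ≤ B ↔ s.wreg 9 ≤ B ∧ ∀ l' < l, 2 ^ l' < K →
          (s.wmem b.1 i + b.2) / 2 ^ l' % 2 = 1 → ∀ a,
          QueryCell K ((s.wreg (20 + 2 * d) * K + 2 ^ l') * K + ((s.wmem b.1 i + b.2) / 2 ^ l' - 1))
            (bs.map fun b => s.wmem b.1 i + b.2) a → s.wmem tb a ≤ B)
      (by omega) hw2 ?_ ?_ ?_ ?_ ?_
    · simp only [nestCost, List.length_cons]; nlinarith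
    · refine ⟨(Same.refl _ _ s).setW (by simp), by simp, ?_⟩
      have : ¬ (9 = (21 + 2 * d)) := by omega
      simp [this]
    · rintro l s' ⟨hs, hp, -⟩
      exact ⟨hp, (hs.wreg 5 (by omega)).trans h5⟩
    · rintro l hl s' ⟨hs, hp, ht⟩
      have e5 : s'.wreg 5 = K := (hs.wreg 5 (by omega)).trans h5
      have e7 : s'.wreg 7 = i := (hs.wreg 7 (by omega)).trans h7
      have ea : s'.wreg (20 + 2 * d) = s.wreg (20 + 2 * d) := hs.wreg _ (by simp; omega)
      have hbK := hb b (by simp)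
      set U := s.wmem b.1 i + b.2 with hU
      have eU : (qryBound b.1 b.2 d).eval w s' = U / 2 ^ l := by
        simp only [qryBound, WExpr.eval, e7, hp, hs.wmem _ trivial]
        rw [Nat.mod_eq_of_lt (a := b.2) (by omega), Nat.mod_eq_of_lt (by omega)]
      have hUl : U / 2 ^ l ≤ U := Nat.div_le_self _ _
      -- There is no remainder operation on words; oddness of x is tested as 2 * (x / 2) < x.
      have htest : Test.Holds w s' (.wlt (.mul (.const 2) (.div (qryBound b.1 b.2 d) (.const 2)))
          (qryBound b.1 b.2 d)) ↔ U / 2 ^ l % 2 = 1 := by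
        simp only [Test.Holds, WExpr.eval, eU]
        rw [Nat.mod_eq_of_lt (a := 2) (by omega), Nat.mod_eq_of_lt (by omega)]
        omega
      refine Runs.branch (T₁ := nestCost (Nat.clog 2 K) bs.length + 30)
        (by simp [Test.cost, WExpr.cost, qryBound]; omega) (fun h => ?_) (fun h => ?_)
      · rw [htest] at h
        refine Runs.seq 30 (nestCost (Nat.clog 2 K) bs.length) (by omega) ?_
        have hlt : U / 2 ^ l - 1 < K := by omega
        have ev := nextAddr_eval (w := w) (s := s') (d := d)
          (x := .sub (qryBound b.1 b.2 d) (.const 1)) (e := U / 2 ^ l - 1) e5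
          (by rwa [ea]) (by rwa [hp])
          (by simp only [WExpr.eval, eU]; rw [Nat.mod_eq_of_lt (a := 1) (by omega)]) hlt hw1
        rw [ea, hp] at ev
        refine Runs.wset (by simp [nextAddr, qryBound, WExpr.cost]) ?_
        rw [ev]
        set s1 := s'.setW (20 + 2 * (d + 1)) ((s.wreg (20 + 2 * d) * K + 2 ^ l) * K + (U / 2 ^ l - 1))
          with hs1
        have hs1s : Same (· < 22 + 2 * d) (fun _ => True) s' s1 :=
          (Same.refl _ _ s').setW (by simp; omega)
        have eacc : s1.wreg (20 + 2 * (d + 1)) =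
          (s.wreg (20 + 2 * d) * K + 2 ^ l) * K + (U / 2 ^ l - 1) := by simp [hs1]
        have em : ∀ k', s1.wmem k' = s.wmem k' := fun k' => by
          rw [hs1s.wmem k' trivial, hs.wmem k' trivial]
        refine (runs_qryProg hK hw2 bs (d + 1) s1 ((hs1s.wreg 5 (by omega)).trans e5)
          ((hs1s.wreg 7 (by omega)).trans e7)
          (fun k' hk' => by rw [em k'.1]; exact hb k' (by simp [hk']))
          (by rw [eacc]; exact nextAddr_bound hacc hl hlt)
          (by simp only [List.length_cons] at hw; convert hw using 3; ring)).mono le_rfl ?_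
        rintro s2 ⟨hs2, ht2⟩
        have hp2 : s2.wreg (21 + 2 * d) = 2 ^ l := by
          rw [hs2.wreg _ (by omega), hs1s.wreg _ (by omega), hp]
        have h9 : ¬ (9 = (21 + 2 * d)) := by omega
        refine ⟨hp2, ⟨?_, by simp, fun B => ?_⟩⟩
        · refine (hs.trans ((hs1s.weaken ?_ ?_).trans (hs2.weaken ?_ ?_))).setW (by simp) <;>
            intros <;> omega
        · rw [setW_wreg, if_neg h9, ht2, hs1s.wreg 9 (by omega), ht, eacc, em tb]
          simp only [em, and_assoc]
          refine and_congr_right fun _ => ⟨?_, fun h => ⟨fun l' hl' => h l' (by omega),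
            fun a hc => h l (by omega) hl ‹_› a hc⟩⟩
          rintro ⟨h1, h2⟩ l' hl' hl2 hod a hc
          rcases Nat.lt_succ_iff_lt_or_eq.1 hl' with h | rfl
          · exact h1 l' h hl2 hod a hc
          · exact h2 a hc
      · rw [htest] at h
        have h9 : ¬ (9 = (21 + 2 * d)) := by omega
        refine Runs.skip (by omega) ⟨hp, hs.setW (by simp), by simp, fun B => ?_⟩
        rw [setW_wreg, if_neg h9, ht]
        refine and_congr_right fun _ => ⟨?_, fun h l' hl' => h l' (by omega)⟩
        rintro h1 l' hl' hl2 hod a hc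
        rcases Nat.lt_succ_iff_lt_or_eq.1 hl' with h' | rfl
        · exact h1 l' h' hl2 hod a hc
        · exact absurd hod h
    · rintro s' l hl ⟨hs, hp, ht⟩
      refine ⟨hs, fun B => ?_⟩
      rw [ht]
      simp only [List.map_cons, QueryCell]
      refine and_congr_right fun _ => ⟨?_, fun h l' _ hl' hod a hc => h a ⟨l', hl', hod, hc⟩⟩
      rintro h a ⟨l', hl', hod, hc⟩
      refine h l' ?_ hl' hod a hc
      by_contra hcon
      have := Nat.pow_le_pow_right (n := 2) (by norm_num) (not_lt.1 hcon)
      omega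

end RealRAM

namespace RealRAM

/-! ### A small language of array commands -/

/-- Commands that compute one array of `n` words from arrays computed before. -/
inductive Cmd where
  /-- For every `i` the maximum of the entries `v j` over all `j` with `k j < b i + f` for all
  `(k, b, f)` in the list `cs`. -/
  | dom (cs : List (ℕ × ℕ × ℕ)) (v : ℕ)
  /-- The array `K - 2 - b i`. -/
  | co (b : ℕ)
  /-- The array `b (c i - 1)` where `c i ≤ n`, and `0` elsewhere. -/
  | gather (b c : ℕ)
  /-- The array `i + 1`. -/
  | iota
  /-- The array `v i` where `b i ≤ c i`, and `0` elsewhere. -/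
  | filt (v b c : ℕ)

namespace Cmd

/-- The array that a command computes from the arrays `m`. -/
def sem (n K : ℕ) (m : ℕ → ℕ → ℕ) : Cmd → ℕ → ℕ
  | dom cs v => fun i => (Finset.range n).sup fun j =>
      if ∀ c ∈ cs, m c.1 j < m c.2.1 i + c.2.2 then m v j else 0
  | co b => fun i => K - 2 - m b i
  | gather b c => fun i => if m c i ≤ n then m b (m c i - 1) else 0
  | iota => fun i => i + 1
  | filt v b c => fun i => if m b i ≤ m c i then m v i else 0

/-- The arrays that a command reads. -/
def deps : Cmd → List ℕ
  | dom cs v => v :: cs.flatMap fun c => [c.1, c.2.1]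
  | co b => [b]
  | gather b c => [b, c]
  | iota => []
  | filt v b c => [v, b, c]

/-- The command number `k` reads only arrays computed before; its lists are short. -/
def WF (k : ℕ) (c : Cmd) : Prop :=
  (∀ b ∈ c.deps, b < k) ∧
    match c with
    | dom cs _ => cs.length ≤ 15 ∧ ∀ c ∈ cs, c.2.2 ≤ 1
    | _ => True

/-- The `i`-th command of the list is well-formed as the command number `k + i`. -/
def WFList : ℕ → List Cmd → Prop
  | _, [] => True
  | k, c :: cs => c.WF k ∧ WFList (k + 1) cs

/-- The word memory bank of array `b`. -/
def bank (b : ℕ) : ℕ := 2 * b + 6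

/-- The word memory bank of the cells used to compute array `b`. -/
def tableBank (b : ℕ) : ℕ := 2 * b + 7

/-- The translation of a command with output array `o`. -/
def prog (o : ℕ) : Cmd → Prog
  | dom cs v => .seq
      (forUp 7 (.reg 4) (.seq (.wset 8 (.load (bank v) (.reg 7))) (.seq (.wset 20 (.const 0))
        (insProg (tableBank o) (cs.map fun c => bank c.1) 0))))
      (forUp 7 (.reg 4) (.seq (.wset 9 (.const 0)) (.seq (.wset 20 (.const 0))
        (.seq (qryProg (tableBank o) (cs.map fun c => (bank c.2.1, c.2.2)) 0)
          (.wstore (bank o) (.reg 7) (.reg 9))))))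
  | co b => forUp 7 (.reg 4) (.wstore (bank o) (.reg 7)
      (.sub (.sub (.reg 5) (.const 2)) (.load (bank b) (.reg 7))))
  | gather b c => forUp 7 (.reg 4) (.branch (.wle (.load (bank c) (.reg 7)) (.reg 4))
      (.wstore (bank o) (.reg 7) (.load (bank b) (.sub (.load (bank c) (.reg 7)) (.const 1))))
      (.wstore (bank o) (.reg 7) (.const 0)))
  | iota => forUp 7 (.reg 4) (.wstore (bank o) (.reg 7) (.add (.reg 7) (.const 1)))
  | filt v b c => forUp 7 (.reg 4) (.branch
      (.wle (.load (bank b) (.reg 7)) (.load (bank c) (.reg 7)))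
      (.wstore (bank o) (.reg 7) (.load (bank v) (.reg 7)))
      (.wstore (bank o) (.reg 7) (.const 0)))

/-- A bound for the running time of a command. -/
def cost (n L : ℕ) : Cmd → ℕ
  | dom cs _ => (n + 1) * (2 * nestCost L cs.length + 100)
  | _ => (n + 1) * 100

/-- A command reads only earlier arrays, so its equation still holds for the final family of arrays;
this is what allows `Solves` to speak of a single family. -/
theorem sem_congr {n K k : ℕ} {m m' : ℕ → ℕ → ℕ} (h : ∀ b < k, m b = m' b) {c : Cmd}
    (hc : c.WF k) : c.sem n K m = c.sem n K m' := by
  obtain ⟨hd, -⟩ := hc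
  cases c with
  | dom cs v =>
    have hv : m v = m' v := h v (hd v (by simp [deps]))
    have hcs : ∀ c ∈ cs, m c.1 = m' c.1 ∧ m c.2.1 = m' c.2.1 := fun c hc =>
      ⟨h _ (hd _ (List.mem_cons_of_mem _ (List.mem_flatMap.2 ⟨c, hc, by simp⟩))),
        h _ (hd _ (List.mem_cons_of_mem _ (List.mem_flatMap.2 ⟨c, hc, by simp⟩)))⟩
    funext i
    refine Finset.sup_congr rfl fun j _ => ?_
    have : (∀ c ∈ cs, m c.1 j < m c.2.1 i + c.2.2) ↔ ∀ c ∈ cs, m' c.1 j < m' c.2.1 i + c.2.2 :=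
      forall₂_congr fun c hc => by rw [(hcs c hc).1, (hcs c hc).2]
    simp only [this, hv]
  | co b => simp [sem, h b (hd b (by simp [deps]))]
  | gather b c => simp [sem, h b (hd b (by simp [deps])), h c (hd c (by simp [deps]))]
  | iota => rfl
  | filt v b c =>
    simp [sem, h b (hd b (by simp [deps])), h c (hd c (by simp [deps])),
      h v (hd v (by simp [deps]))]

/-- The machine state `s` holds the arrays number `0, …, k - 1` of `m`, and the machine is ready
to compute further ones. -/
structure Sim (n K k : ℕ) (m : ℕ → ℕ → ℕ) (s : State) : Prop where
  reg4 : s.wreg 4 = n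
  reg5 : s.wreg 5 = K
  mem : ∀ b < k, ∀ i < n, s.wmem (bank b) i = m b i
  le : ∀ b < k, ∀ i < n, m b i ≤ K - 2
  table : ∀ b, k ≤ b → ∀ a, s.wmem (tableBank b) a = 0

/-- The word registers that the array commands leave alone. -/
def Kept (r : ℕ) : Prop := r < 7 ∨ (9 < r ∧ r < 20)

theorem Sim.next {n K k : ℕ} {m : ℕ → ℕ → ℕ} {s s' : State} (h : Sim n K k m s) {c : Cmd}
    (hs : Same Kept (fun b => b ≠ bank k ∧ b ≠ tableBank k) s s')
    (hm : ∀ i < n, s'.wmem (bank k) i = c.sem n K m i)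
    (hle : ∀ i < n, c.sem n K m i ≤ K - 2) :
    Sim n K (k + 1) (Function.update m k (c.sem n K m)) s' where
  reg4 := (hs.wreg 4 (.inl (by omega))).trans h.reg4
  reg5 := (hs.wreg 5 (.inl (by omega))).trans h.reg5
  mem b hb i hi := by
    rcases Nat.lt_succ_iff_lt_or_eq.1 hb with hb | rfl
    · rw [hs.wmem _ (by simp only [bank, tableBank]; omega), h.mem b hb i hi,
        Function.update_of_ne (by omega)]
    · rw [hm i hi, Function.update_self]
  le b hb i hi := by
    rcases Nat.lt_succ_iff_lt_or_eq.1 hb with hb | rfl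
    · rw [Function.update_of_ne (by omega)]
      exact h.le b hb i hi
    · rw [Function.update_self]
      exact hle i hi
  table b hb a := by
    rw [hs.wmem _ (by simp only [bank, tableBank]; omega), h.table b (by omega)]

/-- Values stay at most K - 2, so a bound increased by 1 is still a digit in base K. -/
theorem sem_le {n K k : ℕ} {m : ℕ → ℕ → ℕ} {s : State} (h : Sim n K k m s) (hK : n + 2 ≤ K)
    {c : Cmd} (hc : c.WF k) : ∀ i < n, c.sem n K m i ≤ K - 2 := by
  intro i hi
  obtain ⟨hd, hc⟩ := hc
  cases c with
  | dom cs v =>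
    refine Finset.sup_le fun j hj => ?_
    split_ifs
    · exact h.le v (hd v (by simp [deps])) j (Finset.mem_range.1 hj)
    · exact Nat.zero_le _
  | co b => exact Nat.sub_le _ _
  | gather b c =>
    simp only [sem]
    split_ifs
    · exact h.le b (hd b (by simp [deps])) _ (by omega)
    · exact Nat.zero_le _
  | iota => simp only [sem]; omega
  | filt v b c =>
    simp only [sem]
    split_ifs
    · exact h.le v (hd v (by simp [deps])) i hi
    · exact Nat.zero_le _

/-! ### Correctness of the translated commands. -/

/-- A loop that fills an array entry by entry. -/
theorem runs_fill {w n k B T : ℕ} {s : State} {p : Prog} {f : ℕ → ℕ}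
    {R Bk : ℕ → Prop} {Q : State → Prop}
    (hR4 : R 4) (hR7 : ¬ R 7) (hn : n < 2 ^ w) (h4 : s.wreg 4 = n)
    (hT : n * (B + 11) + 11 ≤ T)
    (hstep : ∀ i < n, ∀ s', Same R Bk s s' → s'.wreg 7 = i →
      Runs w p s' B fun s'' => Same (fun r => R r ∨ r = 7) Bk s' s'' ∧
        ∀ j, s''.wmem k j = if j = i then f i else s'.wmem k j)
    (hQ : ∀ s', Same R Bk s s' → (∀ i < n, s'.wmem k i = f i) → Q s') :
    Runs w (forUp 7 (.reg 4) p) s T Q := by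
  refine Runs.forUp (B := B) n (fun i s' => s'.wreg 7 = i ∧ Same R Bk s s' ∧
    ∀ j < i, s'.wmem k j = f j) hn (by simpa [WExpr.cost] using hT)
    ⟨by simp, (Same.refl _ _ s).setW hR7, by simp⟩ ?_ ?_ ?_
  · rintro i s' ⟨h7, hs, -⟩
    exact ⟨h7, (hs.wreg 4 hR4).trans h4⟩
  · rintro i hi s' ⟨h7, hs, hf⟩
    refine (hstep i hi s' hs h7).mono le_rfl ?_
    rintro s'' ⟨hs', hf'⟩
    refine ⟨(hs'.wreg 7 (.inr rfl)).trans h7, by simp,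
      (hs.trans (hs'.weaken (fun _ => .inl) fun _ => id)).setW hR7, fun j hj => ?_⟩
    rw [setW_wmem, hf']
    split_ifs with h
    · rw [h]
    · exact hf j (by omega)
  · rintro s' ⟨-, hs, hf⟩
    exact hQ s' hs hf

/-- The store instructions of the loop bodies. -/
theorem runs_store {w i k v B : ℕ} {x : WExpr} {s : State} (h7 : s.wreg 7 = i)
    (hx : x.cost + 2 ≤ B) (hev : x.eval w s = v) :
    Runs w (.wstore k (.reg 7) x) s B fun s' => Same (fun r => Kept r ∨ r = 7) (· ≠ k) s s' ∧
      ∀ j, s'.wmem k j = if j = i then v else s.wmem k j := by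
  refine Runs.wstore (by simp only [WExpr.cost]; omega)
    ⟨(Same.refl _ _ s).setM (by simp), fun j => ?_⟩
  rw [setM_wmem_same, hev]
  simp [WExpr.eval, h7]

theorem runs_insert_items {w n K k : ℕ} {m : ℕ → ℕ → ℕ} {s : State} (h : Sim n K k m s)
    (hK : 2 < K) (hnK : n < K) (hw2 : 2 * K ≤ 2 ^ w) (hw : K ^ 30 ≤ 2 ^ w) {v : ℕ} {ks : List ℕ}
    (hv : v < k) (hks : ∀ b ∈ ks, b < k) (hl : ks.length ≤ 15) :
    Runs w (forUp 7 (.reg 4) (.seq (.wset 8 (.load (bank v) (.reg 7))) (.seq (.wset 20 (.const 0))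
        (insProg (tableBank k) (ks.map bank) 0)))) s
      (n * (nestCost (Nat.clog 2 K) ks.length + 20) + 12) fun s' =>
      Same Kept (· ≠ tableBank k) s s' ∧ ∀ a B, s'.wmem (tableBank k) a ≤ B ↔
        ∀ j < n, Cell K 0 (ks.map fun b => m b j) a → m v j ≤ B := by
  refine Runs.forUp (B := nestCost (Nat.clog 2 K) ks.length + 8) n
    (fun i s' => s'.wreg 7 = i ∧ Same Kept (· ≠ tableBank k) s s' ∧
      ∀ a B, s'.wmem (tableBank k) a ≤ B ↔
        ∀ j < i, Cell K 0 (ks.map fun b => m b j) a → m v j ≤ B)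
    (by omega) (by simp only [WExpr.cost]; nlinarith) ?_ ?_ ?_ fun s' hs => hs.2
  · exact ⟨by simp, (Same.refl _ _ s).setW (by simp [Kept]), by simp [h.table k le_rfl]⟩
  · rintro i s' ⟨h7, hs, -⟩
    exact ⟨h7, (hs.wreg 4 (.inl (by omega))).trans h.reg4⟩
  · rintro i hi s' ⟨h7, hs, ht⟩
    refine Runs.seq 4 (nestCost (Nat.clog 2 K) ks.length + 4) (by omega)
      (Runs.wset (by simp [WExpr.cost]) ?_)
    refine Runs.seq 2 (nestCost (Nat.clog 2 K) ks.length) (by omega)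
      (Runs.wset (by simp [WExpr.cost]) ?_)
    have ev : ∀ b < k, s'.wmem (bank b) i = m b i := fun b hb => by
      rw [hs.wmem _ (by simp only [bank, tableBank]; omega), h.mem b hb i hi]
    have e8 : (WExpr.load (bank v) (.reg 7)).eval w s' = m v i := by
      simp only [WExpr.eval, h7, ev v hv]
    rw [e8]
    set s1 := (s'.setW 8 (m v i)).setW 20 ((WExpr.const 0).eval w (s'.setW 8 (m v i))) with hs1
    have e20 : s1.wreg 20 = 0 := by simp [hs1, WExpr.eval]
    have h8 : s1.wreg 8 = m v i := by simp [hs1]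
    have hss : Same (fun r => Kept r ∨ r = 7) (fun _ => True) s' s1 :=
      ((Same.refl _ _ s').setW (by simp [Kept])).setW (by simp [Kept])
    have emap : ((ks.map bank).map fun b => s1.wmem b i) = ks.map fun b => m b i := by
      rw [List.map_map]
      exact List.map_congr_left fun b hb => by
        rw [Function.comp, hss.wmem _ trivial, ev b (hks b hb)]
    refine (runs_insProg (w := w) (K := K) (i := i) (by omega) hw2 (ks.map bank) 0 s1 ?_ ?_ ?_ ?_
      ?_ ?_).mono (by simp) ?_
    · rw [hss.wreg 5 (.inl (.inl (by omega))), hs.wreg 5 (.inl (by omega)), h.reg5]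
    · rw [hss.wreg 7 (.inr rfl), h7]
    · intro b hb
      obtain ⟨b, -, rfl⟩ := List.mem_map.1 hb
      simp only [bank, tableBank]; omega
    · intro b hb
      obtain ⟨b, hb', rfl⟩ := List.mem_map.1 hb
      rw [hss.wmem _ trivial, ev b (hks b hb')]
      have := h.le b (hks b hb') i hi
      omega
    · simp [e20]
    · exact (Nat.pow_le_pow_right (by omega) (by simp; omega)).trans hw
    · rintro s2 ⟨hs2, ht2⟩
      refine ⟨by rw [hs2.wreg 7 (by omega), hss.wreg 7 (.inr rfl), h7], by simp,
        (hs.trans ((hss.weaken (fun _ => .inl) fun _ _ => trivial).trans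
          (hs2.weaken ?_ fun _ => id))).setW (by simp [Kept]), fun a B => ?_⟩
      · rintro r (hr | hr) <;> omega
      · rw [setW_wmem, ht2, hss.wmem _ trivial, ht, Nat.mul_zero, Nat.add_zero, e20, emap, h8]
        constructor
        · rintro ⟨h1, h2⟩ j hj hc
          rcases Nat.lt_succ_iff_lt_or_eq.1 hj with h' | rfl
          · exact h1 j h' hc
          · exact h2 hc
        · exact fun h => ⟨fun j hj => h j (by omega), h i (by omega)⟩

theorem runs_dom {w n K k : ℕ} {m : ℕ → ℕ → ℕ} {s : State} (h : Sim n K k m s)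
    (hK : n + 3 ≤ K) (hw : K ^ 30 ≤ 2 ^ w) {cs : List (ℕ × ℕ × ℕ)} {v : ℕ}
    (hc : (dom cs v).WF k) :
    Runs w ((dom cs v).prog k) s ((dom cs v).cost n (Nat.clog 2 K)) fun s' =>
      Same Kept (fun b => b ≠ bank k ∧ b ≠ tableBank k) s s' ∧
        ∀ i < n, s'.wmem (bank k) i = (dom cs v).sem n K m i := by
  obtain ⟨hd, hl, hf⟩ := hc
  have hw2 : 2 * K ≤ 2 ^ w := by
    refine le_trans ?_ hw
    calc 2 * K ≤ K * K := by nlinarith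
      _ = K ^ 2 := by ring
      _ ≤ _ := Nat.pow_le_pow_right (by omega) (by norm_num)
  have hdk : ∀ c ∈ cs, c.1 < k := fun c hc =>
    hd _ (List.mem_cons_of_mem _ (List.mem_flatMap.2 ⟨c, hc, by simp⟩))
  have hdb : ∀ c ∈ cs, c.2.1 < k := fun c hc =>
    hd _ (List.mem_cons_of_mem _ (List.mem_flatMap.2 ⟨c, hc, by simp⟩))
  have hdv : v < k := hd v (by simp [deps])
  set C := nestCost (Nat.clog 2 K) cs.length with hC
  refine Runs.seq (n * (C + 20) + 12) (n * (C + 40) + 20)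
    (by simp only [cost, ← hC]; nlinarith) ?_
  have := runs_insert_items h (by omega) (by omega) hw2 hw (v := v) (ks := cs.map fun c => c.1)
    hdv (by simpa using hdk) (by simpa using hl)
  simp only [List.map_map, List.length_map] at this
  refine this.mono le_rfl ?_
  rintro s1 ⟨hs1, ht1⟩
  have htb : bank k ≠ tableBank k := by simp only [bank, tableBank]; omega
  refine runs_fill (R := Kept) (Bk := (· ≠ bank k)) (B := C + 20)
    (f := (dom cs v).sem n K m) (k := bank k) (.inl (by omega)) (by simp [Kept]) (by omega)
    ((hs1.wreg 4 (.inl (by omega))).trans h.reg4) (by nlinarith) ?_ ?_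
  · intro i hi s' hs' h7
    have hss' : Same Kept (fun b => b ≠ bank k ∧ b ≠ tableBank k) s s' :=
      (hs1.weaken (fun _ => id) fun _ => And.right).trans (hs'.weaken (fun _ => id) fun _ => And.left)
    refine Runs.seq 2 (C + 18) (by omega) (Runs.wset (by simp [WExpr.cost]) ?_)
    refine Runs.seq 2 (C + 16) (by omega) (Runs.wset (by simp [WExpr.cost]) ?_)
    refine Runs.seq C 10 (by omega) ?_
    set s2 := (s'.setW 9 ((WExpr.const 0).eval w s')).setW 20
      ((WExpr.const 0).eval w (s'.setW 9 ((WExpr.const 0).eval w s'))) with hs2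
    have e20 : s2.wreg 20 = 0 := by simp [hs2, WExpr.eval]
    have e9 : s2.wreg 9 = 0 := by simp [hs2, WExpr.eval]
    have hs2s : Same (fun r => Kept r ∨ r = 7) (fun _ => True) s' s2 :=
      ((Same.refl _ _ s').setW (by simp [Kept])).setW (by simp [Kept])
    have e7 : s2.wreg 7 = i := (hs2s.wreg 7 (.inr rfl)).trans h7
    have em : ∀ b < k, s2.wmem (bank b) i = m b i := fun b hb => by
      rw [hs2s.wmem _ trivial, hss'.wmem _ (by simp only [bank, tableBank]; omega),
        h.mem b hb i hi]
    have emap : ((cs.map fun c => (bank c.2.1, c.2.2)).map fun b => s2.wmem b.1 i + b.2) =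
        cs.map fun c => m c.2.1 i + c.2.2 := by
      rw [List.map_map]
      refine List.map_congr_left fun c hc => ?_
      simp only [Function.comp, em c.2.1 (hdb c hc)]
    have hlt : ∀ c ∈ cs, m c.2.1 i + c.2.2 < K := fun c hc => by
      have h1 := h.le _ (hdb c hc) i hi
      have h2 := hf c hc
      omega
    have hlt1 : ∀ c ∈ cs, ∀ j < n, m c.1 j < K := fun c hc j hj => by
      have h1 := h.le _ (hdk c hc) j hj
      omega
    refine (runs_qryProg (w := w) (K := K) (i := i) (tb := tableBank k) (by omega) hw2
      (cs.map fun c => (bank c.2.1, c.2.2)) 0 s2 ?_ e7 ?_ (by simp [e20]) ?_).mono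
      (T := C) (by simp [hC]) ?_
    · rw [hs2s.wreg 5 (.inl (.inl (by omega))), hss'.wreg 5 (.inl (by omega)), h.reg5]
    · intro b hb
      obtain ⟨c, hc, rfl⟩ := List.mem_map.1 hb
      simpa only [em c.2.1 (hdb c hc)] using hlt c hc
    · exact (Nat.pow_le_pow_right (by omega) (by simp; omega)).trans hw
    · rintro s3 ⟨hs3, hres⟩
      have e3 : s3.wreg 7 = i := (hs3.wreg 7 (by omega)).trans e7
      refine (runs_store (B := 10) (v := (dom cs v).sem n K m i) e3 (by simp [WExpr.cost])
        ?_).mono le_rfl ?_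
      · simp only [WExpr.eval]
        -- Both sides are maxima, so it suffices to compare their upper bounds. One direction needs
        -- a common cell for every dominated item, the other that a common cell implies dominance.
        refine eq_of_forall_ge_iff fun B => ?_
        rw [hres, e9, hs2s.wmem _ trivial, hs'.wmem (tableBank k) htb.symm, e20, emap]
        simp only [ht1, sem, Finset.sup_le_iff, Finset.mem_range, Nat.zero_le, true_and]
        constructor
        · intro H j hj
          split_ifs with hcond
          · obtain ⟨a, ha1, ha2⟩ := exists_cell_of_forall₂ (K := K)
              (us := cs.map fun c => m c.1 j) (Us := cs.map fun c => m c.2.1 i + c.2.2)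
              (by simpa [List.forall₂_map_left_iff, List.forall₂_map_right_iff,
                List.forall₂_same] using hcond) (List.forall_mem_map.2 hlt) 0
            exact H a ha2 j hj (by simpa [Function.comp_def] using ha1)
          · exact Nat.zero_le _
        · intro H a ha j hj hcell
          have := (forall₂_of_cell (by simp) (List.forall_mem_map.2 fun c hc =>
            hlt1 c hc j hj) (List.forall_mem_map.2 hlt) hcell ha).2
          have hcond : ∀ c ∈ cs, m c.1 j < m c.2.1 i + c.2.2 := by
            simpa [List.forall₂_map_left_iff, List.forall₂_map_right_iff,
              List.forall₂_same, Function.comp_def] using this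
          simpa [if_pos hcond] using H j hj
      · rintro s4 ⟨hs4, hm4⟩
        refine ⟨((hs2s.weaken (fun _ => id) fun _ _ => trivial).trans
          (hs3.weaken ?_ fun _ _ => trivial)).trans hs4, fun j => ?_⟩
        · rintro r ((hr | hr) | hr) <;> omega
        · rw [hm4, hs3.wmem _ trivial, hs2s.wmem _ trivial]
  · intro s' hs' hm
    exact ⟨(hs1.weaken (fun _ => id) fun _ => And.right).trans
      (hs'.weaken (fun _ => id) fun _ => And.left), hm⟩

theorem runs_prog {w n K k : ℕ} {m : ℕ → ℕ → ℕ} {s : State} (h : Sim n K k m s)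
    (hK : n + 3 ≤ K) (hw : K ^ 30 ≤ 2 ^ w) {c : Cmd} (hc : c.WF k) :
    Runs w (c.prog k) s (c.cost n (Nat.clog 2 K)) fun s' =>
      Same Kept (fun b => b ≠ bank k ∧ b ≠ tableBank k) s s' ∧
        Sim n K (k + 1) (Function.update m k (c.sem n K m)) s' := by
  suffices H : Runs w (c.prog k) s (c.cost n (Nat.clog 2 K)) fun s' =>
      Same Kept (fun b => b ≠ bank k ∧ b ≠ tableBank k) s s' ∧
        ∀ i < n, s'.wmem (bank k) i = c.sem n K m i from
    H.mono le_rfl fun s' hs => ⟨hs.1, h.next hs.1 hs.2 (sem_le h (by omega) hc)⟩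
  have hKw : K ≤ 2 ^ w := (Nat.le_self_pow (by norm_num) K).trans hw
  -- Every command other than `dom` fills its array entry by entry, so only the loop body remains to
  -- be checked.
  have fill : ∀ (p : Prog) (f : ℕ → ℕ), (∀ i < n, ∀ s', s'.wreg 7 = i → s'.wreg 4 = n →
      s'.wreg 5 = K → (∀ b < k, ∀ i < n, s'.wmem (bank b) i = m b i) →
      Runs w p s' 60 fun s'' => Same (fun r => Kept r ∨ r = 7) (· ≠ bank k) s' s'' ∧
        ∀ j, s''.wmem (bank k) j = if j = i then f i else s'.wmem (bank k) j) →
      Runs w (forUp 7 (.reg 4) p) s ((n + 1) * 100) fun s' =>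
        Same Kept (fun b => b ≠ bank k ∧ b ≠ tableBank k) s s' ∧
          ∀ i < n, s'.wmem (bank k) i = f i := by
    intro p f hp
    refine runs_fill (R := Kept) (Bk := (· ≠ bank k)) (B := 60) (f := f) (k := bank k)
      (.inl (by omega)) (by simp [Kept]) (by omega) h.reg4 (by omega) ?_ ?_
    · intro i hi s' hs h7
      refine hp i hi s' h7 ((hs.wreg 4 (.inl (by omega))).trans h.reg4)
        ((hs.wreg 5 (.inl (by omega))).trans h.reg5) fun b hb j hj => ?_
      rw [hs.wmem _ (by simp only [bank]; omega), h.mem b hb j hj]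
    · exact fun s' hs hm => ⟨hs.weaken (fun _ => id) fun _ => And.left, hm⟩
  cases c with
  | dom cs v => exact runs_dom h hK hw hc
  | co b =>
    refine fill _ _ fun i hi s' h7 h4 h5 hm => runs_store h7 (by simp [WExpr.cost]) ?_
    simp only [WExpr.eval, h7, h5, hm b (hc.1 b (by simp [deps])) i hi, sem]
    rw [Nat.mod_eq_of_lt (a := 2) (by omega)]
  | gather b c =>
    have hb := hc.1 b (by simp [deps])
    refine fill _ _ fun i hi s' h7 h4 h5 hm => ?_
    have ec := hm c (hc.1 c (by simp [deps])) i hi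
    refine Runs.branch (T₁ := 50) (by simp [Test.cost, WExpr.cost]) (fun ht => ?_) (fun ht => ?_)
      <;> simp only [Test.Holds, WExpr.eval, h7, ec, h4] at ht
    · refine runs_store h7 (by simp [WExpr.cost]) ?_
      simp only [WExpr.eval, h7, ec, sem, ht, if_true]
      rw [Nat.mod_eq_of_lt (a := 1) (by omega), hm b hb _ (by omega)]
    · refine runs_store h7 (by simp [WExpr.cost]) ?_
      simp [WExpr.eval, sem, ht]
  | iota =>
    refine fill _ _ fun i hi s' h7 h4 h5 hm => runs_store h7 (by simp [WExpr.cost]) ?_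
    simp only [WExpr.eval, h7, sem]
    rw [Nat.mod_eq_of_lt (a := 1) (by omega), Nat.mod_eq_of_lt (by omega)]
  | filt v b c =>
    refine fill _ _ fun i hi s' h7 h4 h5 hm => ?_
    have ev := hm v (hc.1 v (by simp [deps])) i hi
    have eb := hm b (hc.1 b (by simp [deps])) i hi
    have ec := hm c (hc.1 c (by simp [deps])) i hi
    refine Runs.branch (T₁ := 50) (by simp [Test.cost, WExpr.cost]) (fun ht => ?_) (fun ht => ?_)
      <;> simp only [Test.Holds, WExpr.eval, h7, eb, ec] at ht
    · refine runs_store h7 (by simp [WExpr.cost]) ?_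
      simp [WExpr.eval, h7, ev, sem, ht]
    · refine runs_store h7 (by simp [WExpr.cost]) ?_
      simp [WExpr.eval, sem, ht]

/-- The commands of the list as a program; the first one computes array `k`. -/
def listProg : ℕ → List Cmd → Prog
  | _, [] => .skip
  | k, c :: cs => .seq (c.prog k) (listProg (k + 1) cs)

/-- A bound for the running time of a list of commands. -/
def listCost (n L : ℕ) : List Cmd → ℕ
  | [] => 1
  | c :: cs => c.cost n L + listCost n L cs

/-- The arrays number `k`, `k + 1`, … of `m` are those computed by the commands of the list. -/
def Solves (n K : ℕ) (m : ℕ → ℕ → ℕ) : ℕ → List Cmd → Prop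
  | _, [] => True
  | k, c :: cs => m k = c.sem n K m ∧ Solves n K m (k + 1) cs

theorem runs_listProg {w n K : ℕ} (hK : n + 3 ≤ K) (hw : K ^ 30 ≤ 2 ^ w) :
    ∀ (cs : List Cmd) (k : ℕ) (m : ℕ → ℕ → ℕ) (s : State), Sim n K k m s → WFList k cs →
    Runs w (listProg k cs) s (listCost n (Nat.clog 2 K) cs) fun s' =>
      Same Kept (· < 6) s s' ∧ ∃ m', (∀ b < k, m' b = m b) ∧ Sim n K (k + cs.length) m' s' ∧
        Solves n K m' k cs
  | [], k, m, s, h, _ => Runs.skip le_rfl ⟨Same.refl _ _ s, m, fun _ _ => rfl, h, trivial⟩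
  | c :: cs, k, m, s, h, hc => by
    refine Runs.seq _ _ le_rfl ((runs_prog h hK hw hc.1).mono le_rfl ?_)
    rintro s1 ⟨hs1, h1⟩
    refine (runs_listProg hK hw cs (k + 1) _ s1 h1 hc.2).mono le_rfl ?_
    rintro s2 ⟨hs2, m', hm', h2, hsol⟩
    have hlt : ∀ b < k, m' b = m b := fun b hb => by
      rw [hm' b (by omega), Function.update_of_ne (by omega)]
    refine ⟨(hs1.weaken (fun _ => id) fun b hb => ?_).trans hs2, m', hlt, ?_, ?_, hsol⟩
    · simp only [bank, tableBank]; omega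
    · rwa [List.length_cons, Nat.add_comm cs.length, ← Nat.add_assoc]
    · rw [hm' k (by omega), Function.update_self]
      exact sem_congr (fun b hb => (hlt b hb).symm) hc.1

end Cmd
end RealRAM

namespace RealRAM

/-! ### Ranking real numbers -/

/-- The rank of the entry `i` among `v 0, …, v (N - 1)`; equal entries have equal ranks. -/
noncomputable def rank (N : ℕ) (v : ℕ → ℝ) (i : ℕ) : ℕ :=
  {j ∈ Finset.range N | v j < v i}.card + 1

theorem rank_pos (N : ℕ) (v : ℕ → ℝ) (i : ℕ) : 1 ≤ rank N v i := Nat.le_add_left _ _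

theorem rank_le {N : ℕ} (v : ℕ → ℝ) {i : ℕ} (hi : i < N) : rank N v i ≤ N := by
  have : {j ∈ Finset.range N | v j < v i} ⊂ Finset.range N :=
    Finset.filter_ssubset.2 ⟨i, Finset.mem_range.2 hi, lt_irrefl _⟩
  simpa [rank] using Finset.card_lt_card this

/-- If v j < v i, then j itself is counted in the rank of i but not in its own rank. -/
theorem rank_le_rank {N : ℕ} (v : ℕ → ℝ) {i j : ℕ} (hj : j < N) :
    rank N v i ≤ rank N v j ↔ v i ≤ v j := by
  constructor
  · intro h
    by_contra hcon
    rw [not_le] at hcon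
    have : {l ∈ Finset.range N | v l < v j} ⊂ {l ∈ Finset.range N | v l < v i} := by
      refine (Finset.ssubset_iff_of_subset fun l hl => ?_).2 ⟨j, ?_, ?_⟩
      · simp only [Finset.mem_filter] at hl ⊢
        exact ⟨hl.1, hl.2.trans hcon⟩
      · simp [hj, hcon]
      · simp
    have := Finset.card_lt_card this
    simp only [rank] at h
    omega
  · intro h
    refine Nat.succ_le_succ (Finset.card_le_card fun l hl => ?_)
    simp only [Finset.mem_filter] at hl ⊢
    exact ⟨hl.1, hl.2.trans_le h⟩

/-! ### Selection sort with block minima. -/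

/-- `r` is an entry of `f` in the range from `lo` to `hi - 1` for which `v (r - 1)` is smallest;
entries `0` do not count. -/
def ArgMin (v : ℕ → ℝ) (f : ℕ → ℕ) (lo hi r : ℕ) : Prop :=
  (r ≠ 0 → ∃ q, lo ≤ q ∧ q < hi ∧ f q = r) ∧
    ∀ q, lo ≤ q → q < hi → f q ≠ 0 → r ≠ 0 ∧ v (r - 1) ≤ v (f q - 1)

theorem ArgMin.congr {v : ℕ → ℝ} {f g : ℕ → ℕ} {lo hi r : ℕ} (h : ArgMin v f lo hi r)
    (hfg : ∀ q, lo ≤ q → q < hi → f q = g q) : ArgMin v g lo hi r := by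
  refine ⟨fun hr => ?_, fun q h1 h2 => ?_⟩
  · obtain ⟨q, h1, h2, h3⟩ := h.1 hr
    exact ⟨q, h1, h2, (hfg q h1 h2) ▸ h3⟩
  · rw [← hfg q h1 h2]
    exact h.2 q h1 h2

/-- Put into register `13` an entry of the bank `c` in the range from register `12` to register
`15` that belongs to the smallest entry of the real bank `vb`. -/
def argMinProg (vb c : ℕ) : Prog :=
  .seq (.wset 13 (.const 0)) (.loop (.wlt (.reg 12) (.reg 15)) (.seq
    (.branch (.conj (.wlt (.const 0) (.load c (.reg 12))) (.neg (.conj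
        (.wlt (.const 0) (.reg 13)) (.neg (.rlt (.load vb (.sub (.load c (.reg 12)) (.const 1)))
          (.load vb (.sub (.reg 13) (.const 1))))))))
      (.wset 13 (.load c (.reg 12))) .skip)
    (.wset 12 (.add (.reg 12) (.const 1)))))

/-- Indices are stored increased by 1, so 0 can mean a removed entry in the bank and "nothing found
yet" in register 13. -/
theorem runs_argMinProg {w vb c lo hi T : ℕ} {s : State} (hlo : s.wreg 12 = lo)
    (hhi : s.wreg 15 = hi) (hle : lo ≤ hi) (hw : hi + 1 < 2 ^ w) (hT : (hi - lo) * 60 + 60 ≤ T) :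
    Runs w (argMinProg vb c) s T fun s' => Same (fun r => r ≠ 12 ∧ r ≠ 13) (fun _ => True) s s' ∧
      ArgMin (s.rmem vb) (s.wmem c) lo hi (s'.wreg 13) := by
  refine Runs.seq 2 ((hi - lo) * 60 + 58) (by omega) (Runs.wset (by simp [WExpr.cost]) ?_)
  refine Runs.loop (B := 50) (hi - lo) (fun k s' => s'.wreg 12 = lo + k ∧
    Same (fun r => r ≠ 12 ∧ r ≠ 13) (fun _ => True) s s' ∧
    ArgMin (s.rmem vb) (s.wmem c) lo (lo + k) (s'.wreg 13))
    (by simp only [Test.cost, WExpr.cost]; omega) ?_ ?_ ?_ ?_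
  · refine ⟨by simp [hlo], (Same.refl _ _ s).setW (by simp), ?_⟩
    simp only [ArgMin, WExpr.eval, setW_wreg]
    constructor
    · simp
    · intros; omega
  · rintro k hk s' ⟨h12, hs, hmin⟩
    have h15 : s'.wreg 15 = hi := (hs.wreg 15 (by omega)).trans hhi
    refine ⟨by simp only [Test.Holds, WExpr.eval, h12, h15]; omega, ?_⟩
    have hc1 : (1 : ℕ) % 2 ^ w = 1 := Nat.mod_eq_of_lt (by omega)
    have h13 : ∀ s'' : State, Same (fun r => r ≠ 13) (fun _ => True) s' s'' →
        ArgMin (s.rmem vb) (s.wmem c) lo (lo + (k + 1)) (s''.wreg 13) →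
        Runs w (.wset 12 (.add (.reg 12) (.const 1))) s'' 4 fun s' => s'.wreg 12 = lo + (k + 1) ∧
          Same (fun r => r ≠ 12 ∧ r ≠ 13) (fun _ => True) s s' ∧
          ArgMin (s.rmem vb) (s.wmem c) lo (lo + (k + 1)) (s'.wreg 13) := by
      intro s'' hs' hm
      refine Runs.wset (by simp [WExpr.cost]) ⟨?_, (hs.trans (hs'.weaken (fun _ => And.right)
        fun _ => id)).setW (by simp), by simpa using hm⟩
      simp only [WExpr.eval, setW_wreg, if_true, hs'.wreg 12 (by omega), h12, hc1]
      exact Nat.mod_eq_of_lt (by omega)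
    refine Runs.seq 46 4 (by omega) (Runs.branch (T₁ := 4) (by simp [Test.cost, WExpr.cost,
      RExpr.cost]) (fun ht => ?_) (fun ht => ?_))
    · refine Runs.wset (by simp [WExpr.cost]) (h13 _ ((Same.refl _ _ s').setW (by simp)) ?_)
      simp only [Test.Holds, WExpr.eval, RExpr.eval, h12, hs.wmem c trivial, hs.rmem, hc1,
        Nat.zero_mod, not_and, not_not] at ht
      simp only [WExpr.eval, setW_wreg, if_true, h12, hs.wmem c trivial]
      obtain ⟨ht1, ht2⟩ := ht
      refine ⟨fun _ => ⟨lo + k, by omega, by omega, rfl⟩, fun q hq1 hq2 hq => ⟨ht1.ne', ?_⟩⟩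
      rcases Nat.lt_succ_iff_lt_or_eq.1 hq2 with h | rfl
      · obtain ⟨hr, hv⟩ := hmin.2 q hq1 h hq
        exact ((ht2 (Nat.pos_of_ne_zero hr)).trans_le hv).le
      · exact le_rfl
    · refine Runs.skip (by omega) (h13 _ (Same.refl _ _ s') ?_)
      simp only [Test.Holds, WExpr.eval, RExpr.eval, h12, hs.wmem c trivial, hs.rmem, hc1,
        Nat.zero_mod, not_and, not_not, not_forall, not_lt] at ht
      refine ⟨fun hr => ?_, fun q hq1 hq2 hq => ?_⟩
      · obtain ⟨q, h1, h2, h3⟩ := hmin.1 hr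
        exact ⟨q, h1, by omega, h3⟩
      · rcases Nat.lt_succ_iff_lt_or_eq.1 hq2 with h | rfl
        · exact hmin.2 q hq1 h hq
        · obtain ⟨h1, h2⟩ := ht (Nat.pos_of_ne_zero hq)
          exact ⟨h1.ne', h2⟩
  · rintro s' ⟨h12, hs, -⟩
    have h15 : s'.wreg 15 = hi := (hs.wreg 15 (by omega)).trans hhi
    simp only [Test.Holds, WExpr.eval, h12, h15]
    omega
  · rintro s' ⟨-, hs, hmin⟩
    exact ⟨hs, by rwa [Nat.add_sub_cancel' hle] at hmin⟩

/-- Recompute the minimum of the block whose number is in register `rb`; blocks have the length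
in register `10`. -/
def blockProg (vb c₁ c₂ rb : ℕ) : Prog :=
  .seq (.wset 12 (.mul (.reg rb) (.reg 10))) (.seq (.wset 15 (.add (.reg 12) (.reg 10)))
    (.seq (argMinProg vb c₁) (.wstore c₂ (.reg rb) (.reg 13))))

theorem runs_blockProg {w vb c₁ c₂ rb S b T : ℕ} {s : State} (h10 : s.wreg 10 = S)
    (hb : s.wreg rb = b) (hrb : rb ≠ 12 ∧ rb ≠ 13 ∧ rb ≠ 15) (hw : S * S + 1 < 2 ^ w) (hbS : b < S)
    (hT : S * 60 + 80 ≤ T) :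
    Runs w (blockProg vb c₁ c₂ rb) s T fun s' =>
      Same (fun r => r ≠ 12 ∧ r ≠ 13 ∧ r ≠ 15) (· ≠ c₂) s s' ∧
      (∀ b', b' ≠ b → s'.wmem c₂ b' = s.wmem c₂ b') ∧
      ArgMin (s.rmem vb) (s.wmem c₁) (b * S) (b * S + S) (s'.wmem c₂ b) := by
  have hle : b * S + S ≤ S * S := by nlinarith
  refine Runs.seq 4 (S * 60 + 76) (by omega) (Runs.wset (by simp [WExpr.cost]) ?_)
  have e1 : (WExpr.mul (.reg rb) (.reg 10)).eval w s = b * S := by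
    simp only [WExpr.eval, hb, h10]
    exact Nat.mod_eq_of_lt (by omega)
  rw [e1]
  refine Runs.seq 4 (S * 60 + 72) (by omega) (Runs.wset (by simp [WExpr.cost]) ?_)
  have e2 : (WExpr.add (.reg 12) (.reg 10)).eval w (s.setW 12 (b * S)) = b * S + S := by
    simp only [WExpr.eval, setW_wreg, h10]
    exact Nat.mod_eq_of_lt (by simp; omega)
  rw [e2]
  set s1 := (s.setW 12 (b * S)).setW 15 (b * S + S) with hs1
  have hs : Same (fun r => r ≠ 12 ∧ r ≠ 15) (fun _ => True) s s1 :=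
    ((Same.refl _ _ s).setW (by simp)).setW (by simp)
  refine Runs.seq (S * 60 + 60) 4 (by omega) ?_
  refine (runs_argMinProg (lo := b * S) (hi := b * S + S) (by simp [hs1]) (by simp [hs1])
    (by omega) (by omega) le_rfl).mono (by simp) ?_
  rintro s2 ⟨hs2, hmin⟩
  refine Runs.wstore (by simp [WExpr.cost]) ?_
  have hb2 : s2.wreg rb = b := by rw [hs2.wreg rb (by omega), hs.wreg rb (by omega), hb]
  simp only [WExpr.eval, hb2]
  refine ⟨((hs.weaken ?_ fun _ _ => trivial).trans (hs2.weaken ?_ fun _ _ => trivial)).setM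
    (by simp), fun b' hb' => ?_, ?_⟩
  · rintro r hr; omega
  · rintro r hr; omega
  · rw [setM_wmem_same, if_neg hb', hs2.wmem c₂ trivial, hs.wmem c₂ trivial]
  · rwa [setM_wmem_same, if_pos rfl, ← hs.rmem, ← hs.wmem c₁ trivial]

end RealRAM

namespace RealRAM

/-- Put into register `10` the smallest number whose square is at least register `6`. -/
def sqrtProg : Prog :=
  .seq (.wset 10 (.const 0)) (.loop (.wlt (.mul (.reg 10) (.reg 10)) (.reg 6))
    (.wset 10 (.add (.reg 10) (.const 1))))

theorem exists_le_sq (N : ℕ) : ∃ S, N ≤ S * S := ⟨Nat.sqrt N + 1, (Nat.lt_succ_sqrt N).le⟩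

/-- The square root rounded up. -/
noncomputable def sqrtUp (N : ℕ) : ℕ := by classical exact Nat.find (exists_le_sq N)

theorem le_sqrtUp_sq (N : ℕ) : N ≤ sqrtUp N * sqrtUp N := by
  classical exact Nat.find_spec (exists_le_sq N)

theorem lt_of_lt_sqrtUp {N k : ℕ} (h : k < sqrtUp N) : k * k < N := by
  classical exact not_le.1 (Nat.find_min (exists_le_sq N) h)

theorem sqrtUp_le (N : ℕ) : sqrtUp N ≤ Nat.sqrt N + 1 := by
  classical exact Nat.find_min' (exists_le_sq N) (Nat.lt_succ_sqrt N).le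

theorem runs_sqrtProg {w N T : ℕ} {s : State} (h6 : s.wreg 6 = N)
    (hw : sqrtUp N * sqrtUp N + sqrtUp N < 2 ^ w) (hT : sqrtUp N * 20 + 20 ≤ T) :
    Runs w sqrtProg s T fun s' => Same (fun r => r ≠ 10) (fun _ => True) s s' ∧
      s'.wreg 10 = sqrtUp N := by
  refine Runs.seq 2 (sqrtUp N * 20 + 18) (by omega) (Runs.wset (by simp [WExpr.cost]) ?_)
  have hmul : ∀ k s', k ≤ sqrtUp N → s'.wreg 10 = k →
      (WExpr.mul (.reg 10) (.reg 10)).eval w s' = k * k := by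
    intro k s' hk h10
    have : k * k ≤ sqrtUp N * sqrtUp N := Nat.mul_le_mul hk hk
    simp only [WExpr.eval, h10]
    exact Nat.mod_eq_of_lt (by omega)
  refine Runs.loop (B := 4) (sqrtUp N) (fun k s' => Same (fun r => r ≠ 10) (fun _ => True) s s' ∧
    s'.wreg 10 = k) (by simp only [Test.cost, WExpr.cost]; omega)
    ⟨(Same.refl _ _ s).setW (by simp), by simp [WExpr.eval]⟩ ?_ ?_ fun _ h => h
  · rintro k hk s' ⟨hs, h10⟩
    have h6' : s'.wreg 6 = N := (hs.wreg 6 (by omega)).trans h6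
    refine ⟨?_, Runs.wset (by simp [WExpr.cost]) ⟨hs.setW (by simp), ?_⟩⟩
    · have h1 := hmul k s' hk.le h10
      simp only [Test.Holds, h1]
      simpa [WExpr.eval, h6'] using lt_of_lt_sqrtUp hk
    · have : (1 : ℕ) % 2 ^ w = 1 := Nat.mod_eq_of_lt (by omega)
      simp only [WExpr.eval, setW_wreg, if_true, h10, this]
      exact Nat.mod_eq_of_lt (by omega)
  · rintro s' ⟨hs, h10⟩
    have h6' : s'.wreg 6 = N := (hs.wreg 6 (by omega)).trans h6
    have h1 := hmul _ s' le_rfl h10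
    simp only [Test.Holds, h1]
    simpa [WExpr.eval, h6'] using le_sqrtUp_sq N

/-- Extract the smallest entry that is left; register `11` counts the extractions, register `17`
holds the rank of the entry extracted last, which is number `reg 14`. -/
def extractProg (vb c₁ c₂ rk : ℕ) : Prog :=
  .seq (.wset 12 (.const 0)) (.seq (.wset 15 (.reg 10)) (.seq (argMinProg vb c₂)
  (.seq (.wset 16 (.sub (.reg 13) (.const 1)))
  (.seq (.branch (.conj (.wlt (.const 0) (.reg 17))
      (.neg (.rlt (.load vb (.reg 14)) (.load vb (.reg 16))))) .skip
      (.wset 17 (.add (.reg 11) (.const 1))))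
  (.seq (.wset 14 (.reg 16))
  (.seq (.wstore rk (.reg 16) (.reg 17))
  (.seq (.wstore c₁ (.reg 16) (.const 0))
  (.seq (.wset 18 (.div (.reg 16) (.reg 10)))
    (blockProg vb c₁ c₂ 18)))))))))

/-- Store in the bank `rk` the ranks of the first `reg 6` entries of the real bank `vb`. -/
def rankProg (vb c₁ c₂ rk : ℕ) : Prog :=
  .seq (forUp 11 (.reg 6) (.wstore c₁ (.reg 11) (.add (.reg 11) (.const 1))))
  (.seq (forUp 11 (.reg 10) (blockProg vb c₁ c₂ 11))
  (.seq (.wset 17 (.const 0))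
    (forUp 11 (.reg 6) (extractProg vb c₁ c₂ rk))))

/-- The state of the sorting procedure when the entries in `D` have been extracted. -/
structure SortInv (vb c₁ c₂ rk N S : ℕ) (s₀ s : State) (D : Finset ℕ) : Prop where
  same : Same (fun r => r < 11) (fun b => b ≠ c₁ ∧ b ≠ c₂ ∧ b ≠ rk) s₀ s
  sub : D ⊆ Finset.range N
  left : ∀ q, s.wmem c₁ q = if q < N ∧ q ∉ D then q + 1 else 0
  block : ∀ b < S, ArgMin (s₀.rmem vb) (s.wmem c₁) (b * S) (b * S + S) (s.wmem c₂ b)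
  sorted : ∀ i ∈ D, ∀ j < N, j ∉ D → s₀.rmem vb i ≤ s₀.rmem vb j
  ranks : ∀ i ∈ D, s.wmem rk i = rank N (s₀.rmem vb) i
  none : s.wreg 17 = 0 → D = ∅
  last : s.wreg 17 ≠ 0 → s.wreg 14 ∈ D ∧ s.wreg 17 = rank N (s₀.rmem vb) (s.wreg 14) ∧
    ∀ i ∈ D, s₀.rmem vb i ≤ s₀.rmem vb (s.wreg 14)

set_option maxRecDepth 2000 in
-- One round takes O(S) operations: it scans the S block minima and recomputes the single block that
-- has changed. Entries come out in increasing order. An entry equal to the previous one inherits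
-- its rank; for any other, the smaller entries are exactly the k extracted ones.
theorem runs_extractProg {w vb c₁ c₂ rk N S k T : ℕ} {s₀ s : State} {D : Finset ℕ}
    (hc : c₁ ≠ c₂) (hc₁ : c₁ ≠ rk) (hc₂ : c₂ ≠ rk) (h : SortInv vb c₁ c₂ rk N S s₀ s D)
    (hD : D.card = k) (hk : k < N) (h11 : s.wreg 11 = k) (h10 : s₀.wreg 10 = S)
    (hNS : N ≤ S * S) (hw : S * S + S + 1 < 2 ^ w) (hNw : N < 2 ^ w) (hT : S * 120 + 300 ≤ T) :
    Runs w (extractProg vb c₁ c₂ rk) s T fun s' => s'.wreg 11 = k ∧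
      ∃ D' : Finset ℕ, D'.card = k + 1 ∧ SortInv vb c₁ c₂ rk N S s₀ s' D' := by
  set v := s₀.rmem vb with hv
  have hc1 : (1 : ℕ) % 2 ^ w = 1 := Nat.mod_eq_of_lt (by omega)
  have h10s : s.wreg 10 = S := (h.same.wreg 10 (by omega)).trans h10
  refine Runs.seq 2 (S * 120 + 298) (by omega) (Runs.wset (by simp [WExpr.cost]) ?_)
  refine Runs.seq 2 (S * 120 + 296) (by omega) (Runs.wset (by simp [WExpr.cost]) ?_)
  set s1 := (s.setW 12 ((WExpr.const 0).eval w s)).setW 15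
    ((WExpr.reg 10).eval w (s.setW 12 ((WExpr.const 0).eval w s))) with hs1
  have e12 : s1.wreg 12 = 0 := by simp [hs1, WExpr.eval]
  have e15 : s1.wreg 15 = S := by simp [hs1, WExpr.eval, h10s]
  have hss1 : Same (fun r => r ≠ 12 ∧ r ≠ 15) (fun _ => True) s s1 :=
    ((Same.refl _ _ s).setW (by simp)).setW (by simp)
  refine Runs.seq (S * 60 + 60) (S * 60 + 236) (by omega) ((runs_argMinProg e12 e15 (by omega)
    (by omega) (by omega)).mono le_rfl ?_)
  rintro s2 ⟨hs12, hmin⟩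
  have hs2 : Same (fun r => r ≠ 12 ∧ r ≠ 13 ∧ r ≠ 15) (fun _ => True) s s2 :=
    (hss1.weaken (by intro r hr; omega) fun _ => id).trans
      (hs12.weaken (by intro r hr; omega) fun _ => id)
  rw [hss1.rmem, h.same.rmem, ← hv, hss1.wmem c₂ trivial] at hmin
  -- the extracted entry
  have hblk : ∀ j < N, j / S < S ∧ j / S * S ≤ j ∧ j < j / S * S + S := by
    intro j hj
    have hS : 0 < S := Nat.pos_of_ne_zero fun e => by subst e; omega
    refine ⟨(Nat.div_lt_iff_lt_mul hS).2 (by omega), Nat.div_mul_le_self j S, ?_⟩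
    have := Nat.lt_div_mul_add hS (a := j)
    omega
  have hleft : ∀ j < N, j ∉ D → s.wmem c₁ j = j + 1 := fun j hj hjD => by
    rw [h.left, if_pos ⟨hj, hjD⟩]
  have hex : ∃ j < N, j ∉ D := by
    by_contra hcon
    push Not at hcon
    have : Finset.range N ⊆ D := fun j hj => hcon j (Finset.mem_range.1 hj)
    have := Finset.card_le_card this
    rw [Finset.card_range] at this
    omega
  -- The minimum of the block minima is a minimum of all entries that are left.
  have hle : ∀ j < N, j ∉ D → s2.wreg 13 ≠ 0 ∧ v (s2.wreg 13 - 1) ≤ v j := by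
    intro j hj hjD
    obtain ⟨h1, h2, h3⟩ := hblk j hj
    have h4 := (h.block _ h1).2 j h2 h3 (by rw [hleft j hj hjD]; omega)
    have h5 := hmin.2 _ (Nat.zero_le _) h1 h4.1
    refine ⟨h5.1, h5.2.trans ?_⟩
    simpa [hleft j hj hjD] using h4.2
  obtain ⟨q, h13, hqN, hqD⟩ : ∃ q, s2.wreg 13 = q + 1 ∧ q < N ∧ q ∉ D := by
    obtain ⟨j, hj, hjD⟩ := hex
    have h0 := (hle j hj hjD).1
    obtain ⟨b, -, hb, hb2⟩ := hmin.1 h0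
    obtain ⟨q, -, -, hq⟩ := (h.block b hb).1 (by rw [hb2]; exact h0)
    rw [h.left, hb2] at hq
    split_ifs at hq with hqq
    · exact ⟨q, hq.symm, hqq.1, hqq.2⟩
    · exact absurd hq.symm h0
  have hqmin : ∀ j < N, j ∉ D → v q ≤ v j := fun j hj hjD => by
    simpa [h13] using (hle j hj hjD).2
  have hrank : (∀ i ∈ D, v i < v q) → rank N v q = k + 1 := by
    intro hlt
    have : {j ∈ Finset.range N | v j < v q} = D := by
      ext j
      simp only [Finset.mem_filter, Finset.mem_range]
      refine ⟨fun hj => ?_, fun hj => ⟨Finset.mem_range.1 (h.sub hj), hlt j hj⟩⟩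
      by_contra hjD
      exact absurd hj.2 (not_lt.2 (hqmin j hj.1 hjD))
    rw [rank, this, hD]
  refine Runs.seq 4 (S * 60 + 232) (by omega) (Runs.wset (by simp [WExpr.cost]) ?_)
  have e16 : (WExpr.sub (.reg 13) (.const 1)).eval w s2 = q := by
    simp only [WExpr.eval, h13, hc1, Nat.add_sub_cancel]
  rw [e16]
  refine Runs.seq 20 (S * 60 + 212) (by omega) ?_
  set s3 := s2.setW 16 q with hs3
  have hs3s : Same (fun r => r ≠ 12 ∧ r ≠ 13 ∧ r ≠ 15 ∧ r ≠ 16) (fun _ => True) s s3 :=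
    (hs2.weaken (by intro r hr; omega) fun _ => id).setW (by simp)
  have h16 : s3.wreg 16 = q := by simp [hs3]
  suffices H : ∀ s4, Same (fun r => r ≠ 17) (fun _ => True) s3 s4 → s4.wreg 17 = rank N v q →
      Runs w (.seq (.wset 14 (.reg 16)) (.seq (.wstore rk (.reg 16) (.reg 17))
        (.seq (.wstore c₁ (.reg 16) (.const 0)) (.seq (.wset 18 (.div (.reg 16) (.reg 10)))
        (blockProg vb c₁ c₂ 18))))) s4 (S * 60 + 212) fun s' => s'.wreg 11 = k ∧
      ∃ D' : Finset ℕ, D'.card = k + 1 ∧ SortInv vb c₁ c₂ rk N S s₀ s' D' by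
    have h17 : s3.wreg 17 = s.wreg 17 := hs3s.wreg 17 (by omega)
    have h14 : s3.wreg 14 = s.wreg 14 := hs3s.wreg 14 (by omega)
    refine Runs.branch (T₁ := 4) (by simp [Test.cost, WExpr.cost, RExpr.cost]) (fun ht => ?_)
      (fun ht => ?_)
    · simp only [Test.Holds, WExpr.eval, RExpr.eval, h17, h14, h16, hs3s.rmem, h.same.rmem, ← hv,
        Nat.zero_mod, not_lt] at ht
      refine Runs.skip (by omega) (H _ (Same.refl _ _ _) ?_)
      obtain ⟨h1, h2, h3⟩ := h.last ht.1.ne'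
      have heq : v q = v (s.wreg 14) := le_antisymm ht.2 (h.sorted _ h1 q hqN hqD)
      rw [h17, h2, rank, rank, heq]
    · simp only [Test.Holds, WExpr.eval, RExpr.eval, h17, h14, h16, hs3s.rmem, h.same.rmem, ← hv,
        Nat.zero_mod, not_lt, not_and, not_le] at ht
      refine Runs.wset (by simp [WExpr.cost]) (H _ ((Same.refl _ _ _).setW (by simp)) ?_)
      have h11' : s3.wreg 11 = k := (hs3s.wreg 11 (by omega)).trans h11
      simp only [WExpr.eval, setW_wreg, if_true, h11', hc1]
      rw [Nat.mod_eq_of_lt (by omega), hrank]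
      intro i hi
      by_cases h0 : s.wreg 17 = 0
      · rw [h.none h0] at hi
        simp at hi
      · exact ((h.last h0).2.2 i hi).trans_lt (ht (Nat.pos_of_ne_zero h0))
  intro s4 hs4 h17
  have hs4s : Same (fun r => r < 12) (fun _ => True) s s4 :=
    (hs3s.weaken (by intro r hr; omega) fun _ => id).trans
      (hs4.weaken (by intro r hr; omega) fun _ => id)
  have h16' : s4.wreg 16 = q := (hs4.wreg 16 (by omega)).trans h16
  refine Runs.seq 2 (S * 60 + 210) (by omega) (Runs.wset (by simp [WExpr.cost]) ?_)
  refine Runs.seq 4 (S * 60 + 206) (by omega) (Runs.wstore (by simp [WExpr.cost]) ?_)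
  refine Runs.seq 4 (S * 60 + 202) (by omega) (Runs.wstore (by simp [WExpr.cost]) ?_)
  refine Runs.seq 4 (S * 60 + 198) (by omega) (Runs.wset (by simp [WExpr.cost]) ?_)
  simp only [WExpr.eval, setW_wreg, setM_wreg, h16', h17, Nat.reduceEqDiff, if_false,
    Nat.zero_mod, (hs4s.wreg 10 (by omega)).trans h10s]
  set s5 := (((s4.setW 14 q).setM rk q (rank N v q)).setM c₁ q 0).setW 18 (q / S) with hs5
  have hs5s : Same (fun r => r < 12) (fun b => b ≠ c₁ ∧ b ≠ rk) s s5 :=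
    ((((hs4s.weaken (fun _ => id) fun _ _ => trivial).setW (by simp)).setM (by simp)).setM
      (by simp)).setW (by simp)
  obtain ⟨hq1, hq2, hq3⟩ := hblk q hqN
  have m1 : ∀ j, s5.wmem c₁ j = if j < N ∧ j ∉ insert q D then j + 1 else 0 := by
    intro j
    rw [hs5, setW_wmem, setM_wmem_same]
    split_ifs with h1 h2 h2
    · subst h1; simp at h2
    · rfl
    · rw [setM_wmem_ne _ _ _ _ _ hc₁, setW_wmem, hs4s.wmem c₁ trivial, h.left, if_pos]
      exact ⟨h2.1, fun h => h2.2 (Finset.mem_insert_of_mem h)⟩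
    · rw [setM_wmem_ne _ _ _ _ _ hc₁, setW_wmem, hs4s.wmem c₁ trivial, h.left, if_neg]
      rintro ⟨h3, h4⟩
      exact h2 ⟨h3, fun h => (Finset.mem_insert.1 h).elim h1 h4⟩
  have m2 : s5.wmem c₂ = s.wmem c₂ := hs5s.wmem c₂ ⟨hc.symm, hc₂⟩
  have m3 : ∀ j, s5.wmem rk j = if j = q then rank N v q else s.wmem rk j := by
    intro j
    rw [hs5, setW_wmem, setM_wmem_ne _ _ _ _ _ hc₁.symm, setM_wmem_same, setW_wmem,
      hs4s.wmem rk trivial]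
  refine (runs_blockProg (S := S) (b := q / S)
    ((hs5s.wreg 10 (by omega)).trans h10s) (by simp [hs5]) (by omega) (by omega) hq1
    (by omega)).mono le_rfl ?_
  rintro s6 ⟨hs6, hm6, hmin6⟩
  rw [hs5s.rmem, h.same.rmem, ← hv] at hmin6
  have e17 : s6.wreg 17 = rank N v q := by
    rw [hs6.wreg 17 (by omega), hs5]; simp [h17]
  have e14 : s6.wreg 14 = q := by
    rw [hs6.wreg 14 (by omega), hs5]; simp
  refine ⟨?_, insert q D, by rw [Finset.card_insert_of_notMem hqD, hD], ?_⟩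
  · rw [hs6.wreg 11 (by omega), hs5s.wreg 11 (by omega), h11]
  · have hm1 : s6.wmem c₁ = s5.wmem c₁ := hs6.wmem c₁ hc
    refine ⟨?_, ?_, fun j => by rw [hm1]; exact m1 j, fun b hb => ?_, ?_, ?_, ?_, ?_⟩
    · exact h.same.trans ((hs5s.weaken (by intro r hr; omega) (by intro b hb; tauto)).trans
        (hs6.weaken (by intro r hr; omega) (by intro b hb; tauto)))
    · exact Finset.insert_subset (Finset.mem_range.2 hqN) h.sub
    · rw [hm1]
      by_cases hbq : b = q / S
      · subst hbq
        exact hmin6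
      · rw [hm6 b hbq, m2]
        refine (h.block b hb).congr fun j hj1 hj2 => ?_
        rw [m1, h.left]
        have hjq : j ≠ q := by
          rintro rfl
          apply hbq
          have hS : 0 < S := by omega
          refine le_antisymm ((Nat.le_div_iff_mul_le hS).2 hj1) ?_
          rw [← Nat.lt_succ_iff, Nat.div_lt_iff_lt_mul hS, Nat.succ_mul]
          exact hj2
        simp [Finset.mem_insert, hjq]
    · intro i hi j hj hjD
      have hjD' : j ∉ D := fun h => hjD (Finset.mem_insert_of_mem h)
      rcases Finset.mem_insert.1 hi with rfl | hi
      · exact hqmin j hj hjD'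
      · exact h.sorted i hi j hj hjD'
    · intro i hi
      rw [hs6.wmem rk hc₂.symm, m3]
      split_ifs with h1
      · rw [h1]
      · exact h.ranks i ((Finset.mem_insert.1 hi).resolve_left h1)
    · intro h0
      rw [e17] at h0
      have := rank_pos N v q
      omega
    · intro _
      rw [e14]
      refine ⟨Finset.mem_insert_self _ _, e17, fun i hi => ?_⟩
      rcases Finset.mem_insert.1 hi with rfl | hi
      · exact le_rfl
      · exact h.sorted i hi q hqN hqD

/-- A bound for the running time of `rankProg`. -/
def rankCost (N S : ℕ) : ℕ := N * (S * 120 + 400) + S * (S * 60 + 200) + 200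

theorem runs_rankProg {w vb c₁ c₂ rk N S : ℕ} {s : State} (hc : c₁ ≠ c₂) (hc₁ : c₁ ≠ rk)
    (hc₂ : c₂ ≠ rk) (h6 : s.wreg 6 = N) (h10 : s.wreg 10 = S) (hNS : N ≤ S * S)
    (hw : S * S + S + 1 < 2 ^ w) (hNw : N + 1 < 2 ^ w) (h0 : ∀ q, s.wmem c₁ q = 0) :
    Runs w (rankProg vb c₁ c₂ rk) s (rankCost N S) fun s' =>
      Same (fun r => r < 11) (fun b => b ≠ c₁ ∧ b ≠ c₂ ∧ b ≠ rk) s s' ∧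
      ∀ i < N, s'.wmem rk i = rank N (s.rmem vb) i := by
  have hc1 : (1 : ℕ) % 2 ^ w = 1 := Nat.mod_eq_of_lt (by omega)
  refine Runs.seq (N * 21 + 20) (N * (S * 120 + 370) + S * (S * 60 + 200) + 150)
    (by simp only [rankCost]; nlinarith) ?_
  refine Runs.forUp (B := 6) N (fun k s' => s'.wreg 11 = k ∧
    Same (fun r => r < 11) (fun b => b ≠ c₁ ∧ b ≠ c₂ ∧ b ≠ rk) s s' ∧
    ∀ q, s'.wmem c₁ q = if q < k then q + 1 else 0) (by omega) (by simp [WExpr.cost]; omega) ?_ ?_ ?_ ?_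
  · exact ⟨by simp, (Same.refl _ _ s).setW (by simp), by simp [h0]⟩
  · rintro k s' ⟨h11, hs, -⟩
    exact ⟨h11, (hs.wreg 6 (by omega)).trans h6⟩
  · rintro k hk s' ⟨h11, hs, hm⟩
    refine Runs.wstore (by simp [WExpr.cost]) ⟨by simpa using h11, by simp,
      (hs.setM (by simp)).setW (by simp), fun q => ?_⟩
    simp only [setW_wmem, setM_wmem_same, WExpr.eval, h11, hc1]
    rw [Nat.mod_eq_of_lt (by omega), hm]
    split_ifs <;> omega
  rintro s1 ⟨-, hs1, hm1⟩
  refine Runs.seq (S * (S * 60 + 100) + 20) (N * (S * 120 + 370) + S * 100 + 130)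
    (by nlinarith) ?_
  refine Runs.forUp (B := S * 60 + 80) S (fun k s' => s'.wreg 11 = k ∧
    Same (fun r => r < 11) (fun b => b ≠ c₁ ∧ b ≠ c₂ ∧ b ≠ rk) s s' ∧
    (s'.wmem c₁ = s1.wmem c₁) ∧
    ∀ b < k, ArgMin (s.rmem vb) (s1.wmem c₁) (b * S) (b * S + S) (s'.wmem c₂ b))
    (by omega) (by simp only [WExpr.cost]; nlinarith) ?_ ?_ ?_ ?_
  · exact ⟨by simp, hs1.setW (by simp), rfl, by simp⟩
  · rintro k s' ⟨h11, hs, -⟩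
    exact ⟨h11, (hs.wreg 10 (by omega)).trans h10⟩
  · rintro k hk s' ⟨h11, hs, hm, hmin⟩
    refine (runs_blockProg (S := S) ((hs.wreg 10 (by omega)).trans h10) h11 (by omega) (by omega)
      hk (by omega)).mono le_rfl ?_
    rintro s'' ⟨hs', hne, hmin'⟩
    rw [hs.rmem, hm] at hmin'
    refine ⟨(hs'.wreg 11 (by omega)).trans h11, by simp, ?_, ?_, fun b hb => ?_⟩
    · exact (hs.trans (hs'.weaken (by intro r hr; omega) fun b hb => hb.2.1)).setW (by simp)
    · rw [setW_wmem, hs'.wmem c₁ hc, hm]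
    · rw [setW_wmem]
      rcases Nat.lt_succ_iff_lt_or_eq.1 hb with hb | rfl
      · rw [hne b (by omega)]
        exact hmin b hb
      · exact hmin'
  rintro s2 ⟨-, hs2, hm2, hmin2⟩
  refine Runs.seq 2 (N * (S * 120 + 370) + S * 100 + 120) (by omega)
    (Runs.wset (by simp [WExpr.cost]) ?_)
  refine Runs.forUp (B := S * 120 + 300) N (fun k s' => s'.wreg 11 = k ∧
    ∃ D : Finset ℕ, D.card = k ∧ SortInv vb c₁ c₂ rk N S s s' D)
    (by omega) (by simp only [WExpr.cost]; nlinarith) ?_ ?_ ?_ ?_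
  · refine ⟨by simp, ∅, rfl, (hs2.setW (by simp)).setW (by simp), by simp, fun q => ?_,
      fun b hb => ?_, by simp, by simp, by simp, ?_⟩
    · simp [hm2, hm1]
    · simpa [hm2] using hmin2 b hb
    · simp [WExpr.eval]
  · rintro k s' ⟨h11, D, -, h⟩
    exact ⟨h11, (h.same.wreg 6 (by omega)).trans h6⟩
  · rintro k hk s' ⟨h11, D, hD, h⟩
    refine (runs_extractProg hc hc₁ hc₂ h hD hk h11 h10 hNS hw (by omega) le_rfl).mono le_rfl ?_
    rintro s'' ⟨h11', D', hD', h'⟩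
    refine ⟨h11', by simp, D', hD', h'.same.setW (by simp), h'.sub, h'.left, h'.block, h'.sorted,
      h'.ranks, ?_, ?_⟩
    · simpa using h'.none
    · simpa using h'.last
  · rintro s' ⟨-, D, hD, h⟩
    refine ⟨h.same, fun i hi => h.ranks i ?_⟩
    have : D = Finset.range N := Finset.eq_of_subset_of_card_le h.sub (by simp [hD])
    rw [this]
    exact Finset.mem_range.2 hi

end RealRAM

namespace ThreeSquares

/-! ### The combinatorics of three squares -/

/-- An instance in terms of ranks: the points `(X p, Y p)` and the squares
`[A i, A' i] × [B i, B' i]`, whose sides all have the same length before ranking. -/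
structure Instance (n M : ℕ) (X Y A A' B B' : ℕ → ℕ) : Prop where
  X_pos : ∀ p < n, 1 ≤ X p
  X_le : ∀ p < n, X p ≤ M
  Y_pos : ∀ p < n, 1 ≤ Y p
  Y_le : ∀ p < n, Y p ≤ M
  A_le : ∀ i < n, A i ≤ M
  A'_le : ∀ i < n, A' i ≤ M
  B_le : ∀ i < n, B i ≤ M
  B'_le : ∀ i < n, B' i ≤ M
  A_iff : ∀ i < n, ∀ j < n, A i ≤ A j ↔ A' i ≤ A' j
  B_iff : ∀ i < n, ∀ j < n, B i ≤ B j ↔ B' i ≤ B' j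
  A_pos : ∀ i < n, 1 ≤ A i
  A'_pos : ∀ i < n, 1 ≤ A' i
  B_pos : ∀ i < n, 1 ≤ B i
  B'_pos : ∀ i < n, 1 ≤ B' i

variable (n : ℕ) (X Y A A' B B' : ℕ → ℕ)

/-- The square `i` contains the point `p`. -/
def Contains (i p : ℕ) : Prop := A i ≤ X p ∧ X p ≤ A' i ∧ B i ≤ Y p ∧ Y p ≤ B' i

/-- The squares `i`, `j`, `k` contain all points. -/
def Covers (i j k : ℕ) : Prop :=
  ∀ p < n, Contains X Y A A' B B' i p ∨ Contains X Y A A' B B' j p ∨ Contains X Y A A' B B' k p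

/-- The lower left corner of the square `r` is below and to the left of all points. -/
def LowerLeft (r : ℕ) : Prop := (∀ p < n, A r ≤ X p) ∧ ∀ p < n, B r ≤ Y p

/-- Some square reaches beyond the abscissa of `p` and the ordinate of `q`. -/
def Feasible (p q : ℕ) : Prop := ∃ r < n, LowerLeft n X Y A B r ∧ X p ≤ A' r ∧ Y q ≤ B' r

/-- The points that only the lower left one of three squares can contain when `j` is the right one
and `i` is the upper one. -/
def Forced (j i p : ℕ) : Prop := X p < A i ∨ Y p < B j ∨ (X p < A j ∧ Y p < B i)

/-- The part of the condition below that concerns the squares `i` and `j` alone. -/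
structure PairOuter (i j : ℕ) : Prop where
  right : ∀ p < n, A' i < X p → A j ≤ X p ∧ B j ≤ Y p ∧ Y p ≤ B' j
  upper : ∀ p < n, B' j < Y p → B i ≤ Y p ∧ A i ≤ X p ∧ X p ≤ A' i
  rightmost : ∀ p < n, X p ≤ A' j
  topmost : ∀ p < n, Y p ≤ B' i

/-- The condition under which the squares `i` (upper) and `j` (right) are part of a solution;
every item compares a number depending on `i` with a number depending on `j`. -/
structure PairCond (i j : ℕ) : Prop extends PairOuter n X Y A A' B B' i j where
  right_right : ∀ p < n, ∀ q < n, Y p < B j → Y q < B j → Feasible n X Y A A' B B' p q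
  upper_right : ∀ p < n, ∀ q < n, X p < A i → Y q < B j → Feasible n X Y A A' B B' p q
  right_upper : ∀ p < n, ∀ q < n, Y p < B j → X q < A i → Feasible n X Y A A' B B' p q
  upper_both : ∀ p < n, ∀ q < n, Y q < B i → X p < A i → ¬ Feasible n X Y A A' B B' p q → A j ≤ X q
  both_upper : ∀ p < n, ∀ q < n, Y p < B i → X q < A i → ¬ Feasible n X Y A A' B B' p q → A j ≤ X p
  both_both : ∀ p < n, ∀ q < n, Y p < B i → X q ≤ X p → Y q < B i →
    ¬ Feasible n X Y A A' B B' p q → A j ≤ X p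
  right_both : ∀ p < n, ∀ q < n, X q < A j → Y p < B j → ¬ Feasible n X Y A A' B B' p q → B i ≤ Y q
  both_right : ∀ p < n, ∀ q < n, X p < A j → Y q < B j → ¬ Feasible n X Y A A' B B' p q → B i ≤ Y p

variable {n : ℕ} {X Y A A' B B' : ℕ → ℕ}

/-- Every point lies in one of the three squares, and none of these starts further left or lower
than the square i. -/
theorem lowerLeft_of_covers {i j k : ℕ} (h : Covers n X Y A A' B B' i j k) (hA : A i ≤ A j)
    (hA' : A i ≤ A k) (hB : B i ≤ B j) (hB' : B i ≤ B k) : LowerLeft n X Y A B i := by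
  constructor <;> intro p hp <;> rcases h p hp with h | h | h <;>
    obtain ⟨h1, h2, h3, h4⟩ := h <;> omega

/-- Since opposite sides are ordered alike, r reaches no further right than i and no higher than j.
So a point to the right of i must lie in j, a point above j must lie in i, and a forced point must
lie in r. The square r then witnesses that any two forced points are feasible. -/
theorem pairCond_of_covers {M r j i : ℕ} (hI : Instance n M X Y A A' B B')
    (hr : r < n) (hj : j < n) (hi : i < n) (h : Covers n X Y A A' B B' r j i)
    (hA : A r ≤ A i) (hA' : A i ≤ A j) (hB : B r ≤ B j) (hB' : B j ≤ B i) :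
    PairCond n X Y A A' B B' i j := by
  have hL := lowerLeft_of_covers h (hA.trans hA') hA hB (hB.trans hB')
  have a1 := (hI.A_iff _ hr _ hi).1 hA
  have a2 := (hI.A_iff _ hi _ hj).1 hA'
  have b1 := (hI.B_iff _ hr _ hj).1 hB
  have b2 := (hI.B_iff _ hj _ hi).1 hB'
  have hF : ∀ p < n, Forced X Y A B j i p → X p ≤ A' r ∧ Y p ≤ B' r := by
    intro p hp hf
    rcases hf with hf | hf | hf <;> rcases h p hp with h | h | h <;>
      obtain ⟨h1, h2, h3, h4⟩ := h <;> omega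
  have hFF : ∀ p < n, ∀ q < n, Forced X Y A B j i p → Forced X Y A B j i q →
      Feasible n X Y A A' B B' p q :=
    fun p hp q hq h1 h2 => ⟨r, hr, hL, (hF p hp h1).1, (hF q hq h2).2⟩
  refine ⟨⟨?_, ?_, ?_, ?_⟩, ?_, ?_, ?_, ?_, ?_, ?_, ?_, ?_⟩
  iterate 4
    intro p hp
    rcases h p hp with h | h | h <;> obtain ⟨h1, h2, h3, h4⟩ := h <;> omega
  · exact fun p hp q hq h1 h2 => hFF p hp q hq (.inr (.inl h1)) (.inr (.inl h2))
  · exact fun p hp q hq h1 h2 => hFF p hp q hq (.inl h1) (.inr (.inl h2))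
  · exact fun p hp q hq h1 h2 => hFF p hp q hq (.inr (.inl h1)) (.inl h2)
  · intro p hp q hq h1 h2 h3
    by_contra hc
    exact h3 (hFF p hp q hq (.inl h2) (.inr (.inr ⟨not_le.1 hc, h1⟩)))
  · intro p hp q hq h1 h2 h3
    by_contra hc
    exact h3 (hFF p hp q hq (.inr (.inr ⟨not_le.1 hc, h1⟩)) (.inl h2))
  · intro p hp q hq h1 h2 h4 h3
    by_contra hc
    exact h3 (hFF p hp q hq (.inr (.inr ⟨not_le.1 hc, h1⟩)) (.inr (.inr ⟨by omega, h4⟩)))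
  · intro p hp q hq h1 h2 h3
    by_contra hc
    exact h3 (hFF p hp q hq (.inr (.inl h2)) (.inr (.inr ⟨h1, not_le.1 hc⟩)))
  · intro p hp q hq h1 h2 h3
    by_contra hc
    exact h3 (hFF p hp q hq (.inr (.inr ⟨h1, not_le.1 hc⟩)) (.inr (.inl h2)))

/-- A finite set of points lies in one lower left square if any two of them are feasible. -/
theorem exists_lowerLeft {S : ℕ → Prop} (hne : ∃ r < n, LowerLeft n X Y A B r)
    (h : ∀ p < n, ∀ q < n, S p → S q → Feasible n X Y A A' B B' p q) :
    ∃ r < n, LowerLeft n X Y A B r ∧ ∀ p < n, S p → X p ≤ A' r ∧ Y p ≤ B' r := by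
  classical
  set F := (Finset.range n).filter S with hF
  have hmem : ∀ p, p ∈ F ↔ p < n ∧ S p := by simp [hF]
  rcases F.eq_empty_or_nonempty with h0 | h0
  · obtain ⟨r, hr, hL⟩ := hne
    refine ⟨r, hr, hL, fun p hp hs => ?_⟩
    have := (hmem p).2 ⟨hp, hs⟩
    simp [h0] at this
  -- A lower left square contains the whole set once it reaches its largest abscissa and its largest
  -- ordinate.
  · obtain ⟨p, hp, hpmax⟩ := F.exists_max_image X h0
    obtain ⟨q, hq, hqmax⟩ := F.exists_max_image Y h0
    obtain ⟨r, hr, hL, h1, h2⟩ := h p ((hmem p).1 hp).1 q ((hmem q).1 hq).1 ((hmem p).1 hp).2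
      ((hmem q).1 hq).2
    exact ⟨r, hr, hL, fun u hu hs => ⟨(hpmax u ((hmem u).2 ⟨hu, hs⟩)).trans h1,
      (hqmax u ((hmem u).2 ⟨hu, hs⟩)).trans h2⟩⟩

/-- The two forced points can have nine combinations of kinds. Only the one in which both lie to the
left of i is covered by `h0`; it concerns i alone and is automatic when i is the upper square of a
solution. -/
theorem exists_of_pairCond {i j : ℕ} (hne : ∃ r < n, LowerLeft n X Y A B r)
    (h : PairCond n X Y A A' B B' i j)
    (h0 : ∀ p < n, ∀ q < n, X p < A i → X q < A i → Feasible n X Y A A' B B' p q) :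
    ∃ r < n, LowerLeft n X Y A B r ∧ ∀ p < n, Forced X Y A B j i p → X p ≤ A' r ∧ Y p ≤ B' r := by
  refine exists_lowerLeft hne fun p hp q hq h1 h2 => ?_
  by_contra hf
  rcases h1 with h1 | h1 | h1 <;> rcases h2 with h2 | h2 | h2
  · exact hf (h0 p hp q hq h1 h2)
  · exact hf (h.upper_right p hp q hq h1 h2)
  · have := h.upper_both p hp q hq h2.2 h1 hf
    omega
  · exact hf (h.right_upper p hp q hq h1 h2)
  · exact hf (h.right_right p hp q hq h1 h2)
  · have := h.right_both p hp q hq h2.1 h1 hf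
    omega
  · have := h.both_upper p hp q hq h1.2 h2 hf
    omega
  · have := h.both_right p hp q hq h1.1 h2 hf
    omega
  · rcases le_total (X q) (X p) with hpq | hpq
    · have := h.both_both p hp q hq h1.2 hpq h2.2 hf
      omega
    -- `both_both` assumes X q ≤ X p, so that only X p has to be compared with A j. If X p ≤ X q,
    -- then the infeasibility of p, q implies that of q, q, to which `both_both` applies.
    · have hf' : ¬ Feasible n X Y A A' B B' q q := fun ⟨r, hr, hL, h3, h4⟩ =>
        hf ⟨r, hr, hL, hpq.trans h3, h4⟩
      have := h.both_both q hq q hq h2.2 le_rfl h2.2 hf'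
      omega

/-- A point that is not forced lies to the right of the left side of i and above the lower side of
j, and moreover to the right of the left side of j or above the lower side of i. In the first case
it is in j unless it lies above j, and then `upper` puts it in i; the second case is symmetric. The
order of the squares plays no role. -/
theorem covers_of_forced {r j i : ℕ} (hL : LowerLeft n X Y A B r)
    (hr : ∀ p < n, Forced X Y A B j i p → X p ≤ A' r ∧ Y p ≤ B' r)
    (h : PairOuter n X Y A A' B B' i j) : Covers n X Y A A' B B' r j i := by
  intro p hp
  by_cases hf : Forced X Y A B j i p
  · exact .inl ⟨hL.1 p hp, (hr p hp hf).1, hL.2 p hp, (hr p hp hf).2⟩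
  · have h1 := h.right p hp
    have h2 := h.upper p hp
    have h3 := h.rightmost p hp
    have h4 := h.topmost p hp
    simp only [Forced, Contains] at *
    omega

/-- The squares `i`, `k` contain all points that are below or to the left, respectively above or
to the right, of the lower left, respectively upper right, corner of the square `j`. -/
structure MonoCond (i j k : ℕ) : Prop where
  lower : LowerLeft n X Y A B i
  below : ∀ p < n, (X p < A j ∨ Y p < B j) → X p ≤ A' i ∧ Y p ≤ B' i
  upper : ∀ p < n, X p ≤ A' k ∧ Y p ≤ B' k
  above : ∀ p < n, (A' j < X p ∨ B' j < Y p) → A k ≤ X p ∧ B k ≤ Y p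

/-- In an increasing chain only i can contain points to the left of or below j, and only k points to
the right of or above j. Given j, the conditions on i and on k are separate. -/
theorem monoCond_of_covers {M i j k : ℕ} (hI : Instance n M X Y A A' B B')
    (hi : i < n) (hj : j < n) (hk : k < n) (h : Covers n X Y A A' B B' i j k)
    (hA : A i ≤ A j) (hA' : A j ≤ A k) (hB : B i ≤ B j) (hB' : B j ≤ B k) :
    MonoCond (n := n) (X := X) (Y := Y) (A := A) (A' := A') (B := B) (B' := B') i j k := by
  have a1 := (hI.A_iff _ hi _ hj).1 hA
  have a2 := (hI.A_iff _ hj _ hk).1 hA'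
  have b1 := (hI.B_iff _ hi _ hj).1 hB
  have b2 := (hI.B_iff _ hj _ hk).1 hB'
  refine ⟨lowerLeft_of_covers h hA (hA.trans hA') hB (hB.trans hB'), ?_, ?_, ?_⟩ <;> intro p hp <;>
    rcases h p hp with h | h | h <;> obtain ⟨h1, h2, h3, h4⟩ := h <;> omega

theorem covers_of_monoCond {i j k : ℕ}
    (h : MonoCond (n := n) (X := X) (Y := Y) (A := A) (A' := A') (B := B) (B' := B') i j k) :
    Covers n X Y A A' B B' i j k := by
  intro p hp
  have h1 := h.lower.1 p hp
  have h2 := h.lower.2 p hp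
  have h3 := h.below p hp
  have h4 := h.upper p hp
  have h5 := h.above p hp
  simp only [Contains]
  omega

end ThreeSquares

namespace ThreeSquares
open RealRAM

/-! ### The array program -/

/-- The arrays that describe an instance, and their complements. -/
structure Names where
  (x cx y cy a ca a' ca' b cb b' cb' : ℕ)

/-- The commands that look for solutions in which the first square is the lower left one; the
first command computes array `k`. -/
def core (N : Names) (k : ℕ) : List Cmd :=
  [ .iota,
    -- The extreme coordinates of all points, as constant arrays. A minimum is the complement of a
    -- maximum of complements, so that an empty minimum would be M + 1.
    .dom [] N.cx, .co (k + 1),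
    .dom [] N.cy, .co (k + 3),
    .dom [] N.x, .co (k + 5),
    .dom [] N.y, .co (k + 7),
    -- The offset 1 turns < into ≤. At p, array k + 9 is the highest upper side of a lower left
    -- square that reaches the abscissa of p, so q is feasible with p exactly when its ordinate does
    -- not exceed this value.
    .dom [(N.a, k + 2, 1), (N.b, k + 4, 1), (N.ca', N.cx, 1)] N.b', .co (k + 9),
    -- Array k + 12: the lowest point q, not further right than p, for which p, q is infeasible.
    .dom [(N.x, N.x, 1), (N.cy, k + 10, 0)] N.cy, .co (k + 11),
    -- Extreme values over the points to the left of a square, and over the points below it.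
    .dom [(N.x, N.a, 0)] (k + 10), .co (k + 13),
    .dom [(N.y, N.b, 0)] (k + 10), .co (k + 15),
    .dom [(N.x, N.a, 0)] N.y, .co (k + 17),
    .dom [(N.y, N.b, 0)] N.y, .co (k + 19),
    .dom [(N.x, N.a, 0)] N.x, .co (k + 21),
    .dom [(N.y, N.b, 0)] N.x, .co (k + 23),
    -- Arrays k + 26, k + 28, k + 30, k + 31, k + 32 are the thresholds for the last five items of
    -- `PairCond`, in that order; the last two are kept as complements.
    .dom [(N.y, N.b, 0), (N.cy, k + 13, 0)] N.cx, .co (k + 25),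
    .dom [(N.y, N.b, 0), (k + 9, k + 17, 0)] N.cx, .co (k + 27),
    .dom [(N.y, N.b, 0), (k + 12, N.b, 0)] N.cx, .co (k + 29),
    .dom [(N.x, N.a, 0), (N.cy, k + 15, 0)] N.cy,
    .dom [(N.x, N.a, 0), (k + 9, k + 19, 0)] N.cy,
    -- Extreme values over the points to the right of a square, then over the points above it.
    .dom [(N.cx, N.ca', 0)] N.cx, .co (k + 33),
    .dom [(N.cx, N.ca', 0)] N.cy, .co (k + 35),
    .dom [(N.cx, N.ca', 0)] N.y, .co (k + 37),
    .dom [(N.cy, N.cb', 0)] N.cx, .co (k + 39),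
    .dom [(N.cy, N.cb', 0)] N.cy, .co (k + 41),
    .dom [(N.cy, N.cb', 0)] N.x,
    -- `right_right` concerns j alone; squares violating it are removed as candidates for j.
    .filt k (k + 19) (k + 16),
    -- The fifteen constraints are the remaining items of `PairCond`, with `right` and `upper`
    -- contributing three each. The result at i is j + 1 for a suitable j, or 0.
    .dom [(k + 19, k + 14, 1), (k + 15, k + 18, 1), (N.a, k + 26, 1), (N.a, k + 28, 1),
      (N.a, k + 30, 1), (k + 31, N.cb, 1), (k + 32, N.cb, 1), (N.a, k + 34, 1), (N.b, k + 36, 1),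
      (N.cb', k + 38, 1), (k + 41, N.cb, 1), (k + 39, N.ca, 1), (k + 43, N.a', 1),
      (N.ca', k + 6, 1), (k + 7, N.b', 1)] (k + 44),
    -- With j now fixed for each i, the bounds that the forced points impose on r are collected.
    .gather N.a (k + 45),
    .dom [(N.x, k + 46, 0), (N.y, N.b, 0)] N.x, .co (k + 47),
    .dom [(N.x, k + 46, 0), (N.y, N.b, 0)] N.y, .co (k + 49),
    .gather (k + 24) (k + 45), .gather (k + 20) (k + 45),
    .dom [(N.a, k + 2, 1), (N.b, k + 4, 1), (N.ca', k + 22, 1), (N.ca', k + 51, 1),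
      (N.ca', k + 48, 1), (N.cb', k + 18, 1), (N.cb', k + 52, 1), (N.cb', k + 50, 1)] k,
    -- The increasing case: for each middle square, the lower and the upper one are found by
    -- independent queries.
    .dom [(N.a, k + 2, 1), (N.b, k + 4, 1), (N.ca', k + 22, 1), (N.ca', k + 24, 1),
      (N.cb', k + 18, 1), (N.cb', k + 20, 1)] k,
    .dom [(N.a, k + 34, 1), (N.a, k + 40, 1), (N.b, k + 36, 1), (N.b, k + 42, 1),
      (N.ca', k + 6, 1), (N.cb', k + 8, 1)] k ]

/-! ### Correctness of the array program. -/

theorem sem_dom_le {n K : ℕ} {m : ℕ → ℕ → ℕ} {f : ℕ → ℕ} {cs : List (ℕ × ℕ × ℕ)} {v : ℕ}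
    (h : f = (Cmd.dom cs v).sem n K m) (i c : ℕ) :
    f i ≤ c ↔ ∀ j < n, (∀ c ∈ cs, m c.1 j < m c.2.1 i + c.2.2) → m v j ≤ c := by
  subst h
  simp only [Cmd.sem, Finset.sup_le_iff, Finset.mem_range]
  refine forall₂_congr fun j _ => ?_
  split_ifs with hc
  · exact ⟨fun h _ => h, fun h => h hc⟩
  · exact iff_of_true (Nat.zero_le _) fun h => absurd h hc

/-- The value 0 belongs to the empty maximum, which is why indices of squares are stored increased
by 1. -/
theorem exists_of_sem_dom {n K : ℕ} {m : ℕ → ℕ → ℕ} {f : ℕ → ℕ} {cs : List (ℕ × ℕ × ℕ)} {v : ℕ}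
    (h : f = (Cmd.dom cs v).sem n K m) {i : ℕ} (hi : 0 < f i) :
    ∃ j < n, (∀ c ∈ cs, m c.1 j < m c.2.1 i + c.2.2) ∧ m v j = f i := by
  by_contra hcon
  push Not at hcon
  have := (sem_dom_le h i (f i - 1)).2 fun j hj hc => by
    have h1 := hcon j hj hc
    have h2 := (sem_dom_le h i (f i)).1 le_rfl j hj hc
    omega
  omega

/-- A maximum of complements is the complement of a minimum. -/
theorem le_co_sem_dom {n K C : ℕ} {m : ℕ → ℕ → ℕ} {f w : ℕ → ℕ} {cs : List (ℕ × ℕ × ℕ)} {v : ℕ}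
    (h : f = (Cmd.dom cs v).sem n K m) (hw : ∀ j < n, m v j = C - w j) (i : ℕ) {u : ℕ}
    (hu : u ≤ C) :
    (u ≤ C - f i ↔ ∀ j < n, (∀ c ∈ cs, m c.1 j < m c.2.1 i + c.2.2) → u ≤ w j) ∧
    (f i ≤ C - u ↔ ∀ j < n, (∀ c ∈ cs, m c.1 j < m c.2.1 i + c.2.2) → u ≤ w j) := by
  have h1 : f i ≤ C := (sem_dom_le h i C).2 fun j hj _ => by rw [hw j hj]; omega
  have h2 : f i ≤ C - u ↔ ∀ j < n, (∀ c ∈ cs, m c.1 j < m c.2.1 i + c.2.2) → u ≤ w j := by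
    rw [sem_dom_le h]
    refine forall₃_congr fun j hj _ => ?_
    rw [hw j hj]
    omega
  exact ⟨by rw [← h2]; omega, h2⟩

/-- What the report needs to know about the array program. -/
structure CoreSpec (n : ℕ) (X Y A A' B B' : ℕ → ℕ) (I J I₁ K₁ : ℕ → ℕ) : Prop where
  sound : ∀ i < n, 0 < I i → 0 < J i → ∃ r < n, ∃ j < n, I i = r + 1 ∧ J i = j + 1 ∧
    Covers n X Y A A' B B' r j i
  complete : ∀ r < n, ∀ j < n, ∀ i < n, Covers n X Y A A' B B' r j i → A r ≤ A i → A i ≤ A j →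
    B r ≤ B j → B j ≤ B i → 0 < I i ∧ 0 < J i
  sound_mono : ∀ j < n, 0 < I₁ j → 0 < K₁ j → ∃ r < n, ∃ k < n, I₁ j = r + 1 ∧ K₁ j = k + 1 ∧
    Covers n X Y A A' B B' r j k
  complete_mono : ∀ r < n, ∀ j < n, ∀ k < n, Covers n X Y A A' B B' r j k → A r ≤ A j → A j ≤ A k →
    B r ≤ B j → B j ≤ B k → 0 < I₁ j ∧ 0 < K₁ j

/-- Each array is first rewritten as an equivalence about its bounds. Then `hcond` identifies the
query for j with `PairCond`, `hforced` the query for r with the containment of all forced points,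
and `h1ex`, `h2ex` the two queries of the increasing case with the two halves of `MonoCond`. -/
theorem coreSpec {n M k : ℕ} {m : ℕ → ℕ → ℕ} {N : Names}
    (hI : Instance n M (m N.x) (m N.y) (m N.a) (m N.a') (m N.b) (m N.b'))
    (hcx : ∀ p < n, m N.cx p = M + 1 - m N.x p) (hcy : ∀ p < n, m N.cy p = M + 1 - m N.y p)
    (hca : ∀ p < n, m N.ca p = M + 1 - m N.a p) (hca' : ∀ p < n, m N.ca' p = M + 1 - m N.a' p)
    (hcb : ∀ p < n, m N.cb p = M + 1 - m N.b p) (hcb' : ∀ p < n, m N.cb' p = M + 1 - m N.b' p)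
    (h : Cmd.Solves n (M + 3) m k (core N k)) :
    CoreSpec n (m N.x) (m N.y) (m N.a) (m N.a') (m N.b) (m N.b') (m (k + 53)) (m (k + 45))
      (m (k + 54)) (m (k + 55)) := by
  simp only [core, Cmd.Solves, Nat.add_assoc, Nat.reduceAdd] at h
  obtain ⟨e0, e1, e2, e3, e4, e5, e6, e7, e8, e9, e10, e11, e12, e13, e14, e15, e16, e17, e18, e19,
    e20, e21, e22, e23, e24, e25, e26, e27, e28, e29, e30, e31, e32, e33, e34, e35, e36, e37, e38,
    e39, e40, e41, e42, e43, e44, e45, e46, e47, e48, e49, e50, e51, e52, e53, e54, e55, -⟩ := h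
  have hco : ∀ {f : ℕ → ℕ} {b : ℕ}, f = (Cmd.co b).sem n (M + 3) m → ∀ i, f i = M + 1 - m b i := by
    rintro f b rfl i
    simp [Cmd.sem]
  replace e2 := hco e2; replace e4 := hco e4; replace e6 := hco e6; replace e8 := hco e8
  replace e10 := hco e10; replace e12 := hco e12; replace e14 := hco e14; replace e16 := hco e16
  replace e18 := hco e18; replace e20 := hco e20; replace e22 := hco e22; replace e24 := hco e24
  replace e26 := hco e26; replace e28 := hco e28; replace e30 := hco e30; replace e34 := hco e34
  replace e36 := hco e36; replace e38 := hco e38; replace e40 := hco e40; replace e42 := hco e42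
  replace e48 := hco e48; replace e50 := hco e50
  have d1 := fun i (u : ℕ) hu => (le_co_sem_dom e1 hcx i (u := u) hu).1
  have d3 := fun i (u : ℕ) hu => (le_co_sem_dom e3 hcy i (u := u) hu).1
  have d5 := sem_dom_le e5
  have d7 := sem_dom_le e7
  have d9 := sem_dom_le e9
  have d11 := fun i (u : ℕ) hu => (le_co_sem_dom e11 hcy i (u := u) hu).1
  have d13 := fun i (u : ℕ) hu => le_co_sem_dom e13 (fun j _ => e10 j) i (u := u) hu
  have d15 := fun i (u : ℕ) hu => le_co_sem_dom e15 (fun j _ => e10 j) i (u := u) hu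
  have d17 := sem_dom_le e17
  have d19 := sem_dom_le e19
  have d21 := sem_dom_le e21
  have d23 := sem_dom_le e23
  have d25 := fun i (u : ℕ) hu => (le_co_sem_dom e25 hcx i (u := u) hu).1
  have d27 := fun i (u : ℕ) hu => (le_co_sem_dom e27 hcx i (u := u) hu).1
  have d29 := fun i (u : ℕ) hu => (le_co_sem_dom e29 hcx i (u := u) hu).1
  have d31 := fun i (u : ℕ) hu => (le_co_sem_dom e31 hcy i (u := u) hu).2
  have d32 := fun i (u : ℕ) hu => (le_co_sem_dom e32 hcy i (u := u) hu).2
  have d33 := fun i (u : ℕ) hu => (le_co_sem_dom e33 hcx i (u := u) hu).1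
  have d35 := fun i (u : ℕ) hu => (le_co_sem_dom e35 hcy i (u := u) hu).1
  have d37 := sem_dom_le e37
  have d39 := fun i (u : ℕ) hu => le_co_sem_dom e39 hcx i (u := u) hu
  have d41 := fun i (u : ℕ) hu => le_co_sem_dom e41 hcy i (u := u) hu
  have d43 := sem_dom_le e43
  have d47 := sem_dom_le e47
  have d49 := sem_dom_le e49
  have d45 := sem_dom_le e45
  have d45' := fun i => exists_of_sem_dom e45 (i := i)
  have d53 := sem_dom_le e53
  have d53' := fun i => exists_of_sem_dom e53 (i := i)
  have d54 := sem_dom_le e54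
  have d54' := fun i => exists_of_sem_dom e54 (i := i)
  have d55 := sem_dom_le e55
  have d55' := fun i => exists_of_sem_dom e55 (i := i)
  simp only [List.mem_cons, List.not_mem_nil, or_false, forall_eq_or_imp, forall_eq, Nat.add_zero,
    IsEmpty.forall_iff, implies_true, forall_const, Nat.lt_succ_iff]
    at d1 d3 d5 d7 d9 d11 d13 d15 d17 d19 d21 d23 d25 d27 d29 d31 d32 d33 d35
  simp only [List.mem_cons, List.not_mem_nil, or_false, forall_eq_or_imp, forall_eq, Nat.add_zero,
    Nat.lt_succ_iff] at d37 d39 d41 d43 d45 d45' d47 d49 d53 d53' d54 d54' d55 d55'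
  clear e1 e3 e5 e7 e9 e11 e13 e15 e17 e19 e21 e23 e25 e27 e29 e31 e32 e33 e35 e37 e39 e41 e43 e45
    e47 e49 e53 e54 e55
  obtain ⟨X1, XM, Y1, YM, AM, A'M, BM, B'M, -⟩ := id hI
  have hLL : ∀ r < n, ∀ i, m N.a r ≤ m (k + 2) i ∧ m N.b r ≤ m (k + 4) i ↔
      LowerLeft n (m N.x) (m N.y) (m N.a) (m N.b) r := fun r hr i => by
    rw [e2, e4, d1 i _ ((AM r hr).trans (Nat.le_succ _)), d3 i _ ((BM r hr).trans (Nat.le_succ _))]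
    rfl
  have ht : ∀ p < n, ∀ q < n, m N.y q ≤ m (k + 9) p ↔
      Feasible n (m N.x) (m N.y) (m N.a) (m N.a') (m N.b) (m N.b') p q := fun p hp q hq => by
    -- Ranks are positive, so the value 0 of an empty maximum makes p infeasible with every q.
    have h1 := Y1 q hq
    have h2 : m N.y q ≤ m (k + 9) p ↔ ¬ m (k + 9) p ≤ m N.y q - 1 := by omega
    rw [h2, d9]
    push Not
    refine exists_congr fun r => and_congr_right fun hr => ?_
    have h3 := XM p hp
    have h4 := A'M r hr
    rw [← and_assoc, hLL r hr, hcx p hp, hca' r hr, and_assoc]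
    refine and_congr_right fun _ => and_congr ?_ ?_ <;> omega
  have hT3 : ∀ i, ∀ q < n, (m N.y q ≤ m (k + 14) i ↔ ∀ p < n, m N.x p < m N.a i →
      Feasible n (m N.x) (m N.y) (m N.a) (m N.a') (m N.b) (m N.b') p q) ∧
      (m N.cy q < m (k + 13) i ↔ ¬ ∀ p < n, m N.x p < m N.a i →
      Feasible n (m N.x) (m N.y) (m N.a) (m N.a') (m N.b) (m N.b') p q) := fun i q hq => by
    have h1 := d13 i (m N.y q) ((YM q hq).trans (Nat.le_succ _))
    rw [e14, h1.1, hcy q hq, ← not_le, h1.2]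
    have h2 : (∀ j < n, m N.x j < m N.a i → m N.y q ≤ m (k + 9) j) ↔ ∀ p < n, m N.x p < m N.a i →
      Feasible n (m N.x) (m N.y) (m N.a) (m N.a') (m N.b) (m N.b') p q :=
      forall₃_congr fun p hp _ => ht p hp q hq
    rw [h2]
    exact ⟨Iff.rfl, Iff.rfl⟩
  have hT2 : ∀ i, ∀ q < n, (m N.y q ≤ m (k + 16) i ↔ ∀ p < n, m N.y p < m N.b i →
      Feasible n (m N.x) (m N.y) (m N.a) (m N.a') (m N.b) (m N.b') p q) ∧
      (m N.cy q < m (k + 15) i ↔ ¬ ∀ p < n, m N.y p < m N.b i →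
      Feasible n (m N.x) (m N.y) (m N.a) (m N.a') (m N.b) (m N.b') p q) := fun i q hq => by
    have h1 := d15 i (m N.y q) ((YM q hq).trans (Nat.le_succ _))
    rw [e16, h1.1, hcy q hq, ← not_le, h1.2]
    have h2 : (∀ j < n, m N.y j < m N.b i → m N.y q ≤ m (k + 9) j) ↔ ∀ p < n, m N.y p < m N.b i →
      Feasible n (m N.x) (m N.y) (m N.a) (m N.a') (m N.b) (m N.b') p q :=
      forall₃_congr fun p hp _ => ht p hp q hq
    rw [h2]
    exact ⟨Iff.rfl, Iff.rfl⟩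
  have htM : ∀ p, m (k + 9) p ≤ M := fun p => (d9 p M).2 fun r hr _ => B'M r hr
  have hct : ∀ p < n, ∀ q < n, m N.cy q < m (k + 10) p ↔
      ¬ Feasible n (m N.x) (m N.y) (m N.a) (m N.a') (m N.b) (m N.b') p q := fun p hp q hq => by
    rw [← ht p hp q hq, e10, hcy q hq]
    have h1 := htM p
    have h2 := YM q hq
    omega
  have hQ3C : ∀ i, m (k + 17) i ≤ M + 1 := fun i =>
    (d17 i _).2 fun q hq _ => (YM q hq).trans (Nat.le_succ _)
  have hT2C : ∀ i, m (k + 15) i ≤ M + 1 := fun i => by simpa using ((d15 i 0 (Nat.zero_le _)).2).2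
  have hx' : ∀ p < n, ∀ i < n, m N.cx p < m N.ca' i ↔ m N.a' i < m N.x p := fun p hp i hi => by
    have h1 := XM p hp
    have h2 := A'M i hi
    rw [hcx p hp, hca' i hi]
    omega
  have hy' : ∀ p < n, ∀ i < n, m N.cy p < m N.cb' i ↔ m N.b' i < m N.y p := fun p hp i hi => by
    have h1 := YM p hp
    have h2 := B'M i hi
    rw [hcy p hp, hcb' i hi]
    omega
  have hrA : ∀ r < n, ∀ u, m N.ca' r ≤ M + 1 - u ↔ u ≤ m N.a' r := fun r hr u => by
    have h1 := A'M r hr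
    rw [hca' r hr]
    omega
  have hrB : ∀ r < n, ∀ u, m N.cb' r ≤ M + 1 - u ↔ u ≤ m N.b' r := fun r hr u => by
    have h1 := B'M r hr
    rw [hcb' r hr]
    omega
  have hAC : ∀ r < n, m N.a r ≤ M + 1 := fun r hr => (AM r hr).trans (Nat.le_succ _)
  have hBC : ∀ r < n, m N.b r ≤ M + 1 := fun r hr => (BM r hr).trans (Nat.le_succ _)
  set P := PairCond n (m N.x) (m N.y) (m N.a) (m N.a') (m N.b) (m N.b') with hP
  set F := Feasible n (m N.x) (m N.y) (m N.a) (m N.a') (m N.b) (m N.b') with hF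
  have c0 : ∀ j, m (k + 19) j ≤ m (k + 16) j ↔
      ∀ q < n, m N.y q < m N.b j → ∀ p < n, m N.y p < m N.b j → F p q := fun j => by
    rw [d19]
    exact forall₃_congr fun q hq _ => (hT2 j q hq).1
  have c1 : ∀ i j, m (k + 19) j ≤ m (k + 14) i ↔
      ∀ q < n, m N.y q < m N.b j → ∀ p < n, m N.x p < m N.a i → F p q := fun i j => by
    rw [d19]
    exact forall₃_congr fun q hq _ => (hT3 i q hq).1
  have c2 : ∀ i j, m (k + 15) j ≤ m (k + 18) i ↔
      ∀ q < n, m N.x q < m N.a i → ∀ p < n, m N.y p < m N.b j → F p q := fun i j => by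
    have h1 : m (k + 15) j ≤ m (k + 18) i ↔ m (k + 17) i ≤ m (k + 16) j := by
      rw [e18, e16]
      have h1 := hQ3C i
      have h2 := hT2C j
      omega
    rw [h1, d17]
    exact forall₃_congr fun q hq _ => (hT2 j q hq).1
  have c3 : ∀ i, ∀ j < n, m N.a j ≤ m (k + 26) i ↔ ∀ q < n, m N.y q < m N.b i ∧
      (¬ ∀ p < n, m N.x p < m N.a i → F p q) → m N.a j ≤ m N.x q := fun i j hj => by
    rw [e26, d25 i _ (hAC j hj)]
    exact forall₂_congr fun q hq => by rw [(hT3 i q hq).2]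
  have c4 : ∀ i, ∀ j < n, m N.a j ≤ m (k + 28) i ↔ ∀ p < n, m N.y p < m N.b i ∧
      (¬ ∀ q < n, m N.x q < m N.a i → F p q) → m N.a j ≤ m N.x p := fun i j hj => by
    rw [e28, d27 i _ (hAC j hj)]
    refine forall₂_congr fun p hp => ?_
    rw [← not_le (b := m (k + 9) p), d17, forall₃_congr fun q hq _ => ht p hp q hq]
  have c5 : ∀ i < n, ∀ j < n, m N.a j ≤ m (k + 30) i ↔ ∀ p < n, m N.y p < m N.b i ∧
      (¬ ∀ q < n, m N.x q ≤ m N.x p ∧ ¬ F p q → m N.b i ≤ m N.y q) → m N.a j ≤ m N.x p :=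
    fun i hi j hj => by
    rw [e30, d29 i _ (hAC j hj)]
    refine forall₂_congr fun p hp => ?_
    rw [← not_le (a := m N.b i) (b := m (k + 12) p), e12, d11 p _ (hBC i hi)]
    rw [forall₂_congr fun q hq => by rw [hct p hp q hq]]
  have c6 : ∀ i < n, ∀ j, m (k + 31) j ≤ m N.cb i ↔ ∀ q < n, m N.x q < m N.a j ∧
      (¬ ∀ p < n, m N.y p < m N.b j → F p q) → m N.b i ≤ m N.y q := fun i hi j => by
    rw [hcb i hi, d31 j _ (hBC i hi)]
    exact forall₂_congr fun q hq => by rw [(hT2 j q hq).2]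
  have c7 : ∀ i < n, ∀ j, m (k + 32) j ≤ m N.cb i ↔ ∀ p < n, m N.x p < m N.a j ∧
      (¬ ∀ q < n, m N.y q < m N.b j → F p q) → m N.b i ≤ m N.y p := fun i hi j => by
    rw [hcb i hi, d32 j _ (hBC i hi)]
    refine forall₂_congr fun p hp => ?_
    rw [← not_le (b := m (k + 9) p), d19, forall₃_congr fun q hq _ => ht p hp q hq]
  have c8 : ∀ i < n, ∀ j < n, m N.a j ≤ m (k + 34) i ↔
      ∀ p < n, m N.a' i < m N.x p → m N.a j ≤ m N.x p := fun i hi j hj => by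
    rw [e34, d33 i _ (hAC j hj)]
    exact forall₂_congr fun p hp => by rw [hx' p hp i hi]
  have c9 : ∀ i < n, ∀ j < n, m N.b j ≤ m (k + 36) i ↔
      ∀ p < n, m N.a' i < m N.x p → m N.b j ≤ m N.y p := fun i hi j hj => by
    rw [e36, d35 i _ (hBC j hj)]
    exact forall₂_congr fun p hp => by rw [hx' p hp i hi]
  have c10 : ∀ i < n, ∀ j < n, m N.cb' j ≤ m (k + 38) i ↔
      ∀ p < n, m N.a' i < m N.x p → m N.y p ≤ m N.b' j := fun i hi j hj => by
    rw [e38, hrB j hj, d37]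
    exact forall₂_congr fun p hp => by rw [hx' p hp i hi]
  have c11 : ∀ i < n, ∀ j < n, m (k + 41) j ≤ m N.cb i ↔
      ∀ p < n, m N.b' j < m N.y p → m N.b i ≤ m N.y p := fun i hi j hj => by
    rw [hcb i hi, (d41 j _ (hBC i hi)).2]
    exact forall₂_congr fun p hp => by rw [hy' p hp j hj]
  have c12 : ∀ i < n, ∀ j < n, m (k + 39) j ≤ m N.ca i ↔
      ∀ p < n, m N.b' j < m N.y p → m N.a i ≤ m N.x p := fun i hi j hj => by
    rw [hca i hi, (d39 j _ (hAC i hi)).2]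
    exact forall₂_congr fun p hp => by rw [hy' p hp j hj]
  have c13 : ∀ i, ∀ j < n, m (k + 43) j ≤ m N.a' i ↔
      ∀ p < n, m N.b' j < m N.y p → m N.x p ≤ m N.a' i := fun i j hj => by
    rw [d43]
    exact forall₂_congr fun p hp => by rw [hy' p hp j hj]
  have c14 : ∀ i, ∀ j < n, m N.ca' j ≤ m (k + 6) i ↔ ∀ p < n, m N.x p ≤ m N.a' j :=
    fun i j hj => by rw [e6, hrA j hj, d5]
  have c15 := fun i j => d7 j (m N.b' i)
  have hcond : ∀ i < n, ∀ j < n, ((m (k + 19) j ≤ m (k + 14) i ∧ m (k + 15) j ≤ m (k + 18) i ∧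
      m N.a j ≤ m (k + 26) i ∧ m N.a j ≤ m (k + 28) i ∧ m N.a j ≤ m (k + 30) i ∧
      m (k + 31) j ≤ m N.cb i ∧ m (k + 32) j ≤ m N.cb i ∧ m N.a j ≤ m (k + 34) i ∧
      m N.b j ≤ m (k + 36) i ∧ m N.cb' j ≤ m (k + 38) i ∧ m (k + 41) j ≤ m N.cb i ∧
      m (k + 39) j ≤ m N.ca i ∧ m (k + 43) j ≤ m N.a' i ∧ m N.ca' j ≤ m (k + 6) i ∧
      m (k + 7) j ≤ m N.b' i) ∧ m (k + 19) j ≤ m (k + 16) j) ↔ P i j := fun i hi j hj => by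
    rw [c0, c1, c2, c3 i j hj, c4 i j hj, c5 i hi j hj, c6 i hi, c7 i hi, c8 i hi j hj,
      c9 i hi j hj, c10 i hi j hj, c11 i hi j hj, c12 i hi j hj, c13 i j hj, c14 i j hj, c15]
    constructor
    · rintro ⟨⟨h1, h2, h3, h4, h5, h6, h7, h8, h9, h10, h11, h12, h13, h14, h15⟩, h0⟩
      exact ⟨⟨fun p hp h => ⟨h8 p hp h, h9 p hp h, h10 p hp h⟩,
        fun p hp h => ⟨h11 p hp h, h12 p hp h, h13 p hp h⟩, h14, h15⟩,
        fun p hp q hq u v => h0 q hq v p hp u, fun p hp q hq u v => h1 q hq v p hp u,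
        fun p hp q hq u v => h2 q hq v p hp u,
        fun p hp q hq u v f => h3 q hq ⟨u, fun g => f (g p hp v)⟩,
        fun p hp q hq u v f => h4 p hp ⟨u, fun g => f (g q hq v)⟩,
        fun p hp q hq u v x f => h5 p hp ⟨u, fun g => absurd (g q hq ⟨v, f⟩) (not_le.2 x)⟩,
        fun p hp q hq u v f => h6 q hq ⟨u, fun g => f (g p hp v)⟩,
        fun p hp q hq u v f => h7 p hp ⟨u, fun g => f (g q hq v)⟩⟩
    · intro h
      refine ⟨⟨fun q hq v p hp u => h.upper_right p hp q hq u v,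
        fun q hq v p hp u => h.right_upper p hp q hq u v, ?_, ?_, ?_, ?_, ?_,
        fun p hp u => (h.right p hp u).1, fun p hp u => (h.right p hp u).2.1,
        fun p hp u => (h.right p hp u).2.2, fun p hp u => (h.upper p hp u).1,
        fun p hp u => (h.upper p hp u).2.1, fun p hp u => (h.upper p hp u).2.2, h.rightmost,
        h.topmost⟩, fun q hq v p hp u => h.right_right p hp q hq u v⟩
      · rintro q hq ⟨u, v⟩
        push Not at v
        obtain ⟨p, hp, v, f⟩ := v
        exact h.upper_both p hp q hq u v f
      · rintro p hp ⟨u, v⟩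
        push Not at v
        obtain ⟨q, hq, v, f⟩ := v
        exact h.both_upper p hp q hq u v f
      · rintro p hp ⟨u, v⟩
        push Not at v
        obtain ⟨q, hq, ⟨v, f⟩, x⟩ := v
        exact h.both_both p hp q hq u v x f
      · rintro q hq ⟨u, v⟩
        push Not at v
        obtain ⟨p, hp, v, f⟩ := v
        exact h.right_both p hp q hq u v f
      · rintro p hp ⟨u, v⟩
        push Not at v
        obtain ⟨q, hq, v, f⟩ := v
        exact h.both_right p hp q hq u v f
  have hgather : ∀ b c i, (Cmd.gather b c).sem n (M + 3) m i =
      if m c i ≤ n then m b (m c i - 1) else 0 := fun _ _ _ => rfl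
  have hforced : ∀ i, ∀ j < n, m (k + 45) i = j + 1 → ∀ r < n,
      ((m N.a r ≤ m (k + 2) i ∧ m N.b r ≤ m (k + 4) i ∧ m N.ca' r ≤ m (k + 22) i ∧
      m N.ca' r ≤ m (k + 51) i ∧ m N.ca' r ≤ m (k + 48) i ∧ m N.cb' r ≤ m (k + 18) i ∧
      m N.cb' r ≤ m (k + 52) i ∧ m N.cb' r ≤ m (k + 50) i) ↔
      LowerLeft n (m N.x) (m N.y) (m N.a) (m N.b) r ∧ ∀ p < n,
        Forced (m N.x) (m N.y) (m N.a) (m N.b) j i p → m N.x p ≤ m N.a' r ∧ m N.y p ≤ m N.b' r) := by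
    intro i j hj hJ r hr
    have g46 : m (k + 46) i = m N.a j := by
      rw [e46, hgather, hJ, if_pos (by omega), Nat.add_sub_cancel]
    have g51 : m (k + 51) i = m (k + 24) j := by
      rw [e51, hgather, hJ, if_pos (by omega), Nat.add_sub_cancel]
    have g52 : m (k + 52) i = m (k + 20) j := by
      rw [e52, hgather, hJ, if_pos (by omega), Nat.add_sub_cancel]
    rw [← and_assoc, hLL r hr, g51, g52, e22, e24, e48, e18, e20, e50, hrA r hr, hrA r hr,
      hrA r hr, hrB r hr, hrB r hr, hrB r hr, d21, d23, d47, d17, d19, d49, g46]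
    refine and_congr_right fun _ => ⟨?_, fun h => ⟨?_, ?_, ?_, ?_, ?_, ?_⟩⟩
    · rintro ⟨h1, h2, h3, h4, h5, h6⟩ p hp (h | h | h)
      · exact ⟨h1 p hp h, h4 p hp h⟩
      · exact ⟨h2 p hp h, h5 p hp h⟩
      · exact ⟨h3 p hp h, h6 p hp h⟩
    · exact fun p hp hq => (h p hp (.inl hq)).1
    · exact fun p hp hq => (h p hp (.inr (.inl hq))).1
    · exact fun p hp hq => (h p hp (.inr (.inr hq))).1
    · exact fun p hp hq => (h p hp (.inl hq)).2
    · exact fun p hp hq => (h p hp (.inr (.inl hq))).2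
    · exact fun p hp hq => (h p hp (.inr (.inr hq))).2
  have hk : ∀ i, m k i = i + 1 := fun i => by rw [e0]; rfl
  have hgood : ∀ j, m (k + 44) j = if m (k + 19) j ≤ m (k + 16) j then j + 1 else 0 := fun j => by
    rw [e44]; simp only [Cmd.sem, hk]
  have hJex : ∀ i < n, 0 < m (k + 45) i → ∃ j < n, m (k + 45) i = j + 1 ∧ P i j := by
    intro i hi hJ
    obtain ⟨j, hj, h1, h2⟩ := d45' i hJ
    rw [hgood] at h2
    split_ifs at h2 with h3
    · exact ⟨j, hj, h2.symm, (hcond i hi j hj).1 ⟨h1, h3⟩⟩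
    · omega
  have h1ex : ∀ j, ∀ r < n, ((m N.a r ≤ m (k + 2) j ∧ m N.b r ≤ m (k + 4) j ∧
      m N.ca' r ≤ m (k + 22) j ∧ m N.ca' r ≤ m (k + 24) j ∧ m N.cb' r ≤ m (k + 18) j ∧
      m N.cb' r ≤ m (k + 20) j) ↔ LowerLeft n (m N.x) (m N.y) (m N.a) (m N.b) r ∧
      ∀ p < n, (m N.x p < m N.a j ∨ m N.y p < m N.b j) →
        m N.x p ≤ m N.a' r ∧ m N.y p ≤ m N.b' r) := by
    intro j r hr
    rw [← and_assoc, hLL r hr, e22, e24, e18, e20, hrA r hr, hrA r hr, hrB r hr, hrB r hr, d21, d23,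
      d17, d19]
    refine and_congr_right fun _ => ⟨?_, fun h => ⟨?_, ?_, ?_, ?_⟩⟩
    · rintro ⟨h1, h2, h4, h5⟩ p hp (h | h)
      · exact ⟨h1 p hp h, h4 p hp h⟩
      · exact ⟨h2 p hp h, h5 p hp h⟩
    · exact fun p hp hq => (h p hp (.inl hq)).1
    · exact fun p hp hq => (h p hp (.inr hq)).1
    · exact fun p hp hq => (h p hp (.inl hq)).2
    · exact fun p hp hq => (h p hp (.inr hq)).2
  have h2ex : ∀ j < n, ∀ r < n, ((m N.a r ≤ m (k + 34) j ∧ m N.a r ≤ m (k + 40) j ∧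
      m N.b r ≤ m (k + 36) j ∧ m N.b r ≤ m (k + 42) j ∧ m N.ca' r ≤ m (k + 6) j ∧
      m N.cb' r ≤ m (k + 8) j) ↔ (∀ p < n, m N.x p ≤ m N.a' r ∧ m N.y p ≤ m N.b' r) ∧
      ∀ p < n, (m N.a' j < m N.x p ∨ m N.b' j < m N.y p) →
        m N.a r ≤ m N.x p ∧ m N.b r ≤ m N.y p) := by
    intro j hj r hr
    rw [c8 j hj r hr, c9 j hj r hr, c14 j r hr, e8, hrB r hr, d7, e40, e42,
      (d39 j _ (hAC r hr)).1, (d41 j _ (hBC r hr)).1]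
    constructor
    · rintro ⟨h1, h2, h3, h4, h5, h6⟩
      refine ⟨fun p hp => ⟨h5 p hp, h6 p hp⟩, fun p hp h => ?_⟩
      rcases h with h | h
      · exact ⟨h1 p hp h, h3 p hp h⟩
      · exact ⟨h2 p hp ((hy' p hp j hj).2 h), h4 p hp ((hy' p hp j hj).2 h)⟩
    · rintro ⟨h1, h2⟩
      exact ⟨fun p hp h => (h2 p hp (.inl h)).1,
        fun p hp h => (h2 p hp (.inr ((hy' p hp j hj).1 h))).1,
        fun p hp h => (h2 p hp (.inl h)).2,
        fun p hp h => (h2 p hp (.inr ((hy' p hp j hj).1 h))).2,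
        fun p hp => (h1 p hp).1, fun p hp => (h1 p hp).2⟩
  refine ⟨?_, ?_, ?_, ?_⟩
  · intro i hi h1 h2
    obtain ⟨j, hj, hJ, hpc⟩ := hJex i hi h2
    obtain ⟨r, hr, hr1, hr2⟩ := d53' i h1
    rw [hforced i j hj hJ r hr] at hr1
    exact ⟨r, hr, j, hj, by rw [← hr2, hk], hJ, covers_of_forced hr1.1 hr1.2 hpc.toPairOuter⟩
  · intro r hr j hj i hi hcov hA hA' hB hB'
    have hpc := (hcond i hi j hj).2 (pairCond_of_covers hI hr hj hi hcov hA hA' hB hB')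
    have h1 := (d45 i _).1 le_rfl j hj hpc.1
    rw [hgood, if_pos hpc.2] at h1
    have hJ : 0 < m (k + 45) i := by omega
    refine ⟨?_, hJ⟩
    -- The stored j' may differ from j. It satisfies the pair condition with i, and the points to
    -- the left of i all lie in r, so some lower left square completes i and j'.
    obtain ⟨j', hj', hJ', hpc'⟩ := hJex i hi hJ
    have hL := lowerLeft_of_covers hcov (hA.trans hA') hA hB (hB.trans hB')
    obtain ⟨r', hr', hL', hf'⟩ := exists_of_pairCond ⟨r, hr, hL⟩ hpc' (fun p hp q hq hp1 hq1 => by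
      have key : ∀ p < n, m N.x p < m N.a i → m N.x p ≤ m N.a' r ∧ m N.y p ≤ m N.b' r := by
        intro p hp hp1
        rcases hcov p hp with h | h | h <;> obtain ⟨h1, h2, h3, h4⟩ := h <;> omega
      exact ⟨r, hr, hL, (key p hp hp1).1, (key q hq hq1).2⟩)
    have h2 := (d53 i _).1 le_rfl r' hr' ((hforced i j' hj' hJ' r' hr').2 ⟨hL', hf'⟩)
    rw [hk] at h2
    omega
  · intro j hj h1 h2
    obtain ⟨r, hr, hr1, hr2⟩ := d54' j h1
    obtain ⟨l, hl, hl1, hl2⟩ := d55' j h2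
    rw [h1ex j r hr] at hr1
    rw [h2ex j hj l hl] at hl1
    exact ⟨r, hr, l, hl, by rw [← hr2, hk], by rw [← hl2, hk],
      covers_of_monoCond ⟨hr1.1, hr1.2, hl1.1, hl1.2⟩⟩
  · intro r hr j hj l hl hcov hA hA' hB hB'
    have hmc := monoCond_of_covers hI hr hj hl hcov hA hA' hB hB'
    have h1 := (d54 j _).1 le_rfl r hr ((h1ex j r hr).2 ⟨hmc.lower, hmc.below⟩)
    have h2 := (d55 j _).1 le_rfl l hl ((h2ex j hj l hl).2 ⟨hmc.upper, hmc.above⟩)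
    rw [hk] at h1 h2
    omega

end ThreeSquares

namespace ThreeSquares
open RealRAM

variable {n M : ℕ} {X Y A A' B B' U V V' : ℕ → ℕ}

/-! ### Reflections -/

/-- Reflection turns right sides into left sides, so the new left side is the complement of the old
right side. Complements in M + 1 keep ranks between 1 and M. -/
theorem Instance.flipX (h : Instance n M X Y A A' B B') (hU : ∀ p < n, U p = M + 1 - X p)
    (hV : ∀ p < n, V p = M + 1 - A' p) (hV' : ∀ p < n, V' p = M + 1 - A p) :
    Instance n M U Y V V' B B' where
  X_pos p hp := by have := h.X_le p hp; rw [hU p hp]; omega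
  X_le p hp := by have := h.X_pos p hp; rw [hU p hp]; omega
  Y_pos := h.Y_pos
  Y_le := h.Y_le
  A_le p hp := by have := h.A'_pos p hp; rw [hV p hp]; omega
  A'_le p hp := by have := h.A_pos p hp; rw [hV' p hp]; omega
  B_le := h.B_le
  B'_le := h.B'_le
  A_iff p hp q hq := by
    have h1 := h.A_iff q hq p hp
    have h2 := h.A_le p hp; have h3 := h.A_le q hq
    have h4 := h.A'_le p hp; have h5 := h.A'_le q hq
    rw [hV p hp, hV q hq, hV' p hp, hV' q hq]; omega
  B_iff := h.B_iff
  A_pos p hp := by have := h.A'_le p hp; rw [hV p hp]; omega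
  A'_pos p hp := by have := h.A_le p hp; rw [hV' p hp]; omega
  B_pos := h.B_pos
  B'_pos := h.B'_pos

theorem Instance.swap (h : Instance n M X Y A A' B B') : Instance n M Y X B B' A A' :=
  ⟨h.Y_pos, h.Y_le, h.X_pos, h.X_le, h.B_le, h.B'_le, h.A_le, h.A'_le, h.B_iff, h.A_iff,
    h.B_pos, h.B'_pos, h.A_pos, h.A'_pos⟩

theorem Instance.flipY (h : Instance n M X Y A A' B B') (hU : ∀ p < n, U p = M + 1 - Y p)
    (hV : ∀ p < n, V p = M + 1 - B' p) (hV' : ∀ p < n, V' p = M + 1 - B p) :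
    Instance n M X U A A' V V' :=
  (h.swap.flipX hU hV hV').swap

theorem covers_flipX (h : Instance n M X Y A A' B B') (hU : ∀ p < n, U p = M + 1 - X p)
    (hV : ∀ p < n, V p = M + 1 - A' p) (hV' : ∀ p < n, V' p = M + 1 - A p) {i j k : ℕ}
    (hi : i < n) (hj : j < n) (hk : k < n) :
    Covers n U Y V V' B B' i j k ↔ Covers n X Y A A' B B' i j k := by
  refine forall₂_congr fun p hp => ?_
  have key : ∀ r < n, Contains U Y V V' B B' r p ↔ Contains X Y A A' B B' r p := by
    intro r hr
    simp only [Contains]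
    have h1 := h.X_le p hp
    have h2 := h.A_le r hr
    have h3 := h.A'_le r hr
    rw [hU p hp, hV r hr, hV' r hr]
    omega
  rw [key i hi, key j hj, key k hk]

theorem covers_swap {i j k : ℕ} :
    Covers n Y X B B' A A' i j k ↔ Covers n X Y A A' B B' i j k := by
  refine forall₂_congr fun p hp => ?_
  simp only [Contains]
  tauto

theorem covers_flipY (h : Instance n M X Y A A' B B') (hU : ∀ p < n, U p = M + 1 - Y p)
    (hV : ∀ p < n, V p = M + 1 - B' p) (hV' : ∀ p < n, V' p = M + 1 - B p) {i j k : ℕ}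
    (hi : i < n) (hj : j < n) (hk : k < n) :
    Covers n X U A A' V V' i j k ↔ Covers n X Y A A' B B' i j k := by
  rw [← covers_swap, covers_flipX h.swap hU hV hV' hi hj hk, covers_swap]

theorem covers_perm₁ {i j k : ℕ} (h : Covers n X Y A A' B B' i j k) :
    Covers n X Y A A' B B' j i k := fun p hp => by
  have := h p hp; tauto

theorem covers_perm₂ {i j k : ℕ} (h : Covers n X Y A A' B B' i j k) :
    Covers n X Y A A' B B' i k j := fun p hp => by
  have := h p hp; tauto

/-- No three squares in a position for which `CoreSpec` promises completeness. -/
def NoHit (n : ℕ) (X Y A A' B B' : ℕ → ℕ) (le le' : ℕ → ℕ → Prop) : Prop :=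
  ∀ r < n, ∀ j < n, ∀ i < n, Covers n X Y A A' B B' r j i →
    (le r i → le i j → le' r j → le' j i → False) ∧ (le r j → le j i → le' r j → le' j i → False)

/-- With the squares sorted by abscissa, the ordinates are in one of six orders. Two are monotone.
In each of the other four, one square is extreme in both coordinates, and reflecting it to the lower
left leaves an upper and a right square. -/
theorem not_covers_of_noHit
    (h₁ : NoHit n X Y A A' B B' (fun i j => A i ≤ A j) (fun i j => B i ≤ B j))
    (h₂ : NoHit n X Y A A' B B' (fun i j => A j ≤ A i) (fun i j => B i ≤ B j))
    (h₃ : NoHit n X Y A A' B B' (fun i j => A i ≤ A j) (fun i j => B j ≤ B i))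
    (h₄ : NoHit n X Y A A' B B' (fun i j => A j ≤ A i) (fun i j => B j ≤ B i))
    {i j k : ℕ} (hi : i < n) (hj : j < n) (hk : k < n) : ¬ Covers n X Y A A' B B' i j k := by
  have sorted : ∀ r < n, ∀ j < n, ∀ i < n, A r ≤ A j → A j ≤ A i →
      ¬ Covers n X Y A A' B B' r j i := by
    intro r hr j hj i hi h1 h2 h
    rcases le_total (B r) (B j) with h3 | h3 <;> rcases le_total (B j) (B i) with h4 | h4
    · exact (h₁ r hr j hj i hi h).2 h1 h2 h3 h4
    · rcases le_total (B r) (B i) with h5 | h5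
      · exact (h₁ r hr i hi j hj (covers_perm₂ h)).1 h1 h2 h5 h4
      · exact (h₂ i hi r hr j hj (covers_perm₁ (covers_perm₂ h))).1 h2 h1 h5 h3
    · rcases le_total (B r) (B i) with h5 | h5
      · exact (h₄ i hi r hr j hj (covers_perm₁ (covers_perm₂ h))).1 h2 h1 h5 h3
      · exact (h₃ r hr i hi j hj (covers_perm₂ h)).1 h1 h2 h5 h4
    · exact (h₃ r hr j hj i hi h).2 h1 h2 h3 h4
  intro h
  have p1 := covers_perm₁ h
  have p2 := covers_perm₂ h
  rcases le_total (A i) (A j) with h1 | h1 <;> rcases le_total (A j) (A k) with h2 | h2 <;>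
    rcases le_total (A i) (A k) with h3 | h3
  · exact sorted i hi j hj k hk h1 h2 h
  · exact sorted i hi j hj k hk h1 h2 h
  · exact sorted i hi k hk j hj h3 h2 p2
  · exact sorted k hk i hi j hj h3 h1 (covers_perm₁ p2)
  · exact sorted j hj i hi k hk h1 h3 p1
  · exact sorted j hj k hk i hi h2 h3 (covers_perm₂ p1)
  · exact sorted k hk j hj i hi h2 h1 (covers_perm₂ (covers_perm₁ p2))
  · exact sorted k hk j hj i hi h2 h1 (covers_perm₂ (covers_perm₁ p2))

/-- The arrays computed before the core programs: `0, …, 5` describe the instance, `6, …, 11` are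
their complements.  The names for the instance and for its reflections. -/
def names : Bool → Bool → Names
  | false, false => ⟨0, 6, 3, 9, 1, 7, 2, 8, 4, 10, 5, 11⟩
  | true, false => ⟨6, 0, 3, 9, 8, 2, 7, 1, 4, 10, 5, 11⟩
  | false, true => ⟨0, 6, 9, 3, 1, 7, 2, 8, 11, 5, 10, 4⟩
  | true, true => ⟨6, 0, 9, 3, 8, 2, 7, 1, 11, 5, 10, 4⟩

/-- All array commands. -/
def commands : List Cmd :=
  [.co 0, .co 1, .co 2, .co 3, .co 4, .co 5] ++ (core (names false false) 12 ++
    (core (names true false) 68 ++ (core (names false true) 124 ++ core (names true true) 180)))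

/-- The triples of arrays in which solutions are reported. -/
def reports : List (ℕ × ℕ × ℕ) :=
  [12, 68, 124, 180].flatMap fun k => [(k + 53, k + 45, k), (k + 54, k, k + 55)]

/-- The arrays of the triple `t` report a solution at the position `i`. -/
def Hit (m : ℕ → ℕ → ℕ) (t : ℕ × ℕ × ℕ) (i : ℕ) : Prop :=
  0 < m t.1 i ∧ 0 < m t.2.1 i ∧ 0 < m t.2.2 i

theorem solves_append {n K : ℕ} {m : ℕ → ℕ → ℕ} : ∀ {l l' : List Cmd} {k : ℕ},
    Cmd.Solves n K m k (l ++ l') ↔ Cmd.Solves n K m k l ∧ Cmd.Solves n K m (k + l.length) l'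
  | [], l', k => by simp [Cmd.Solves]
  | c :: l, l', k => by
    simp only [List.cons_append, Cmd.Solves, solves_append (l := l), and_assoc, List.length_cons]
    rw [Nat.add_assoc k 1, Nat.add_comm 1]

theorem core_length : ∀ (N : Names) (k : ℕ), (core N k).length = 56 := fun _ _ => rfl

theorem coreSpec_hit {m : ℕ → ℕ → ℕ} {k : ℕ}
    (hk : ∀ i, m k i = i + 1)
    (h : CoreSpec n X Y A A' B B' (m (k + 53)) (m (k + 45)) (m (k + 54)) (m (k + 55))) :
    (∀ t ∈ [(k + 53, k + 45, k), (k + 54, k, k + 55)], ∀ i < n, Hit m t i →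
      ∃ r < n, ∃ j < n, ∃ l < n, m t.1 i = r + 1 ∧ m t.2.1 i = j + 1 ∧ m t.2.2 i = l + 1 ∧
        Covers n X Y A A' B B' r j l) ∧
    ((∀ t ∈ [(k + 53, k + 45, k), (k + 54, k, k + 55)], ∀ i < n, ¬ Hit m t i) →
      NoHit n X Y A A' B B' (fun i j => A i ≤ A j) (fun i j => B i ≤ B j)) := by
  simp only [List.mem_cons, List.not_mem_nil, or_false, forall_eq_or_imp, forall_eq, Hit]
  refine ⟨⟨fun i hi ⟨h1, h2, h3⟩ => ?_, fun i hi ⟨h1, h2, h3⟩ => ?_⟩, fun ⟨h1, h2⟩ => ?_⟩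
  · obtain ⟨r, hr, j, hj, e1, e2, hc⟩ := h.sound i hi h1 h2
    exact ⟨r, hr, j, hj, i, hi, e1, e2, hk i, hc⟩
  · obtain ⟨r, hr, l, hl, e1, e2, hc⟩ := h.sound_mono i hi h1 h3
    exact ⟨r, hr, i, hi, l, hl, e1, hk i, e2, hc⟩
  · intro r hr j hj i hi hc
    refine ⟨fun u1 u2 u3 u4 => ?_, fun u1 u2 u3 u4 => ?_⟩
    · obtain ⟨v1, v2⟩ := h.complete r hr j hj i hi hc u1 u2 u3 u4
      exact h1 i hi ⟨v1, v2, by rw [hk]; omega⟩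
    · obtain ⟨v1, v2⟩ := h.complete_mono r hr j hj i hi hc u1 u2 u3 u4
      exact h2 j hj ⟨v1, by rw [hk]; omega, v2⟩

theorem NoHit.imp {n : ℕ} {X Y A A' B B' X₁ Y₁ A₁ A₁' B₁ B₁' : ℕ → ℕ}
    {le le' le₁ le₁' : ℕ → ℕ → Prop} (h : NoHit n X Y A A' B B' le le')
    (hc : ∀ i < n, ∀ j < n, ∀ k < n, Covers n X₁ Y₁ A₁ A₁' B₁ B₁' i j k →
      Covers n X Y A A' B B' i j k)
    (hle : ∀ i < n, ∀ j < n, le₁ i j → le i j) (hle' : ∀ i < n, ∀ j < n, le₁' i j → le' i j) :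
    NoHit n X₁ Y₁ A₁ A₁' B₁ B₁' le₁ le₁' := by
  intro r hr j hj i hi hcov
  obtain ⟨h1, h2⟩ := h r hr j hj i hi (hc r hr j hj i hi hcov)
  exact ⟨fun u1 u2 u3 u4 => h1 (hle _ hr _ hi u1) (hle _ hi _ hj u2) (hle' _ hr _ hj u3)
      (hle' _ hj _ hi u4),
    fun u1 u2 u3 u4 => h2 (hle _ hr _ hj u1) (hle _ hj _ hi u2) (hle' _ hr _ hj u3)
      (hle' _ hj _ hi u4)⟩

theorem commands_spec {m : ℕ → ℕ → ℕ}
    (hI : Instance n M (m 0) (m 3) (m 1) (m 2) (m 4) (m 5))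
    (h : Cmd.Solves n (M + 3) m 6 commands) :
    (∀ t ∈ reports, ∀ i < n, Hit m t i → ∃ r < n, ∃ j < n, ∃ l < n, m t.1 i = r + 1 ∧
      m t.2.1 i = j + 1 ∧ m t.2.2 i = l + 1 ∧
      Covers n (m 0) (m 3) (m 1) (m 2) (m 4) (m 5) r j l) ∧
    ((∀ t ∈ reports, ∀ i < n, ¬ Hit m t i) → ∀ i < n, ∀ j < n, ∀ k < n,
      ¬ Covers n (m 0) (m 3) (m 1) (m 2) (m 4) (m 5) i j k) := by
  simp only [commands, solves_append, core_length, List.length_cons, List.length_nil,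
    Nat.reduceAdd] at h
  obtain ⟨h0, h1, h2, h3, h4⟩ := h
  simp only [Cmd.Solves, Nat.reduceAdd] at h0
  obtain ⟨c0, c1, c2, c3, c4, c5, -⟩ := h0
  have hco : ∀ {f : ℕ → ℕ} {b : ℕ}, f = (Cmd.co b).sem n (M + 3) m →
      ∀ p < n, f p = M + 1 - m b p := by
    rintro f b rfl i -
    simp [Cmd.sem]
  replace c0 := hco c0; replace c1 := hco c1; replace c2 := hco c2; replace c3 := hco c3
  replace c4 := hco c4; replace c5 := hco c5
  have hinv : ∀ {b b'}, (∀ p < n, m b' p = M + 1 - m b p) → (∀ p < n, m b p ≤ M) →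
      ∀ p < n, m b p = M + 1 - m b' p := by
    intro b b' h1 h2 p hp
    have := h1 p hp
    have := h2 p hp
    omega
  have c0' := hinv c0 hI.X_le
  have c1' := hinv c1 hI.A_le
  have c2' := hinv c2 hI.A'_le
  have c3' := hinv c3 hI.Y_le
  have c4' := hinv c4 hI.B_le
  have c5' := hinv c5 hI.B'_le
  have hIx := hI.flipX c0 c2 c1
  have hIy := hI.flipY c3 c5 c4
  have hIxy := hIx.flipY c3 c5 c4
  have iota : ∀ {k N}, Cmd.Solves n (M + 3) m k (core N k) → ∀ i, m k i = i + 1 := by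
    intro k N h i
    rw [h.1]
    rfl
  have s1 := coreSpec_hit (iota h1)
    (coreSpec (N := names false false) hI c0 c3 c1 c2 c4 c5 h1)
  have s2 := coreSpec_hit (iota h2)
    (coreSpec (N := names true false) hIx c0' c3 c2' c1' c4 c5 h2)
  have s3 := coreSpec_hit (iota h3)
    (coreSpec (N := names false true) hIy c0 c3' c1 c2 c5' c4' h3)
  have s4 := coreSpec_hit (iota h4)
    (coreSpec (N := names true true) hIxy c0' c3' c2' c1' c5' c4' h4)
  simp only [names] at s1 s2 s3 s4
  have f2 : ∀ i < n, ∀ j < n, ∀ k < n, _ ↔ _ := fun i hi j hj k hk =>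
    covers_flipX hI c0 c2 c1 hi hj hk
  have f3 : ∀ i < n, ∀ j < n, ∀ k < n, _ ↔ _ := fun i hi j hj k hk =>
    covers_flipY hI c3 c5 c4 hi hj hk
  have f4 : ∀ i < n, ∀ j < n, ∀ k < n, _ ↔ _ := fun i hi j hj k hk =>
    (covers_flipY hIx c3 c5 c4 hi hj hk).trans (f2 i hi j hj k hk)
  -- The left sides of the reflected squares come from the right sides; `A_iff` translates their
  -- order into the reverse order of the original left sides.
  have a8 : ∀ i < n, ∀ j < n, m 1 j ≤ m 1 i → m 8 i ≤ m 8 j := fun i hi j hj h => by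
    rw [c2 i hi, c2 j hj]
    have := (hI.A_iff j hj i hi).1 h
    omega
  have b11 : ∀ i < n, ∀ j < n, m 4 j ≤ m 4 i → m 11 i ≤ m 11 j := fun i hi j hj h => by
    rw [c5 i hi, c5 j hj]
    have := (hI.B_iff j hj i hi).1 h
    omega
  constructor
  · intro t ht i hi hit
    simp only [reports, List.flatMap_cons, List.flatMap_nil, List.append_nil, List.mem_append] at ht
    rcases ht with ht | ht | ht | ht
    · exact s1.1 t ht i hi hit
    · obtain ⟨r, hr, j, hj, l, hl, e1, e2, e3, hc⟩ := s2.1 t ht i hi hit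
      exact ⟨r, hr, j, hj, l, hl, e1, e2, e3, (f2 r hr j hj l hl).1 hc⟩
    · obtain ⟨r, hr, j, hj, l, hl, e1, e2, e3, hc⟩ := s3.1 t ht i hi hit
      exact ⟨r, hr, j, hj, l, hl, e1, e2, e3, (f3 r hr j hj l hl).1 hc⟩
    · obtain ⟨r, hr, j, hj, l, hl, e1, e2, e3, hc⟩ := s4.1 t ht i hi hit
      exact ⟨r, hr, j, hj, l, hl, e1, e2, e3, (f4 r hr j hj l hl).1 hc⟩
  · intro hno i hi j hj k hk
    simp only [reports, List.flatMap_cons, List.flatMap_nil, List.append_nil, List.mem_append,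
      or_imp, forall_and] at hno
    obtain ⟨n1, n2, n3, n4⟩ := hno
    refine not_covers_of_noHit (s1.2 n1)
      ((s2.2 n2).imp (fun i hi j hj k hk => (f2 i hi j hj k hk).2) a8 fun _ _ _ _ h => h)
      ((s3.2 n3).imp (fun i hi j hj k hk => (f3 i hi j hj k hk).2) (fun _ _ _ _ h => h) b11)
      ((s4.2 n4).imp (fun i hi j hj k hk => (f4 i hi j hj k hk).2) a8 b11) hi hj hk

end ThreeSquares

namespace RealRAM.Cmd

instance (k : ℕ) : DecidablePred (WF k) := fun c => by
  unfold WF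
  cases c <;> infer_instance

instance decidableWFList : ∀ (k : ℕ) (l : List Cmd), Decidable (WFList k l)
  | _, [] => isTrue trivial
  | k, c :: l =>
    have := decidableWFList (k + 1) l
    inferInstanceAs (Decidable (c.WF k ∧ WFList (k + 1) l))

set_option maxRecDepth 10000 in
theorem wfList_commands : WFList 6 ThreeSquares.commands := by decide +kernel

end RealRAM.Cmd

namespace RealRAM

/-! ### Ranking the coordinates -/

/-- The states agree on all word registers except number `7`, on the word memory and on the banks
of real memory other than `d`. -/
structure SameOutside (d : ℕ) (s s' : State) : Prop where
  wreg : ∀ r, r ≠ 7 → s'.wreg r = s.wreg r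
  wmem : s'.wmem = s.wmem
  rmem : ∀ b, b ≠ d → s'.rmem b = s.rmem b

theorem SameOutside.trans {d : ℕ} {s s' s'' : State} (h : SameOutside d s s')
    (h' : SameOutside d s' s'') : SameOutside d s s'' :=
  ⟨fun r hr => (h'.wreg r hr).trans (h.wreg r hr), h'.wmem.trans h.wmem,
    fun b hb => (h'.rmem b hb).trans (h.rmem b hb)⟩

theorem runs_fillReal {w n d c : ℕ} {s : State} {e : RExpr} {f : ℕ → ℝ} (h4 : s.wreg 4 = n)
    (hw : n + c * n + 1 < 2 ^ w) (hcw : c < 2 ^ w) (he : e.cost ≤ 10)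
    (hf : ∀ s', SameOutside d s s' → e.eval w s' = f (s'.wreg 7)) :
    Runs w (forUp 7 (.reg 4) (.rstore d (.add (.reg 7) (.mul (.const c) (.reg 4))) e)) s
      ((n + 1) * 40) fun s' => SameOutside d s s' ∧
        ∀ a, s'.rmem d a = if c * n ≤ a ∧ a < c * n + n then f (a - c * n) else s.rmem d a := by
  refine Runs.forUp (B := 20) n (fun k s' => s'.wreg 7 = k ∧ SameOutside d s s' ∧
    ∀ a, s'.rmem d a = if c * n ≤ a ∧ a < c * n + k then f (a - c * n) else s.rmem d a)
    (by omega) (by simp [WExpr.cost]; omega) ?_ ?_ ?_ ?_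
  · refine ⟨by simp, ⟨fun r hr => by simp [hr], by simp, by simp⟩, fun a => ?_⟩
    rw [if_neg (by omega)]
    simp
  · rintro k s' ⟨h7, hs, -⟩
    exact ⟨h7, (hs.wreg 4 (by omega)).trans h4⟩
  · rintro k hk s' ⟨h7, hs, ha⟩
    have hev : (WExpr.add (.reg 7) (.mul (.const c) (.reg 4))).eval w s' = k + c * n := by
      simp only [WExpr.eval, h7, hs.wreg 4 (by omega), h4, Nat.mod_eq_of_lt hcw]
      rw [Nat.mod_eq_of_lt (a := c * n) (by omega), Nat.mod_eq_of_lt (by omega)]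
    refine Runs.rstore (by simp [WExpr.cost]; omega) ⟨by simpa using h7, by simp,
      hs.trans ⟨fun r hr => by simp [hr], by simp, fun b hb => ?_⟩, fun a => ?_⟩
    · rw [setW_rmem, setRM_rmem_ne _ _ _ _ _ hb]
    · rw [setW_rmem, setRM_rmem_same, hev, hf s' hs, h7, ha]
      split_ifs with h1 h2 h2 h2 h2
      · congr 1; omega
      · omega
      · rfl
      · omega
      · omega
      · rfl
  · rintro s' ⟨-, hs, ha⟩
    exact ⟨hs, ha⟩

/-- Write the entries of the real bank `p`, those of the bank `q`, and those of the bank `q`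
increased by `1` one after the other into the bank `d`. -/
def valuesProg (p q d : ℕ) : Prog :=
  .seq (forUp 7 (.reg 4) (.rstore d (.add (.reg 7) (.mul (.const 0) (.reg 4))) (.load p (.reg 7))))
  (.seq (forUp 7 (.reg 4)
      (.rstore d (.add (.reg 7) (.mul (.const 1) (.reg 4))) (.load q (.reg 7))))
    (forUp 7 (.reg 4) (.rstore d (.add (.reg 7) (.mul (.const 2) (.reg 4)))
      (.add (.load q (.reg 7)) (.const 1)))))

theorem runs_valuesProg {w n p q d : ℕ} {s : State} (h4 : s.wreg 4 = n)
    (hw : 3 * n + 2 < 2 ^ w) (hp : p ≠ d) (hq : q ≠ d) :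
    Runs w (valuesProg p q d) s ((n + 1) * 120) fun s' => SameOutside d s s' ∧
      ∀ i < n, s'.rmem d i = s.rmem p i ∧ s'.rmem d (n + i) = s.rmem q i ∧
        s'.rmem d (2 * n + i) = s.rmem q i + 1 := by
  refine Runs.seq ((n + 1) * 40) ((n + 1) * 80) (by omega) ((runs_fillReal (f := s.rmem p) h4
    (by omega) (by omega) (by simp [RExpr.cost, WExpr.cost]) fun s' hs => by
      simp [RExpr.eval, WExpr.eval, hs.rmem p hp]).mono le_rfl ?_)
  rintro s1 ⟨hs1, hr1⟩
  refine Runs.seq ((n + 1) * 40) ((n + 1) * 40) (by omega) ((runs_fillReal (f := s.rmem q)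
    ((hs1.wreg 4 (by omega)).trans h4)
    (by omega) (by omega) (by simp [RExpr.cost, WExpr.cost]) fun s' hs => by
      simp [RExpr.eval, WExpr.eval, (hs1.trans hs).rmem q hq]).mono le_rfl ?_)
  rintro s2 ⟨hs2, hr2⟩
  refine (runs_fillReal (f := fun i => s.rmem q i + 1)
    (((hs1.trans hs2).wreg 4 (by omega)).trans h4)
    (by omega) (by omega) (by simp [RExpr.cost, WExpr.cost]) fun s' hs => by
      simp [RExpr.eval, WExpr.eval, ((hs1.trans hs2).trans hs).rmem q hq]).mono le_rfl ?_
  rintro s3 ⟨hs3, hr3⟩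
  refine ⟨(hs1.trans hs2).trans hs3, fun i hi => ⟨?_, ?_, ?_⟩⟩
  · rw [hr3, if_neg (by omega), hr2, if_neg (by omega), hr1, if_pos (by omega)]
    congr 1; omega
  · rw [hr3, if_neg (by omega), hr2, if_pos (by omega)]
    congr 1; omega
  · rw [hr3, if_pos (by omega)]
    simp

/-- For the triples `(b, rk, c)` of the list, make the entries number `c * n`, …, `c * n + n - 1`
of the bank `rk` array `b`. -/
def loadProg : List (ℕ × ℕ × ℕ) → Prog
  | [] => .skip
  | t :: l => .seq (forUp 7 (.reg 4) (.wstore (Cmd.bank t.1) (.reg 7)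
      (.load t.2.1 (.add (.reg 7) (.mul (.const t.2.2) (.reg 4)))))) (loadProg l)

theorem runs_loadProg {w n : ℕ} (hw : 3 * n + 2 < 2 ^ w) : ∀ (l : List (ℕ × ℕ × ℕ)) (s : State),
    s.wreg 4 = n → (∀ t ∈ l, t.2.1 < 6 ∧ t.2.2 ≤ 2) → l.Pairwise (fun t t' => t.1 ≠ t'.1) →
    Runs w (loadProg l) s (l.length * ((n + 1) * 40) + 1) fun s' =>
      Same Cmd.Kept (fun b => ∀ t ∈ l, b ≠ Cmd.bank t.1) s s' ∧
      ∀ t ∈ l, ∀ i < n, s'.wmem (Cmd.bank t.1) i = s.wmem t.2.1 (t.2.2 * n + i)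
  | [], s, _, _, _ => Runs.skip (by simp) ⟨Same.refl _ _ s, by simp⟩
  | t :: l, s, h4, hl, hne => by
    obtain ⟨hne1, hne2⟩ := List.pairwise_cons.1 hne
    obtain ⟨ht1, ht2⟩ := hl t (by simp)
    have hmul : t.2.2 * n ≤ 2 * n := Nat.mul_le_mul_right n ht2
    refine Runs.seq ((n + 1) * 40) (l.length * ((n + 1) * 40) + 1)
      (by rw [List.length_cons, Nat.succ_mul l.length]; omega) ?_
    refine Cmd.runs_fill (B := 20) (R := Cmd.Kept) (Bk := (· ≠ Cmd.bank t.1)) (n := n)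
      (k := Cmd.bank t.1) (f := fun i => s.wmem t.2.1 (t.2.2 * n + i))
      (.inl (by omega)) (by simp [Cmd.Kept]) (by omega) h4 (by omega) ?_ ?_
    · intro i hi s' hs h7
      refine Cmd.runs_store h7 (by simp [WExpr.cost]) ?_
      simp only [WExpr.eval, h7, hs.wreg 4 (.inl (by omega)), h4]
      rw [hs.wmem _ (by simp only [Cmd.bank]; omega), Nat.mod_eq_of_lt (a := t.2.2) (by omega),
        Nat.mod_eq_of_lt (a := t.2.2 * n) (by omega), Nat.mod_eq_of_lt (by omega), Nat.add_comm]
    intro s1 hs1 hm1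
    refine (runs_loadProg hw l s1 ((hs1.wreg 4 (.inl (by omega))).trans h4)
      (fun t ht => hl t (List.mem_cons_of_mem _ ht)) hne2).mono le_rfl ?_
    rintro s2 ⟨hs2, hm2⟩
    refine ⟨(hs1.weaken (fun _ => id) fun b hb => hb t (by simp)).trans
      (hs2.weaken (fun _ => id) fun b hb t ht => hb t (List.mem_cons_of_mem _ ht)), ?_⟩
    intro t' ht' i hi
    rcases List.mem_cons.1 ht' with rfl | ht'
    · rw [hs2.wmem _ fun t'' h'' => ?_, hm1 i hi]
      have := hne1 t'' h''
      simp only [Cmd.bank]; omega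
    · rw [hm2 t' ht' i hi, hs1.wmem]
      have := (hl t' (List.mem_cons_of_mem _ ht')).1
      simp only [Cmd.bank]; omega

/-- The arrays of ranks that describe the input. -/
noncomputable def rankArrays (n : ℕ) (vx vy : ℕ → ℝ) (b i : ℕ) : ℕ :=
  rank (3 * n) (if b < 3 then vx else vy) (b % 3 * n + i)

/-- Initialise the arrays from the input. -/
def prepareProg : Prog :=
  .seq (.wset 4 (.reg 0)) (.seq (.wset 6 (.mul (.const 3) (.reg 0)))
  (.seq (.wset 5 (.add (.reg 6) (.const 3))) (.seq sqrtProg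
  (.seq (valuesProg 0 2 4) (.seq (valuesProg 1 3 5)
  (.seq (rankProg 4 0 1 2) (.seq (rankProg 5 3 4 5)
    (loadProg [(0, 2, 0), (1, 2, 1), (2, 2, 2), (3, 5, 0), (4, 5, 1), (5, 5, 2)]))))))))

/-- A bound for the running time of `prepareProg`. -/
noncomputable def prepareCost (n : ℕ) : ℕ :=
  (n + 1) * 600 + sqrtUp (3 * n) * 20 + 2 * rankCost (3 * n) (sqrtUp (3 * n))

/-- With K = 3n + 3, the ranks, being at most 3n, stay below the bound K - 2 that the array commands
need. -/
theorem runs_prepareProg {w n : ℕ} {s : State} (h0 : s.wreg 0 = n) (hm : ∀ b a, s.wmem b a = 0)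
    (hw : (3 * n + 3) ^ 30 ≤ 2 ^ w) :
    Runs w prepareProg s (prepareCost n) fun s' => ∃ vx vy : ℕ → ℝ,
      (∀ i < n, (vx i = s.rmem 0 i ∧ vx (n + i) = s.rmem 2 i ∧ vx (2 * n + i) = s.rmem 2 i + 1) ∧
        vy i = s.rmem 1 i ∧ vy (n + i) = s.rmem 3 i ∧ vy (2 * n + i) = s.rmem 3 i + 1) ∧
      Cmd.Sim n (3 * n + 3) 6 (rankArrays n vx vy) s' := by
  set S := sqrtUp (3 * n) with hS
  have hSle : S ≤ 3 * n + 1 := (sqrtUp_le _).trans (by have := Nat.sqrt_le_self (3 * n); omega)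
  have hK3 : (3 * n + 3) ^ 3 ≤ 2 ^ w := (Nat.pow_le_pow_right (by omega) (by omega)).trans hw
  have hSS : S * S + S + 1 < 2 ^ w := by
    have h1 : S * S ≤ (3 * n + 1) * (3 * n + 1) := Nat.mul_le_mul hSle hSle
    refine lt_of_lt_of_le ?_ hK3
    nlinarith
  have hn : 3 * n + 10 < 2 ^ w := by
    have h1 : 3 * 3 * (3 * n + 3) ≤ (3 * n + 3) * (3 * n + 3) * (3 * n + 3) := by gcongr <;> omega
    have h2 : (3 * n + 3) * (3 * n + 3) * (3 * n + 3) = (3 * n + 3) ^ 3 := by ring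
    omega
  simp only [prepareCost, ← hS]
  refine Runs.seq 2 ((n + 1) * 600 + S * 20 + 2 * rankCost (3 * n) S - 2) (by omega)
    (Runs.wset (by simp [WExpr.cost]) ?_)
  refine Runs.seq 4 ((n + 1) * 600 + S * 20 + 2 * rankCost (3 * n) S - 6) (by omega)
    (Runs.wset (by simp [WExpr.cost]) ?_)
  refine Runs.seq 4 ((n + 1) * 600 + S * 20 + 2 * rankCost (3 * n) S - 10) (by omega)
    (Runs.wset (by simp [WExpr.cost]) ?_)
  have h3 : 3 % 2 ^ w = 3 := Nat.mod_eq_of_lt (by omega)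
  have h3n : 3 * n % 2 ^ w = 3 * n := Nat.mod_eq_of_lt (by omega)
  have h3n3 : (3 * n + 3) % 2 ^ w = 3 * n + 3 := Nat.mod_eq_of_lt (by omega)
  simp only [WExpr.eval, setW_wreg, h0, h3, h3n, h3n3, if_true, Nat.reduceEqDiff, if_false]
  set s1 := ((s.setW 4 n).setW 6 (3 * n)).setW 5 (3 * n + 3) with hs1
  refine Runs.seq (S * 20 + 20) ((n + 1) * 600 + 2 * rankCost (3 * n) S - 30) (by omega)
    ((runs_sqrtProg (N := 3 * n) (by simp [hs1]) (by rw [← hS]; omega) le_rfl).mono le_rfl ?_)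
  rintro s2 ⟨hs2, h10⟩
  have r4 : s2.wreg 4 = n := by rw [hs2.wreg 4 (by omega)]; simp [hs1]
  have r5 : s2.wreg 5 = 3 * n + 3 := by rw [hs2.wreg 5 (by omega)]; simp [hs1]
  have r6 : s2.wreg 6 = 3 * n := by rw [hs2.wreg 6 (by omega)]; simp [hs1]
  have hm2 : ∀ b a, s2.wmem b a = 0 := fun b a => by
    rw [hs2.wmem b trivial]; simp [hs1, hm]
  have hr2 : s2.rmem = s.rmem := by rw [hs2.rmem]; simp [hs1]
  refine Runs.seq ((n + 1) * 120) ((n + 1) * 480 + 2 * rankCost (3 * n) S - 30) (by omega)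
    ((runs_valuesProg r4 (by omega) (by omega) (by omega)).mono le_rfl ?_)
  rintro s3 ⟨hs3, hv3⟩
  refine Runs.seq ((n + 1) * 120) ((n + 1) * 360 + 2 * rankCost (3 * n) S - 30) (by omega)
    ((runs_valuesProg ((hs3.wreg 4 (by omega)).trans r4) (by omega) (by omega)
      (by omega)).mono le_rfl ?_)
  rintro s4 ⟨hs4, hv4⟩
  have hw4 : ∀ r, r ≠ 7 → s4.wreg r = s2.wreg r := fun r hr =>
    (hs4.wreg r hr).trans (hs3.wreg r hr)
  have hm4 : ∀ b a, s4.wmem b a = 0 := fun b a => by rw [hs4.wmem, hs3.wmem, hm2]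
  refine Runs.seq (rankCost (3 * n) S) ((n + 1) * 360 + rankCost (3 * n) S - 30) (by omega)
    ((runs_rankProg (N := 3 * n) (S := S) (by omega) (by omega) (by omega)
    ((hw4 6 (by omega)).trans r6) ((hw4 10 (by omega)).trans h10) (le_sqrtUp_sq _) hSS (by omega)
    (hm4 0)).mono le_rfl ?_)
  rintro s5 ⟨hs5, hk5⟩
  refine Runs.seq (rankCost (3 * n) S) ((n + 1) * 360 - 30) (by omega)
    ((runs_rankProg (N := 3 * n) (S := S) (by omega) (by omega) (by omega)
    ((hs5.wreg 6 (by omega)).trans ((hw4 6 (by omega)).trans r6))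
    ((hs5.wreg 10 (by omega)).trans ((hw4 10 (by omega)).trans h10)) (le_sqrtUp_sq _) hSS
    (by omega) fun q => by rw [hs5.wmem 3 (by omega), hm4]).mono le_rfl ?_)
  rintro s6 ⟨hs6, hk6⟩
  refine (runs_loadProg (n := n) (by omega) _ s6 ?_ (by simp) (by simp)).mono
    (by simp only [List.length_cons, List.length_nil]; omega) ?_
  · rw [hs6.wreg 4 (by omega), hs5.wreg 4 (by omega), hw4 4 (by omega), r4]
  rintro s7 ⟨hs7, hl⟩
  simp only [List.forall_mem_cons, List.not_mem_nil, false_imp_iff, implies_true, and_true] at hl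
  obtain ⟨l0, l1, l2, l3, l4, l5⟩ := hl
  have k5 : ∀ i < 3 * n, s6.wmem 2 i = rank (3 * n) (s4.rmem 4) i := fun i hi => by
    rw [hs6.wmem 2 (by omega), hk5 i hi]
  have k6 : ∀ i < 3 * n, s6.wmem 5 i = rank (3 * n) (s4.rmem 5) i := fun i hi => by
    rw [hk6 i hi, hs5.rmem]
  refine ⟨s4.rmem 4, s4.rmem 5, fun i hi => ?_, ?_, ?_, ?_, ?_, ?_⟩
  · obtain ⟨a1, a2, a3⟩ := hv3 i hi
    obtain ⟨b1, b2, b3⟩ := hv4 i hi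
    rw [hs4.rmem 4 (by omega), a1, a2, a3, b1, b2, b3, hs3.rmem 1 (by omega),
      hs3.rmem 3 (by omega), hr2]
    simp
  · rw [hs7.wreg 4 (.inl (by omega)), hs6.wreg 4 (by omega), hs5.wreg 4 (by omega),
      hw4 4 (by omega), r4]
  · rw [hs7.wreg 5 (.inl (by omega)), hs6.wreg 5 (by omega), hs5.wreg 5 (by omega),
      hw4 5 (by omega), r5]
  · intro b hb i hi
    interval_cases b
    · rw [l0 i hi, k5 _ (by omega)]; rfl
    · rw [l1 i hi, k5 _ (by omega)]; rfl
    · rw [l2 i hi, k5 _ (by omega)]; rfl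
    · rw [l3 i hi, k6 _ (by omega)]; rfl
    · rw [l4 i hi, k6 _ (by omega)]; rfl
    · rw [l5 i hi, k6 _ (by omega)]; rfl
  · intro b hb i hi
    refine (rank_le _ ?_).trans (by omega)
    have : b % 3 * n ≤ 2 * n := Nat.mul_le_mul_right n (by omega)
    omega
  -- Sorting uses word banks 0 to 5 and the arrays use even banks, so the table banks, odd and at
  -- least 7, are still zero.
  · intro b hb a
    rw [hs7.wmem _ (by simp [Cmd.bank, Cmd.tableBank]; omega),
      hs6.wmem _ (by simp only [Cmd.tableBank]; omega),
      hs5.wmem _ (by simp only [Cmd.tableBank]; omega), hm4]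

/-! ### Reporting a solution -/

/-- Copy the last solution that is reported by the arrays of the triples in the list into the
registers `1`, `2`, `3` and set register `10` if there is any. -/
def reportsProg : List (ℕ × ℕ × ℕ) → Prog
  | [] => .skip
  | t :: l => .seq (forUp 7 (.reg 4) (.branch
      (.conj (.wlt (.const 0) (.load (Cmd.bank t.1) (.reg 7)))
        (.conj (.wlt (.const 0) (.load (Cmd.bank t.2.1) (.reg 7)))
          (.wlt (.const 0) (.load (Cmd.bank t.2.2) (.reg 7)))))
      (.seq (.wset 1 (.sub (.load (Cmd.bank t.1) (.reg 7)) (.const 1)))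
        (.seq (.wset 2 (.sub (.load (Cmd.bank t.2.1) (.reg 7)) (.const 1)))
        (.seq (.wset 3 (.sub (.load (Cmd.bank t.2.2) (.reg 7)) (.const 1)))
          (.wset 10 (.const 1))))) .skip)) (reportsProg l)

open ThreeSquares in
-- The proposition `H` accumulates the absence of hits in the triples already searched, which the
-- induction on the list needs.
theorem runs_reportsProg {w n K k : ℕ} {m : ℕ → ℕ → ℕ} {G : ℕ → ℕ → ℕ → Prop} (hn : n + 1 < 2 ^ w) :
    ∀ (l : List (ℕ × ℕ × ℕ)) (s : State) (H : Prop), Cmd.Sim n K k m s →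
    (∀ t ∈ l, t.1 < k ∧ t.2.1 < k ∧ t.2.2 < k) →
    (∀ t ∈ l, ∀ i < n, Hit m t i → G (m t.1 i - 1) (m t.2.1 i - 1) (m t.2.2 i - 1)) →
    (s.wreg 10 = 0 ∧ H ∨ s.wreg 10 = 1 ∧ G (s.wreg 1) (s.wreg 2) (s.wreg 3)) →
    Runs w (reportsProg l) s (l.length * ((n + 1) * 60) + 1) fun s' =>
      (s'.wreg 10 = 0 ∧ H ∧ ∀ t ∈ l, ∀ i < n, ¬ Hit m t i) ∨
        s'.wreg 10 = 1 ∧ G (s'.wreg 1) (s'.wreg 2) (s'.wreg 3)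
  | [], s, H, _, _, _, h0 => Runs.skip (by simp) (by simpa using h0)
  | t :: l, s, H, h, hk, hG, h0 => by
    obtain ⟨ht1, ht2, ht3⟩ := hk t (by simp)
    have hc1 : (1 : ℕ) % 2 ^ w = 1 := Nat.mod_eq_of_lt (by omega)
    refine Runs.seq ((n + 1) * 60) (l.length * ((n + 1) * 60) + 1)
      (by rw [List.length_cons, Nat.succ_mul l.length]; omega) ?_
    refine Runs.forUp (B := 40) n (fun i s' => s'.wreg 7 = i ∧ Cmd.Sim n K k m s' ∧
      ((s'.wreg 10 = 0 ∧ H ∧ ∀ j < i, ¬ Hit m t j) ∨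
        s'.wreg 10 = 1 ∧ G (s'.wreg 1) (s'.wreg 2) (s'.wreg 3)))
      (by omega) (by simp [WExpr.cost]; omega) ?_ ?_ ?_ ?_
    · exact ⟨by simp, ⟨by simpa using h.reg4, by simpa using h.reg5, h.mem, h.le, h.table⟩,
        by simpa using h0⟩
    · rintro i s' ⟨h7, hs, -⟩
      exact ⟨h7, hs.reg4⟩
    · rintro i hi s' ⟨h7, hs, hor⟩
      have e1 := hs.mem _ ht1 i hi
      have e2 := hs.mem _ ht2 i hi
      have e3 := hs.mem _ ht3 i hi
      refine Runs.branch (T₁ := 22) (by simp [Test.cost, WExpr.cost]) (fun ht => ?_) fun ht => ?_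
      · simp only [Test.Holds, WExpr.eval, h7, e1, e2, e3, Nat.zero_mod] at ht
        refine Runs.seq 5 17 (by omega) (Runs.wset (by simp [WExpr.cost]) ?_)
        refine Runs.seq 5 12 (by omega) (Runs.wset (by simp [WExpr.cost]) ?_)
        refine Runs.seq 5 7 (by omega) (Runs.wset (by simp [WExpr.cost]) ?_)
        refine Runs.wset (by simp [WExpr.cost]) ?_
        simp only [WExpr.eval, setW_wreg, setW_wmem, h7, e1, e2, e3, hc1, Nat.reduceEqDiff,
          if_false]
        refine ⟨trivial, by simp, ⟨by simpa using hs.reg4, by simpa using hs.reg5, hs.mem, hs.le,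
          hs.table⟩, .inr ⟨by simp, ?_⟩⟩
        simpa using hG t (by simp) i hi ht
      · simp only [Test.Holds, WExpr.eval, h7, e1, e2, e3, Nat.zero_mod] at ht
        refine Runs.skip (by omega) ⟨h7, by simp, ⟨by simpa using hs.reg4, by simpa using hs.reg5,
          hs.mem, hs.le, hs.table⟩, ?_⟩
        simp only [setW_wreg, Nat.reduceEqDiff, if_false]
        rcases hor with ⟨a, b, c⟩ | hor
        · refine .inl ⟨a, b, fun j hj => ?_⟩
          rcases Nat.lt_succ_iff_lt_or_eq.1 hj with hj | rfl
          · exact c j hj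
          · exact ht
        · exact .inr hor
    · rintro s' ⟨-, hs, hor⟩
      refine (runs_reportsProg hn l s' (H ∧ ∀ j < n, ¬ Hit m t j) hs
        (fun t ht => hk t (List.mem_cons_of_mem _ ht))
        (fun t ht => hG t (List.mem_cons_of_mem _ ht)) hor).mono le_rfl ?_
      rintro s'' (⟨a, ⟨b, c⟩, d⟩ | h'')
      · exact .inl ⟨a, b, List.forall_mem_cons.2 ⟨c, d⟩⟩
      · exact .inr h''

end RealRAM

namespace ThreeSquares
open RealRAM

/-! ### The algorithm -/

/-- Three squares that cover the points are found by ranking the coordinates and running the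
array commands. -/
def coverProg : Prog :=
  .seq prepareProg (.seq (Cmd.listProg 6 commands) (.seq (.wset 10 (.const 0))
    (.seq (reportsProg reports) (.wset 0 (.reg 10)))))

/-- A bound for the running time of `coverProg`. -/
noncomputable def coverCost (n : ℕ) : ℕ :=
  prepareCost n + Cmd.listCost n (Nat.clog 2 (3 * n + 3)) commands +
    reports.length * ((n + 1) * 60) + 20

section Ranks

variable {n : ℕ} {P R : Fin n → ℝ × ℝ} {vx vy : ℕ → ℝ}
  (hx : ∀ i : Fin n, vx i = (P i).1 ∧ vx (n + i) = (R i).1 ∧ vx (2 * n + i) = (R i).1 + 1)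
  (hy : ∀ i : Fin n, vy i = (P i).2 ∧ vy (n + i) = (R i).2 ∧ vy (2 * n + i) = (R i).2 + 1)

include hx hy in
-- Membership in a closed square consists of four comparisons ≤ between numbers of the same axis,
-- and ranks preserve these.
theorem covers_rankArrays_iff (i j k : Fin n) :
    Covers n (rankArrays n vx vy 0) (rankArrays n vx vy 3) (rankArrays n vx vy 1)
      (rankArrays n vx vy 2) (rankArrays n vx vy 4) (rankArrays n vx vy 5) i j k ↔
    CoverBy P R i j k := by
  have key : ∀ r p : Fin n, Contains (rankArrays n vx vy 0) (rankArrays n vx vy 3)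
      (rankArrays n vx vy 1) (rankArrays n vx vy 2) (rankArrays n vx vy 4)
      (rankArrays n vx vy 5) r p ↔ P p ∈ unitSquare (R r) := by
    intro r p
    obtain ⟨x1, -, -⟩ := hx p
    obtain ⟨-, x2, x3⟩ := hx r
    obtain ⟨y1, -, -⟩ := hy p
    obtain ⟨-, y2, y3⟩ := hy r
    have hr := r.2
    have hp := p.2
    simp only [Contains, rankArrays, Nat.reduceMod, Nat.reduceLT, if_true, if_false, zero_mul,
      zero_add, one_mul, lt_self_iff_false]
    rw [rank_le_rank _ (by omega), rank_le_rank _ (by omega), rank_le_rank _ (by omega),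
      rank_le_rank _ (by omega), x1, x2, x3, y1, y2, y3, unitSquare, Set.mem_prod, Set.mem_Icc,
      Set.mem_Icc, and_assoc]
  rw [CoverBy, Set.range_subset_iff, Covers, Fin.forall_iff]
  refine forall₂_congr fun p hp => ?_
  rw [key i ⟨p, hp⟩, key j ⟨p, hp⟩, key k ⟨p, hp⟩, Set.mem_union, Set.mem_union, or_assoc]

include hx hy in
-- Right sides are left sides shifted by 1, hence ordered alike, and so are upper and lower sides.
-- This is how the common size of the squares enters.
theorem instance_rankArrays :
    Instance n (3 * n) (rankArrays n vx vy 0) (rankArrays n vx vy 3) (rankArrays n vx vy 1)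
      (rankArrays n vx vy 2) (rankArrays n vx vy 4) (rankArrays n vx vy 5) := by
  have hle : ∀ b, ∀ i < n, rankArrays n vx vy b i ≤ 3 * n := fun b i hi => by
    have : b % 3 * n ≤ 2 * n := Nat.mul_le_mul_right n (by omega)
    exact rank_le _ (by omega)
  have hpos : ∀ b, ∀ i < n, 1 ≤ rankArrays n vx vy b i := fun b i _ => rank_pos _ _ _
  have hiff : ∀ (v : ℕ → ℝ) (c : Fin n → ℝ),
      (∀ i : Fin n, v (n + i) = c i ∧ v (2 * n + i) = c i + 1) → ∀ i < n, ∀ j < n,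
      rank (3 * n) v (n + i) ≤ rank (3 * n) v (n + j) ↔
        rank (3 * n) v (2 * n + i) ≤ rank (3 * n) v (2 * n + j) := by
    intro v c hv i hi j hj
    obtain ⟨h1, h2⟩ := hv ⟨i, hi⟩
    obtain ⟨h3, h4⟩ := hv ⟨j, hj⟩
    simp only at h1 h2 h3 h4
    rw [rank_le_rank _ (by omega), rank_le_rank _ (by omega), h1, h2, h3, h4, add_le_add_iff_right]
  refine ⟨hpos 0, hle 0, hpos 3, hle 3, hle 1, hle 2, hle 4, hle 5, ?_, ?_, hpos 1, hpos 2,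
    hpos 4, hpos 5⟩
  · simpa [rankArrays] using hiff vx (fun i => (R i).1) fun i => (hx i).2
  · simpa [rankArrays] using hiff vy (fun i => (R i).2) fun i => (hy i).2

end Ranks

theorem reports_lt : ∀ t ∈ reports, t.1 < 6 + commands.length ∧ t.2.1 < 6 + commands.length ∧
    t.2.2 < 6 + commands.length := by
  decide +kernel

theorem entry_fin {n : ℕ} (f : Fin n → ℝ) (i : Fin n) : entry f i = f i := by simp [entry]

theorem runs_coverProg {n w : ℕ} (hw : (3 * n + 3) ^ 30 ≤ 2 ^ w) (P R : Fin n → ℝ × ℝ) :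
    Runs w coverProg (inputState P R) (coverCost n) (CorrectAnswer P R) := by
  have hn : n + 1 < 2 ^ w := by
    have : (3 * n + 3) ^ 1 ≤ (3 * n + 3) ^ 30 := Nat.pow_le_pow_right (by omega) (by omega)
    rw [pow_one] at this
    omega
  have hc1 : (1 : ℕ) % 2 ^ w = 1 := Nat.mod_eq_of_lt (by omega)
  refine Runs.seq (prepareCost n) (Cmd.listCost n (Nat.clog 2 (3 * n + 3)) commands +
    (reports.length * ((n + 1) * 60) + 20)) (by simp only [coverCost]; omega)
    ((runs_prepareProg (n := n) (by simp [inputState]) (by simp [inputState]) hw).mono le_rfl ?_)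
  rintro s1 ⟨vx, vy, hv, hsim⟩
  have hx : ∀ i : Fin n, vx i = (P i).1 ∧ vx (n + i) = (R i).1 ∧
      vx (2 * n + i) = (R i).1 + 1 := fun i => by
    simpa [inputState, entry_fin] using (hv i i.2).1
  have hy : ∀ i : Fin n, vy i = (P i).2 ∧ vy (n + i) = (R i).2 ∧
      vy (2 * n + i) = (R i).2 + 1 := fun i => by
    simpa [inputState, entry_fin] using (hv i i.2).2
  refine Runs.seq _ _ le_rfl ((Cmd.runs_listProg (by omega) hw commands 6 _ s1 hsim
    Cmd.wfList_commands).mono le_rfl ?_)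
  rintro s2 ⟨-, m, hm, hsim2, hsol⟩
  have hI := instance_rankArrays hx hy
  have hcov := covers_rankArrays_iff hx hy
  rw [← hm 0 (by omega), ← hm 1 (by omega), ← hm 2 (by omega), ← hm 3 (by omega),
    ← hm 4 (by omega), ← hm 5 (by omega)] at hI hcov
  obtain ⟨hyes, hno⟩ := commands_spec hI hsol
  have hsim3 : Cmd.Sim n (3 * n + 3) (6 + commands.length) m
      (s2.setW 10 ((WExpr.const 0).eval w s2)) :=
    ⟨by simpa using hsim2.reg4, by simpa using hsim2.reg5, hsim2.mem, hsim2.le, hsim2.table⟩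
  refine Runs.seq 2 (reports.length * ((n + 1) * 60) + 18) (by omega)
    (Runs.wset (by simp [WExpr.cost]) ?_)
  refine Runs.seq (reports.length * ((n + 1) * 60) + 1) 17 (by omega)
    ((runs_reportsProg (G := fun i j k => ∃ hi : i < n, ∃ hj : j < n, ∃ hk : k < n,
      CoverBy P R ⟨i, hi⟩ ⟨j, hj⟩ ⟨k, hk⟩) hn reports _ True
      hsim3 reports_lt ?_
      (.inl ⟨by simp [WExpr.eval], trivial⟩)).mono le_rfl ?_)
  · intro t ht i hi hhit
    obtain ⟨a, ha, b, hb, c, hc, e1, e2, e3, hcv⟩ := hyes t ht i hi hhit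
    simp only [e1, e2, e3, Nat.add_sub_cancel]
    exact ⟨ha, hb, hc, (hcov ⟨a, ha⟩ ⟨b, hb⟩ ⟨c, hc⟩).1 hcv⟩
  rintro s3 hs3
  refine Runs.wset (by simp [WExpr.cost]) ?_
  rcases hs3 with ⟨h10, -, hnone⟩ | ⟨h10, h1, h2, h3, hcv⟩
  · refine .inr ⟨by simp [WExpr.eval, h10], ?_⟩
    rintro ⟨i, j, k, h⟩
    exact hno hnone i i.2 j j.2 k k.2 ((hcov i j k).2 h)
  · exact .inl ⟨by simp [WExpr.eval, h10], ⟨_, h1⟩, ⟨_, h2⟩, ⟨_, h3⟩, by simp, by simp, by simp,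
      hcv⟩

end ThreeSquares

/-! ### The running time -/

namespace RealRAM

theorem nestCost_le (L : ℕ) : ∀ k, nestCost L k ≤ 80 ^ (k + 1) * (L + 1) ^ k
  | 0 => by simp [nestCost]
  | k + 1 => by
    have ih := nestCost_le L k
    have h1 : 1 ≤ 80 ^ (k + 1) * (L + 1) ^ k := Nat.pos_of_ne_zero (by positivity)
    have h2 : 80 ^ (k + 1 + 1) * (L + 1) ^ (k + 1) =
        80 * ((L + 1) * (80 ^ (k + 1) * (L + 1) ^ k)) := by ring
    rw [nestCost, h2]
    generalize 80 ^ (k + 1) * (L + 1) ^ k = x at *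
    generalize nestCost L k = y at *
    nlinarith

namespace Cmd

theorem exists_cost_le (c : Cmd) :
    ∃ C e, ∀ n L, c.cost n L ≤ C * ((n + 1) * (L + 1) ^ e) := by
  have simple : ∃ C e, ∀ n L, (n + 1) * 100 ≤ C * ((n + 1) * (L + 1) ^ e) :=
    ⟨100, 0, fun n L => by rw [pow_zero]; omega⟩
  cases c with
  | dom cs v =>
    refine ⟨2 * 80 ^ (cs.length + 1) + 100, cs.length, fun n L => ?_⟩
    have h1 := nestCost_le L cs.length
    have h2 : 1 ≤ (L + 1) ^ cs.length := Nat.pos_of_ne_zero (by positivity)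
    calc (n + 1) * (2 * nestCost L cs.length + 100)
        ≤ (n + 1) * (2 * (80 ^ (cs.length + 1) * (L + 1) ^ cs.length) +
          100 * (L + 1) ^ cs.length) := by gcongr; omega
      _ = _ := by ring
  | co b => exact simple
  | gather b c => exact simple
  | iota => exact simple
  | filt v b c => exact simple

theorem exists_listCost_le : ∀ cs : List Cmd,
    ∃ C e, ∀ n L, listCost n L cs ≤ C * ((n + 1) * (L + 1) ^ e)
  | [] => ⟨1, 0, fun n L => by simp [listCost]⟩
  | c :: cs => by
    obtain ⟨C, e, h⟩ := exists_cost_le c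
    obtain ⟨C', e', h'⟩ := exists_listCost_le cs
    refine ⟨C + C', max e e', fun n L => ?_⟩
    rw [listCost, Nat.add_mul]
    refine Nat.add_le_add ((h n L).trans ?_) ((h' n L).trans ?_)
    · gcongr
      · omega
      · exact le_max_left _ _
    · gcongr
      · omega
      · exact le_max_right _ _

end Cmd

theorem three_mul_add_three_le (n : ℕ) : 3 * n + 3 ≤ 2 ^ (Nat.log 2 n + 3) := by
  have h : n < 2 ^ (Nat.log 2 n + 1) := Nat.lt_pow_succ_log_self (by norm_num) n
  have : 2 ^ (Nat.log 2 n + 3) = 4 * 2 ^ (Nat.log 2 n + 1) := by ring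
  omega

/-- Ranking N = 3n numbers with S of order √n costs of order N S + S²; this is the source of the
exponent 3/2. -/
theorem prepareCost_le (n : ℕ) : prepareCost n ≤ 7000 * ((n + 1) * (Nat.sqrt n + 1)) := by
  have hs1 : Nat.sqrt n * Nat.sqrt n ≤ n := Nat.sqrt_le n
  have hs2 : n < (Nat.sqrt n + 1) * (Nat.sqrt n + 1) := Nat.lt_succ_sqrt n
  have hS : sqrtUp (3 * n) ≤ 2 * (Nat.sqrt n + 1) := by
    have : Nat.sqrt (3 * n) < 2 * (Nat.sqrt n + 1) := Nat.sqrt_lt.2 (by nlinarith)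
    have := sqrtUp_le (3 * n)
    omega
  have hS2 : sqrtUp (3 * n) * sqrtUp (3 * n) ≤ 8 * (n + 1) := by
    have h1 := Nat.mul_le_mul hS hS
    have h2 : 2 * Nat.sqrt n ≤ Nat.sqrt n * Nat.sqrt n + 1 := by
      nlinarith [two_mul_le_add_sq (Nat.sqrt n) 1]
    nlinarith
  have hnS : n * sqrtUp (3 * n) ≤ 2 * ((n + 1) * (Nat.sqrt n + 1)) := by
    calc n * sqrtUp (3 * n) ≤ (n + 1) * (2 * (Nat.sqrt n + 1)) := by gcongr; omega
      _ = _ := by ring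
  have hu : n + 1 ≤ (n + 1) * (Nat.sqrt n + 1) := Nat.le_mul_of_pos_right _ (by omega)
  have hv : Nat.sqrt n + 1 ≤ (n + 1) * (Nat.sqrt n + 1) := Nat.le_mul_of_pos_left _ (by omega)
  have hcost : rankCost (3 * n) (sqrtUp (3 * n)) = 360 * (n * sqrtUp (3 * n)) + 1200 * n +
      60 * (sqrtUp (3 * n) * sqrtUp (3 * n)) + 200 * sqrtUp (3 * n) + 200 := by
    simp only [rankCost]; ring
  rw [prepareCost, hcost]
  omega

end RealRAM

namespace ThreeSquares
open RealRAM

theorem exists_coverCost_le : ∃ C e, ∀ n, coverCost n ≤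
    C * ((n + 1) * (Nat.sqrt n + 1) * (Nat.log 2 n + 4) ^ e) := by
  obtain ⟨C, e, h⟩ := Cmd.exists_listCost_le commands
  refine ⟨7000 + C + reports.length * 60 + 20, e, fun n => ?_⟩
  have hL : Nat.clog 2 (3 * n + 3) + 1 ≤ Nat.log 2 n + 4 :=
    Nat.succ_le_succ (Nat.clog_le_of_le_pow (three_mul_add_three_le n))
  have h1 := h n (Nat.clog 2 (3 * n + 3))
  have h2 := prepareCost_le n
  set x := (n + 1) * (Nat.sqrt n + 1) with hx
  set y := (Nat.log 2 n + 4) ^ e with hy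
  have hy1 : 1 ≤ y := Nat.pos_of_ne_zero (by positivity)
  have hnx : n + 1 ≤ x := Nat.le_mul_of_pos_right _ (by omega)
  have hxy : x ≤ x * y := Nat.le_mul_of_pos_right _ hy1
  have h3 : C * ((n + 1) * (Nat.clog 2 (3 * n + 3) + 1) ^ e) ≤ C * (x * y) := by
    rw [hx, hy, Nat.mul_assoc (n + 1)]
    gcongr
    exact le_trans (Nat.pow_le_pow_left hL e) (Nat.le_mul_of_pos_left _ (by omega))
  have h4 : reports.length * ((n + 1) * 60) ≤ reports.length * 60 * (x * y) := by
    calc reports.length * ((n + 1) * 60) = reports.length * 60 * (n + 1) := by ring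
      _ ≤ _ := Nat.mul_le_mul_left _ (hnx.trans hxy)
  have h5 : (7000 + C + reports.length * 60 + 20) * (x * y) = 7000 * (x * y) + C * (x * y) +
      reports.length * 60 * (x * y) + 20 * (x * y) := by ring
  rw [coverCost, h5]
  omega

theorem isSoftO_coverCost : IsSoftO coverCost fun n => (n : ℝ) ^ (3 / 2 : ℝ) := by
  obtain ⟨C, e, h⟩ := exists_coverCost_le
  -- For n ≥ 3 the logarithm is at least 1. The constant 4 * 6^e comes from n + 1 ≤ 2n, ⌊√n⌋ + 1 ≤
  -- 2√n and ⌊log₂ n⌋ + 4 ≤ 6 log n.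
  refine ⟨e, IsBigO.of_bound (C * (4 * 6 ^ e)) (eventually_atTop.2 ⟨3, fun n hn => ?_⟩)⟩
  have hn3 : (3 : ℝ) ≤ n := by exact_mod_cast hn
  have hlog : 1 ≤ Real.log n := by
    rw [Real.le_log_iff_exp_le (by linarith)]
    linarith [Real.exp_one_lt_d9]
  have hsqrt : (1 : ℝ) ≤ √n := Real.one_le_sqrt.2 (by linarith)
  have h1 : (Nat.log 2 n : ℝ) + 4 ≤ 6 * Real.log n := by
    have h2 : (Nat.log 2 n : ℝ) ≤ Real.logb 2 n := by
      exact_mod_cast Real.natLog_le_logb n 2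
    have h3 : Real.logb 2 n ≤ 2 * Real.log n := by
      rw [Real.logb, div_le_iff₀ (by positivity)]
      nlinarith [Real.log_two_gt_d9]
    linarith
  have h2 : (Nat.sqrt n : ℝ) + 1 ≤ 2 * √n := by
    linarith [Real.nat_sqrt_le_real_sqrt (a := n)]
  have h3 : (n : ℝ) ^ (3 / 2 : ℝ) = n * √n := by
    rw [Real.sqrt_eq_rpow, ← Real.rpow_one_add' (by linarith) (by norm_num)]
    norm_num
  rw [Real.norm_of_nonneg (by positivity), Real.norm_of_nonneg (by positivity)]
  simp only [h3]
  calc (coverCost n : ℝ)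
      ≤ C * (((n : ℝ) + 1) * (Nat.sqrt n + 1) * (Nat.log 2 n + 4) ^ e) := by exact_mod_cast h n
    _ ≤ C * ((2 * n) * (2 * √n) * (6 * Real.log n) ^ e) := by
        gcongr
        linarith
    _ = _ := by rw [mul_pow]; ring

end ThreeSquares

theorem mainTheorem11 :
    ∃ (prog : RealRAM.Prog) (κ : ℕ) (T : ℕ → ℕ),
      IsSoftO T (fun n => (n : ℝ) ^ (3 / 2 : ℝ)) ∧
      ∀ (n w : ℕ), κ * (Nat.log 2 n + 1) ≤ w →
        ∀ (P R : Fin n → ℝ × ℝ),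
          ∃ (t : ℕ) (s : RealRAM.State),
            t ≤ T n ∧ RealRAM.Exec w prog (inputState P R) t s ∧ CorrectAnswer P R s := by
  -- Addresses have up to 30 digits in base 3n + 3 ≤ 2^(⌊log₂ n⌋ + 3), and 30 (⌊log₂ n⌋ + 3) ≤ 120
  -- (⌊log₂ n⌋ + 1).
  refine ⟨ThreeSquares.coverProg, 120, ThreeSquares.coverCost, ThreeSquares.isSoftO_coverCost,
    fun n w hw P R => ThreeSquares.runs_coverProg ?_ P R⟩
  calc (3 * n + 3) ^ 30 ≤ (2 ^ (Nat.log 2 n + 3)) ^ 30 :=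
        Nat.pow_le_pow_left (RealRAM.three_mul_add_three_le n) 30
    _ = 2 ^ ((Nat.log 2 n + 3) * 30) := (pow_mul _ _ _).symm
    _ ≤ 2 ^ w := Nat.pow_le_pow_right (by norm_num) (by omega)
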